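/- Let $X$ be a complex manifold (Hausdorff, second countable, of finite dimension). Let $\omega=\sum_{p}\omega_p$ be a smooth real differential form on $X$ whose components $\omega_p$ are of type $(p,p)$, and suppose that $\omega$ is $\bar\partial\partial$-exact, i.e. $\omega=\bar\partial\partial\eta$ for some smooth complex-valued differential form $\eta$ on $X$. Then there are an integer $r\ge 0$ and two smooth Hermitian metrics $h_1,h_2$ on the trivial holomorphic vector bundle $E=X\times\mathbb{C}^r$ such that $$\mathrm{ch}(E,h_1)-\mathrm{ch}(E,h_2)=\omega .$$ Here a Hermitian metric on $E$ is a smooth function $h$ on $X$ with values in positive-definite Hermitian $r\times r$ matrices, and its Chern character form is $$\mathrm{ch}(E,h)=\mathrm{Tr}\exp\Big(\frac{\sqrt{-1}}{2\pi}\,\Theta\Big)=\sum_{p\ge 0}\frac{1}{p!}\Big(\frac{\sqrt{-1}}{2\pi}\Big)^{p}\,\mathrm{Tr}\,\Theta^{p},\qquad \Theta=\bar\partial\big(h^{-1}\partial h\big),$$ where $\Theta$ is the curvature of the canonical (Chern) connection $d+h^{-1}\partial h$ of $(E,h)$. -/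

import Mathlib

open scoped Manifold ContDiff Topology ComplexOrder ComplexConjugate

noncomputable section

namespace ChernForms

/-! ### Complex-valued alternating forms on a complex vector space -/

section Pointwise

variable {V : Type*} [NormedAddCommGroup V] [NormedSpace ℂ V]

/-- The tensor product `(v₁, …, v_{p+q}) ↦ α(v₁, …, v_p) β(v_{p+1}, …, v_{p+q})`. -/
def tensor {p q : ℕ} (α : V [⋀^Fin p]→L[ℝ] ℂ) (β : V [⋀^Fin q]→L[ℝ] ℂ) :
    ContinuousMultilinearMap ℝ (fun _ : Fin (p + q) => V) ℂ where
  toFun v := α (fun i => v (Fin.castAdd q i)) * β (fun j => v (Fin.natAdd p j))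
  map_update_add' := by
    intro inst v i x y
    obtain rfl : inst = instDecidableEqFin (p + q) := Subsingleton.elim _ _
    induction i using Fin.addCases with
    | left i =>
      have h1 : ∀ x, (fun k => Function.update v (Fin.castAdd q i) x (Fin.castAdd q k)) =
          Function.update (fun k => v (Fin.castAdd q k)) i x := fun x => by
        ext k; simp [Function.update_apply]
      have h2 : ∀ x, (fun k => Function.update v (Fin.castAdd q i) x (Fin.natAdd p k)) =
          fun k => v (Fin.natAdd p k) := fun x => by
        ext k; simp [Function.update_apply, Fin.ext_iff]; omega
      simp only [h1, h2, α.map_update_add, add_mul]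
    | right i =>
      have h1 : ∀ x, (fun k => Function.update v (Fin.natAdd p i) x (Fin.natAdd p k)) =
          Function.update (fun k => v (Fin.natAdd p k)) i x := fun x => by
        ext k; simp [Function.update_apply]
      have h2 : ∀ x, (fun k => Function.update v (Fin.natAdd p i) x (Fin.castAdd q k)) =
          fun k => v (Fin.castAdd q k) := fun x => by
        ext k; simp [Function.update_apply, Fin.ext_iff]; omega
      simp only [h1, h2, β.map_update_add, mul_add]
  map_update_smul' := by
    intro inst v i c x
    obtain rfl : inst = instDecidableEqFin (p + q) := Subsingleton.elim _ _
    induction i using Fin.addCases with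
    | left i =>
      have h1 : ∀ x, (fun k => Function.update v (Fin.castAdd q i) x (Fin.castAdd q k)) =
          Function.update (fun k => v (Fin.castAdd q k)) i x := fun x => by
        ext k; simp [Function.update_apply]
      have h2 : ∀ x, (fun k => Function.update v (Fin.castAdd q i) x (Fin.natAdd p k)) =
          fun k => v (Fin.natAdd p k) := fun x => by
        ext k; simp [Function.update_apply, Fin.ext_iff]; omega
      simp only [h1, h2, α.map_update_smul, smul_mul_assoc]
    | right i =>
      have h1 : ∀ x, (fun k => Function.update v (Fin.natAdd p i) x (Fin.natAdd p k)) =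
          Function.update (fun k => v (Fin.natAdd p k)) i x := fun x => by
        ext k; simp [Function.update_apply]
      have h2 : ∀ x, (fun k => Function.update v (Fin.natAdd p i) x (Fin.castAdd q k)) =
          fun k => v (Fin.castAdd q k) := fun x => by
        ext k; simp [Function.update_apply, Fin.ext_iff]; omega
      simp only [h1, h2, β.map_update_smul, mul_smul_comm]
  cont := (α.cont.comp (continuous_pi fun _ => continuous_apply _)).mul
    (β.cont.comp (continuous_pi fun _ => continuous_apply _))

/-- The wedge product of complex-valued real-multilinear alternating forms,
`(α ∧ β)(v) = 1 / (p! q!) * ∑ σ, sgn σ * α(v_{σ 1}, …, v_{σ p}) β(v_{σ (p+1)}, …, v_{σ (p+q)})`,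
so that `(α ∧ β)(v, w) = α(v) β(w) - α(w) β(v)` for covectors `α`, `β`. -/
def wedge {p q : ℕ} (α : V [⋀^Fin p]→L[ℝ] ℂ) (β : V [⋀^Fin q]→L[ℝ] ℂ) :
    V [⋀^Fin (p + q)]→L[ℝ] ℂ :=
  (1 / ((p.factorial : ℂ) * (q.factorial : ℂ))) •
    ContinuousMultilinearMap.alternatization (tensor α β)

theorem wedge_apply {p q : ℕ} (α : V [⋀^Fin p]→L[ℝ] ℂ) (β : V [⋀^Fin q]→L[ℝ] ℂ)
    (v : Fin (p + q) → V) :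
    wedge α β v = (1 / ((p.factorial : ℂ) * (q.factorial : ℂ))) *
      ∑ σ : Equiv.Perm (Fin (p + q)), ((Equiv.Perm.sign σ : ℤ) : ℂ) *
        (α (fun i => v (σ (Fin.castAdd q i))) * β (fun j => v (σ (Fin.natAdd p j)))) := by
  simp [wedge, ContinuousMultilinearMap.alternatization_apply_apply, Units.smul_def]
  exact Or.inl rfl

/-- Multiplication by `i`, as a real-linear endomorphism. -/
def mulI : V →L[ℝ] V := (Complex.I • ContinuousLinearMap.id ℂ V).restrictScalars ℝ

/-- The operator `∂` on an open set of `V`. The real derivative `Dα` is replaced by its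
complex-linear part `v ↦ (Dα(v) - i Dα(iv)) / 2` and then antisymmetrized; in linear coordinates,
`∂(f dz_I ∧ dz̄_J) = ∑ j, (∂f/∂z_j) dz_j ∧ dz_I ∧ dz̄_J`. -/
def localDel {k : ℕ} (α : V → V [⋀^Fin k]→L[ℝ] ℂ) (z : V) : V [⋀^Fin (k + 1)]→L[ℝ] ℂ :=
  .alternatizeUncurryFin
    ((1 / 2 : ℂ) • (fderiv ℝ α z - Complex.I • (fderiv ℝ α z).comp mulI))

/-- The operator `∂̄` on an open set of `V`, from the complex-antilinear part
`v ↦ (Dα(v) + i Dα(iv)) / 2` of the real derivative; in linear coordinates,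
`∂̄(f dz_I ∧ dz̄_J) = ∑ j, (∂f/∂z̄_j) dz̄_j ∧ dz_I ∧ dz̄_J`. -/
def localDelbar {k : ℕ} (α : V → V [⋀^Fin k]→L[ℝ] ℂ) (z : V) : V [⋀^Fin (k + 1)]→L[ℝ] ℂ :=
  .alternatizeUncurryFin
    ((1 / 2 : ℂ) • (fderiv ℝ α z + Complex.I • (fderiv ℝ α z).comp mulI))

end Pointwise

/-! ### Differential forms on a complex manifold -/

/-- Complex-valued differential `k`-forms (not necessarily smooth) on a complex manifold `X`
modelled on `V`. The tangent space of `X` at `x` is `TangentSpace 𝓘(ℂ, V) x`, which is `V`,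
identified through the preferred chart `chartAt V x`. -/
abbrev Form (V X : Type*) [NormedAddCommGroup V] [NormedSpace ℂ V] (k : ℕ) : Type _ :=
  X → V [⋀^Fin k]→L[ℝ] ℂ

section Forms

variable {V : Type*} [NormedAddCommGroup V] [NormedSpace ℂ V]
  {X : Type*} [TopologicalSpace X] [ChartedSpace V X]

/-- A function as a `0`-form. -/
def ofFunction (V : Type*) [NormedAddCommGroup V] [NormedSpace ℂ V] {X : Type*} (f : X → ℂ) :
    Form V X 0 :=
  fun x => ContinuousAlternatingMap.constOfIsEmpty ℝ V (Fin 0) (f x)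

/-- The expression of a form in a chart: its pull-back by the inverse of the chart. -/
def inChart {k : ℕ} (α : Form V X k) (e : OpenPartialHomeomorph X V) :
    V → V [⋀^Fin k]→L[ℝ] ℂ := fun z =>
  let T : V →L[ℂ] V := mfderiv 𝓘(ℂ, V) 𝓘(ℂ, V) e.symm z
  (α (e.symm z)).compContinuousLinearMap (T.restrictScalars ℝ)

/-- A form is smooth if its expression in every chart is (real) `C^∞`. -/
def IsSmooth {k : ℕ} (α : Form V X k) : Prop :=
  ∀ e ∈ atlas V X, ContDiffOn ℝ ∞ (inChart α e) e.target

/-- A form is real if it takes real values on (real) tangent vectors. -/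
def IsReal {k : ℕ} (α : Form V X k) : Prop :=
  ∀ x v, conj (α x v) = α x v

/-- A form of degree `k = p + q` is of type `(p, q)` if multiplying all the tangent vectors by a
complex number `c` multiplies its values by `c ^ p * c̄ ^ q`. Since `dz_I ∧ dz̄_J` is
multiplied by `c ^ |I| * c̄ ^ |J|`, this says that only terms with `|I| = p`, `|J| = q` occur. -/
def IsOfType {k : ℕ} (p q : ℕ) (α : Form V X k) : Prop :=
  ∀ x (c : ℂ) (v : Fin k → V), α x (fun i => c • v i) = c ^ p * conj c ^ q * α x v

/-- The operator `∂`, computed at `x` in the preferred holomorphic chart at `x` (in which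
the tangent space at `x` is identified with `V` by the identity). -/
def del {k : ℕ} (α : Form V X k) : Form V X (k + 1) :=
  fun x => localDel (inChart α (chartAt V x)) (chartAt V x x)

/-- The operator `∂̄`, computed at `x` in the preferred holomorphic chart at `x`. -/
def delbar {k : ℕ} (α : Form V X k) : Form V X (k + 1) :=
  fun x => localDelbar (inChart α (chartAt V x)) (chartAt V x x)

/-- `∂̄∂` on inhomogeneous forms of even degree, given by their components `η p` of degree `2p`;
the component of degree `2(p + 1)` of the result is `∂̄∂(η p)`. -/
def delbarDel (η : (p : ℕ) → Form V X (2 * p)) : (p : ℕ) → Form V X (2 * p)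
  | 0 => 0
  | p + 1 => delbar (del (η p))

/-- A family of forms of degrees `0, 2, 4, …` is the family of components of a real smooth
form in `⨁ p, A^{p,p}(X)`. -/
structure IsRealDiagonal (w : (p : ℕ) → Form V X (2 * p)) : Prop where
  smooth : ∀ p, IsSmooth (w p)
  type : ∀ p, IsOfType p p (w p)
  real : ∀ p, IsReal (w p)

/-- `w = ∂̄∂η` for some smooth complex form `η`. -/
def IsDelbarDelExact (w : (p : ℕ) → Form V X (2 * p)) : Prop :=
  ∃ η : (p : ℕ) → Form V X (2 * p), (∀ p, IsSmooth (η p)) ∧ w = delbarDel η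

end Forms

/-! ### Hermitian metrics on trivial bundles and their Chern character forms -/

/-- A (smooth) Hermitian metric on the trivial holomorphic vector bundle `X × ℂ^r`. -/
structure HermitianMetric (V X : Type*) [NormedAddCommGroup V] [NormedSpace ℂ V]
    [TopologicalSpace X] [ChartedSpace V X] (r : ℕ) where
  toFun : X → Matrix (Fin r) (Fin r) ℂ
  smooth : ∀ i j, ContMDiff 𝓘(ℝ, V) 𝓘(ℝ, ℂ) ∞ fun x => toFun x i j
  posDef : ∀ x, (toFun x).PosDef

section Chern

variable {V : Type*} [NormedAddCommGroup V] [NormedSpace ℂ V]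
  {X : Type*} [TopologicalSpace X] [ChartedSpace V X] {r : ℕ}

/-- The product of matrices of differential forms. -/
def matrixWedge {p q : ℕ} (A : Matrix (Fin r) (Fin r) (Form V X p))
    (B : Matrix (Fin r) (Fin r) (Form V X q)) : Matrix (Fin r) (Fin r) (Form V X (p + q)) :=
  fun i j x => ∑ l, wedge (A i l x) (B l j x)

/-- The connection form `A = h⁻¹ ∂h` of the canonical connection `d + A` of a Hermitian metric. -/
def HermitianMetric.connection (h : HermitianMetric V X r) :
    Matrix (Fin r) (Fin r) (Form V X 1) :=
  fun i j x => ∑ l, (h.toFun x)⁻¹ i l • del (ofFunction V fun y => h.toFun y l j) x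

/-- The curvature form `Θ = ∂̄A` of the canonical connection of a Hermitian metric. -/
def HermitianMetric.curvature (h : HermitianMetric V X r) :
    Matrix (Fin r) (Fin r) (Form V X 2) :=
  fun i j => delbar (h.connection i j)

/-- The powers `Θ^p` of the curvature form. -/
def HermitianMetric.curvaturePow (h : HermitianMetric V X r) :
    (p : ℕ) → Matrix (Fin r) (Fin r) (Form V X (2 * p))
  | 0 => fun i j => ofFunction V fun _ => (1 : Matrix (Fin r) (Fin r) ℂ) i j
  | p + 1 => matrixWedge (h.curvaturePow p) h.curvature

/-- The Chern character form `ch(X × ℂ^r, h) = Tr exp(iΘ / 2π)`; its component of degree `2p` is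
`ch_p = (1 / p!) (i / 2π)^p Tr Θ^p`. -/
def HermitianMetric.chernCharacter (h : HermitianMetric V X r) (p : ℕ) : Form V X (2 * p) :=
  ((1 / (p.factorial : ℂ)) * (Complex.I / (2 * (Real.pi : ℂ))) ^ p) •
    Matrix.trace (h.curvaturePow p)

end Chern

end ChernForms

end

/-! Diagonal metrics suffice. For `diag(e^{u_1}, …, e^{u_r})` with real smooth `u_i` the connection
form is `diag(∂u_i)` and the curvature is `diag(∂̄∂u_i)`, so the Chern character form is the sum
over `i` of `∑ p, (1/p!) (i/2π)^p (∂̄∂u_i)^p`. Direct sums turn the differences of such forms into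
an additive group, `chernDiff`, and it is enough to show that `ω` lies in it.

Polarization. The product `∂̄∂u_1 ∧ ⋯ ∧ ∂̄∂u_p` is multilinear and symmetric in the `u_i`. The
alternating sum of `ch(e^{u_S})` over the subsets `S` of `{1, …, k}`, with `u_S = ∑ j ∈ S, u_j`,
keeps in degree `2p` only the products indexed by surjections from `{1, …, p}` to `{1, …, k}`. There
are none for `p < k`; for `p = k` the result is exactly `(i/2π)^k ∂̄∂u_1 ∧ ⋯ ∧ ∂̄∂u_k`; for `p > k`
only products with more factors remain. Products with many factors vanish for reasons of dimension,
so descending induction on `k` puts every single product into the group (`single_ddbarProd_mem`).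

Generation. It remains to write each component `∂̄∂η` as a sum of such products. Averaging `η` over
rotations of the tangent vectors by roots of unity projects it to its `(p, p)` part and leaves
`∂̄∂η` unchanged, because the latter is of type `(p + 1, p + 1)`. General position provides real
functions `f_a` whose differentials span every cotangent space (`exists_immersion`). By the Leibniz
rule the forms `∂̄∂f_a` and `∂̄∂(f_a f_b)` then span the `(1, 1)`-forms at each point, and their
`p`-fold products span the `(p, p)`-forms. A projection argument and a partition of unity make the
coefficients smooth (`exists_rootAvg_eq`): the average of `η` is `∑ J, g_J ∂̄∂F_{J,1} ∧ ⋯ ∧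
∂̄∂F_{J,p}`. All the 2-forms here are closed under `∂` and `∂̄`, so `∂̄∂η = ∑ J, ∂̄∂g_J ∧ ∂̄∂F_{J,1}
∧ ⋯ ∧ ∂̄∂F_{J,p}` (`localDelbar_localDel_smul_wprod`). Finally the complex `g_J` are split into real
and imaginary parts after division by `(i/2π)^(p+1)`, and the reality of `ω` removes the imaginary
contribution. -/

noncomputable section

namespace ChernForms

open Equiv

/-! ### Antisymmetrization of functions of several variables -/

section AltSum

variable {ι κ V : Type*} [Fintype ι] [DecidableEq ι] [Fintype κ] [DecidableEq κ]

/-- The antisymmetrization `∑ σ, sgn σ * T (v ∘ σ)` of a function `T` of `ι`-tuples. -/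
def altSum (T : (ι → V) → ℂ) (v : ι → V) : ℂ :=
  ∑ σ : Perm ι, ((Perm.sign σ : ℤ) : ℂ) * T (v ∘ σ)

theorem sign_mul_self_cast (τ : Perm ι) :
    ((Perm.sign τ : ℤ) : ℂ) * ((Perm.sign τ : ℤ) : ℂ) = 1 := by
  rcases Int.units_eq_one_or (Perm.sign τ) with h | h <;> simp [h]

theorem altSum_comp_perm (T : (ι → V) → ℂ) (τ : Perm ι) (v : ι → V) :
    altSum (fun u => T (u ∘ τ)) v = ((Perm.sign τ : ℤ) : ℂ) * altSum T v := by
  unfold altSum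
  rw [Finset.mul_sum]
  refine Fintype.sum_equiv (Equiv.mulRight τ) _ _ fun σ => ?_
  rw [Equiv.coe_mulRight, Perm.sign_mul]
  push_cast
  rw [Function.comp_assoc]
  linear_combination (-((Perm.sign σ : ℤ) : ℂ) * T (v ∘ σ ∘ τ)) * sign_mul_self_cast τ

theorem altSum_add (S T : (ι → V) → ℂ) (v : ι → V) :
    altSum (fun u => S u + T u) v = altSum S v + altSum T v := by
  simp [altSum, mul_add, Finset.sum_add_distrib]

theorem altSum_const_mul (c : ℂ) (T : (ι → V) → ℂ) (v : ι → V) :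
    altSum (fun u => c * T u) v = c * altSum T v := by
  simp only [altSum, Finset.mul_sum]
  exact Finset.sum_congr rfl fun σ _ => by ring

theorem altSum_sum {α : Type*} (s : Finset α) (T : α → (ι → V) → ℂ) (v : ι → V) :
    altSum (fun u => ∑ a ∈ s, T a u) v = ∑ a ∈ s, altSum (T a) v := by
  simp only [altSum, Finset.mul_sum]
  exact Finset.sum_comm

/-- Partial antisymmetrization in a subset of the variables is absorbed by the full one. -/
theorem altSum_altSum (φ : Perm κ → Perm ι) (hφ : ∀ τ, Perm.sign (φ τ) = Perm.sign τ)
    (T : (ι → V) → ℂ) (v : ι → V) :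
    altSum (fun u => ∑ τ : Perm κ, ((Perm.sign τ : ℤ) : ℂ) * T (u ∘ φ τ)) v =
      ((Fintype.card κ).factorial : ℂ) * altSum T v := by
  rw [altSum_sum]
  have : ∀ τ : Perm κ, altSum (fun u => ((Perm.sign τ : ℤ) : ℂ) * T (u ∘ φ τ)) v =
      altSum T v := fun τ => by
    rw [altSum_const_mul, altSum_comp_perm, hφ, ← mul_assoc, sign_mul_self_cast, one_mul]
  simp [this, Fintype.card_perm]

/-- If the sum of `T` over the rotations of three of its variables vanishes, then so does its
antisymmetrization. -/
theorem altSum_eq_zero_of_rotate (ρ : Perm ι) (hρ : Perm.sign ρ = 1) (T : (ι → V) → ℂ)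
    (h : ∀ u, T u + T (u ∘ ρ) + T (u ∘ ρ ∘ ρ) = 0) (v : ι → V) : altSum T v = 0 := by
  have h1 := altSum_comp_perm T ρ v
  have h2 := altSum_comp_perm T (ρ * ρ) v
  have h3 : altSum (fun u => T u + T (u ∘ ρ) + T (u ∘ ρ ∘ ρ)) v = 0 := by
    simp only [h]; simp [altSum]
  rw [altSum_add, altSum_add, h1] at h3
  have h4 : altSum (fun u => T (u ∘ ρ ∘ ρ)) v = altSum T v := by
    simpa [hρ] using h2
  rw [h4] at h3
  simp only [hρ, Units.val_one, Int.cast_one, one_mul] at h3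
  linear_combination h3 / 3

/-- The permutations fixing `0` form a copy of `Perm (Fin k)` with the same signs, so the inner
antisymmetrization is absorbed by the outer one at the cost of `k!`. -/
theorem altSum_uncurry {k : ℕ} (T : V → (Fin k → V) → ℂ) (v : Fin (k + 1) → V) :
    altSum (fun u => altSum (T (u 0)) (fun i => u i.succ)) v =
      (k.factorial : ℂ) * altSum (fun u => T (u 0) (fun i => u i.succ)) v := by
  have key := altSum_altSum (fun τ : Perm (Fin k) => Perm.decomposeFin.symm (0, τ))
    (fun τ => by simp [Perm.decomposeFin.symm_sign])
    (fun u : Fin (k + 1) → V => T (u 0) (fun i => u i.succ)) v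
  rw [Fintype.card_fin] at key
  rw [← key]
  congr 1

end AltSum

/-! ### Wedge products and exterior derivatives as antisymmetrizations -/

section Alternating

variable {V : Type*} [NormedAddCommGroup V] [NormedSpace ℂ V]

theorem altSum_alternating {ι : Type*} [Fintype ι] [DecidableEq ι]
    (α : V [⋀^ι]→L[ℝ] ℂ) (v : ι → V) :
    altSum (fun u => α u) v = ((Fintype.card ι).factorial : ℂ) * α v := by
  have : ∀ σ : Perm ι, ((Perm.sign σ : ℤ) : ℂ) * α (v ∘ σ) = α v := fun σ => by
    have h := α.toAlternatingMap.map_perm v σ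
    simp only [Units.smul_def, zsmul_eq_mul] at h
    have h' : α (v ∘ σ) = ((Perm.sign σ : ℤ) : ℂ) * α v := h
    rw [h', ← mul_assoc, sign_mul_self_cast, one_mul]
  simp [altSum, this, Fintype.card_perm]

theorem wedge_eq_altSum {p q : ℕ} (α : V [⋀^Fin p]→L[ℝ] ℂ) (β : V [⋀^Fin q]→L[ℝ] ℂ)
    (v : Fin (p + q) → V) :
    wedge α β v = (1 / ((p.factorial : ℂ) * (q.factorial : ℂ))) *
      altSum (fun u => α (fun i => u (Fin.castAdd q i)) * β (fun j => u (Fin.natAdd p j))) v :=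
  wedge_apply α β v

/-- The permutation of `Fin (p + q)` acting as `τ` on the first `p` elements. -/
def permCastAdd (p q : ℕ) (τ : Perm (Fin p)) : Perm (Fin (p + q)) :=
  finSumFinEquiv.permCongr (Perm.sumCongr τ 1)

theorem sign_permCastAdd (p q : ℕ) (τ : Perm (Fin p)) :
    Perm.sign (permCastAdd p q τ) = Perm.sign τ := by
  simp [permCastAdd, Perm.sign_permCongr]

theorem permCastAdd_castAdd {p q : ℕ} (τ : Perm (Fin p)) (i : Fin p) :
    permCastAdd p q τ (Fin.castAdd q i) = Fin.castAdd q (τ i) := by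
  simp [permCastAdd, Equiv.permCongr_apply]

theorem permCastAdd_natAdd {p q : ℕ} (τ : Perm (Fin p)) (i : Fin q) :
    permCastAdd p q τ (Fin.natAdd p i) = Fin.natAdd p i := by
  simp [permCastAdd, Equiv.permCongr_apply]

/-- When the left factor is itself an antisymmetrization, the two nested sums merge and `p!`
cancels. This is what makes iterated wedge products computable by a single sum. -/
theorem wedge_altSum {p q : ℕ} (α : V [⋀^Fin p]→L[ℝ] ℂ) (β : V [⋀^Fin q]→L[ℝ] ℂ) (c : ℂ)
    (T : (Fin p → V) → ℂ) (hα : ∀ u, α u = c * altSum T u) (v : Fin (p + q) → V) :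
    wedge α β v = (c / (q.factorial : ℂ)) *
      altSum (fun u => T (fun i => u (Fin.castAdd q i)) * β (fun j => u (Fin.natAdd p j))) v := by
  have key := altSum_altSum (permCastAdd p q) (sign_permCastAdd p q)
    (fun u : Fin (p + q) → V =>
      T (fun i => u (Fin.castAdd q i)) * β (fun j => u (Fin.natAdd p j))) v
  rw [wedge_eq_altSum]
  have h : (fun u : Fin (p + q) → V =>
      α (fun i => u (Fin.castAdd q i)) * β (fun j => u (Fin.natAdd p j))) = fun u =>
      c * ∑ τ : Perm (Fin p), ((Perm.sign τ : ℤ) : ℂ) *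
        (T (fun i => (u ∘ permCastAdd p q τ) (Fin.castAdd q i)) *
          β (fun j => (u ∘ permCastAdd p q τ) (Fin.natAdd p j))) := by
    funext u
    rw [hα, altSum, mul_assoc, Finset.sum_mul]
    simp only [Function.comp_apply, permCastAdd_castAdd, permCastAdd_natAdd]
    congr 1
    exact Finset.sum_congr rfl fun τ _ => by rw [mul_assoc]; rfl
  rw [h, altSum_const_mul, key, Fintype.card_fin]
  have : (p.factorial : ℂ) ≠ 0 := by exact_mod_cast p.factorial_ne_zero
  have : (q.factorial : ℂ) ≠ 0 := by exact_mod_cast q.factorial_ne_zero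
  field_simp

/-- A sum over all permutations replaces the sum over the `k + 1` positions of the derivative slot,
so that the later Leibniz computations become manipulations of `altSum`. -/
theorem alternatizeUncurryFin_eq_altSum {k : ℕ} (f : V →L[ℝ] V [⋀^Fin k]→L[ℝ] ℂ)
    (v : Fin (k + 1) → V) :
    ContinuousAlternatingMap.alternatizeUncurryFin f v =
      (1 / (k.factorial : ℂ)) * altSum (fun u => f (u 0) (fun i => u i.succ)) v := by
  have h1 := altSum_alternating (ContinuousAlternatingMap.alternatizeUncurryFin f) v
  -- Bringing slot `i` to the front is a cycle of sign `(-1) ^ i`, which cancels the sign in the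
  -- formula; all `k + 1` terms have the same antisymmetrization.
  have h2 : ∀ i : Fin (k + 1),
      altSum (fun u : Fin (k + 1) → V => (-1 : ℂ) ^ (i : ℕ) * f (u i) (i.removeNth u)) v =
        altSum (fun u => f (u 0) (fun i => u i.succ)) v := fun i => by
    have h3 := altSum_comp_perm (fun u : Fin (k + 1) → V => f (u 0) (fun j => u j.succ))
      i.cycleRange.symm v
    have h4 : (fun u : Fin (k + 1) → V => f ((u ∘ i.cycleRange.symm) 0)
        (fun j => (u ∘ i.cycleRange.symm) j.succ)) = fun u => f (u i) (i.removeNth u) := by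
      funext u
      simp only [Function.comp_apply, Fin.cycleRange_symm_zero, Fin.cycleRange_symm_succ]
      rfl
    rw [h4] at h3
    rw [altSum_const_mul, h3, Perm.sign_symm, Fin.sign_cycleRange, ← mul_assoc]
    push_cast
    rw [← mul_pow]
    norm_num
  have h5 : altSum (fun u => ContinuousAlternatingMap.alternatizeUncurryFin f u) v =
      ((k + 1 : ℕ) : ℂ) * altSum (fun u => f (u 0) (fun i => u i.succ)) v := by
    have : (fun u => ContinuousAlternatingMap.alternatizeUncurryFin f u) =
        fun u : Fin (k + 1) → V => ∑ i : Fin (k + 1),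
          (-1 : ℂ) ^ (i : ℕ) * f (u i) (i.removeNth u) := by
      funext u
      rw [ContinuousAlternatingMap.alternatizeUncurryFin_apply]
      refine Finset.sum_congr rfl fun i _ => ?_
      rw [zsmul_eq_mul]; push_cast; rfl
    rw [this, altSum_sum, Finset.sum_congr rfl fun i _ => h2 i]
    simp
  rw [h5, Fintype.card_fin, Nat.factorial_succ] at h1
  have h6 : ((k + 1 : ℕ) : ℂ) ≠ 0 := by exact_mod_cast k.succ_ne_zero
  have h7 : (k.factorial : ℂ) ≠ 0 := by exact_mod_cast k.factorial_ne_zero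
  rw [Nat.cast_mul, mul_assoc] at h1
  have h8 := mul_left_cancel₀ h6 h1
  rw [h8]
  field_simp

/-! ### Products of `2`-forms -/

/-- The product `θ 0 ∧ ⋯ ∧ θ (p - 1)` of a tuple of `2`-forms. -/
def wprod : (p : ℕ) → (Fin p → V [⋀^Fin 2]→L[ℝ] ℂ) → V [⋀^Fin (2 * p)]→L[ℝ] ℂ
  | 0, _ => ContinuousAlternatingMap.constOfIsEmpty ℝ V (Fin 0) 1
  | p + 1, θ => wedge (wprod p fun i => θ i.castSucc) (θ (Fin.last p))

/-- The index `2 i + j` of the `j`-th entry of the `i`-th pair. -/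
def pairIdx {p : ℕ} (i : Fin p) (j : Fin 2) : Fin (2 * p) := ⟨2 * i + j, by omega⟩

/-- Each factor contributes the `1 / 2!` of its wedge, and the antisymmetrizations nested in the
recursion collapse into one by `wedge_altSum`. -/
theorem wprod_apply : ∀ (p : ℕ) (θ : Fin p → V [⋀^Fin 2]→L[ℝ] ℂ) (v : Fin (2 * p) → V),
    wprod p θ v = (1 / 2) ^ p * altSum (fun u => ∏ i, θ i (fun j => u (pairIdx i j))) v
  | 0, θ, v => by
    change (1 : ℂ) = (1 / 2) ^ 0 * ∑ σ : Perm (Fin 0), ((Perm.sign σ : ℤ) : ℂ) * 1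
    simp
  | p + 1, θ, v => by
    have h := wedge_altSum (wprod p fun i => θ i.castSucc) (θ (Fin.last p)) _ _
      (wprod_apply p fun i => θ i.castSucc) v
    refine h.trans ?_
    rw [pow_succ, Nat.factorial_two, Nat.cast_ofNat, div_eq_mul_one_div]
    congr 2
    funext u
    rw [Fin.prod_univ_castSucc]
    rfl

/-- Forms of even degree commute: permuting the pairs of slots by `π` is a permutation of the `2p`
slots of sign `(sgn π) ^ 2 = 1`. -/
theorem wprod_comp_perm {p : ℕ} (θ : Fin p → V [⋀^Fin 2]→L[ℝ] ℂ) (π : Perm (Fin p)) :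
    wprod p (θ ∘ π) = wprod p θ := by
  ext v
  rw [wprod_apply, wprod_apply]
  congr 1
  let e : Fin p × Fin 2 ≃ Fin (2 * p) := finProdFinEquiv.trans (finCongr (mul_comm p 2))
  have he : ∀ i j, e (i, j) = pairIdx i j := fun i j => by
    ext; simp [e, pairIdx, finProdFinEquiv]; omega
  let ρ : Perm (Fin (2 * p)) := e.permCongr (Equiv.prodCongrLeft fun _ : Fin 2 => π)
  have hρ : Perm.sign ρ = 1 := by
    rw [Perm.sign_permCongr, Perm.sign_prodCongrLeft]; simp
  have hρe : ∀ i j, ρ (pairIdx i j) = pairIdx (π i) j := fun i j => by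
    rw [← he, ← he]; simp [ρ, Equiv.permCongr_apply]
  have := altSum_comp_perm (fun u : Fin (2 * p) → V => ∏ i, (θ ∘ π) i (fun j => u (pairIdx i j)))
    ρ v
  rw [hρ] at this
  simp only [Units.val_one, Int.cast_one, one_mul] at this
  rw [← this]
  congr 1
  funext u
  simp only [Function.comp_apply, hρe]
  exact Equiv.prod_comp π fun i => θ i (fun j => u (pairIdx i j))

/-- Evaluation of an alternating form on a tuple of vectors. -/
def evalForm {k : ℕ} (v : Fin k → V) : (V [⋀^Fin k]→L[ℝ] ℂ) →ₗ[ℂ] ℂ where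
  toFun α := α v
  map_add' _ _ := rfl
  map_smul' _ _ := rfl

/-- The product of `2`-forms as a multilinear map. -/
def wprodMultilinear (p : ℕ) :
    MultilinearMap ℂ (fun _ : Fin p => V [⋀^Fin 2]→L[ℝ] ℂ) (V [⋀^Fin (2 * p)]→L[ℝ] ℂ) :=
  have key : ∀ θ : Fin p → V [⋀^Fin 2]→L[ℝ] ℂ, ∀ v, wprod p θ v = (1 / 2) ^ p *
      ∑ σ : Perm (Fin (2 * p)), ((Perm.sign σ : ℤ) : ℂ) *
        (MultilinearMap.mkPiAlgebra ℂ (Fin p) ℂ).compLinearMap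
          (fun i => evalForm fun j => v (σ (pairIdx i j))) θ := fun θ v => by
    rw [wprod_apply]; rfl
  { toFun := wprod p
    map_update_add' := fun θ i x y => by
      ext v
      simp only [key, ContinuousAlternatingMap.add_apply, MultilinearMap.map_update_add, mul_add,
        Finset.sum_add_distrib]
    map_update_smul' := fun θ i c x => by
      ext v
      simp only [key, ContinuousAlternatingMap.smul_apply, MultilinearMap.map_update_smul,
        smul_eq_mul, Finset.mul_sum]
      exact Finset.sum_congr rfl fun σ _ => by ring }

theorem wprod_compContinuousLinearMap {p : ℕ} (θ : Fin p → V [⋀^Fin 2]→L[ℝ] ℂ) (T : V →L[ℝ] V) :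
    wprod p (fun i => (θ i).compContinuousLinearMap T) =
      (wprod p θ).compContinuousLinearMap T := by
  ext v
  rw [ContinuousAlternatingMap.compContinuousLinearMap_apply, wprod_apply, wprod_apply]
  rfl

theorem eq_zero_of_finrank_lt [FiniteDimensional ℝ V] {k : ℕ} (hk : Module.finrank ℝ V < k)
    (α : V [⋀^Fin k]→L[ℝ] ℂ) : α = 0 := by
  ext v
  refine α.toAlternatingMap.map_linearDependent v fun h => ?_
  have := h.fintype_card_le_finrank
  simp at this
  omega

end Alternating

end ChernForms

end

noncomputable section

namespace ChernForms

open Equiv Filter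

/-! ### Smoothness of forms and of their values -/

section Smooth

variable {V : Type*} [NormedAddCommGroup V] [NormedSpace ℂ V]

/-- A form is determined by its values on tuples of basis vectors. The linear left inverse reduces
smoothness of form-valued maps to smoothness of finitely many scalar functions. -/
theorem exists_leftInverse_evalForm [FiniteDimensional ℂ V] (k : ℕ) :
    ∃ (ι : Type) (_ : Fintype ι) (b : ι → Fin k → V) (L : (ι → ℂ) →L[ℝ] V [⋀^Fin k]→L[ℝ] ℂ),
      ∀ α : V [⋀^Fin k]→L[ℝ] ℂ, L (fun i => α (b i)) = α := by
  have : FiniteDimensional ℝ V := FiniteDimensional.complexToReal V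
  let b := Module.finBasis ℝ V
  let E : (V [⋀^Fin k]→L[ℝ] ℂ) →ₗ[ℝ] ((Fin k → Fin (Module.finrank ℝ V)) → ℂ) :=
    { toFun := fun α m => α fun i => b (m i)
      map_add' := fun _ _ => rfl
      map_smul' := fun _ _ => rfl }
  have hE : LinearMap.ker E = ⊥ := by
    refine LinearMap.ker_eq_bot.2 fun α β h => ?_
    refine ContinuousAlternatingMap.toAlternatingMap_injective ?_
    exact Module.Basis.ext_alternating b fun m _ => congrFun h m
  obtain ⟨L, hL⟩ := E.exists_leftInverse_of_injective hE
  exact ⟨_, inferInstance, fun m i => b (m i), LinearMap.toContinuousLinearMap L,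
    fun α => congrArg (fun f => f α) hL⟩

theorem contDiffOn_form [FiniteDimensional ℂ V] {k : ℕ} {n : WithTop ℕ∞}
    {E : Type*} [NormedAddCommGroup E] [NormedSpace ℝ E] {s : Set E}
    {α : E → V [⋀^Fin k]→L[ℝ] ℂ} (h : ∀ v, ContDiffOn ℝ n (fun z => α z v) s) :
    ContDiffOn ℝ n α s := by
  obtain ⟨ι, _, b, L, hL⟩ := exists_leftInverse_evalForm (V := V) k
  have : ContDiffOn ℝ n (fun z => L (fun i => α z (b i))) s :=
    L.contDiff.comp_contDiffOn (contDiffOn_pi.2 fun i => h (b i))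
  simpa only [hL] using this

/-- Evaluation of an alternating form on a tuple of vectors, as a continuous linear map. -/
def evalFormCLM {k : ℕ} (v : Fin k → V) : (V [⋀^Fin k]→L[ℝ] ℂ) →L[ℝ] ℂ :=
  ContinuousAlternatingMap.apply ℝ V ℂ v

theorem contDiffOn_form_apply {k : ℕ} {n : WithTop ℕ∞}
    {E : Type*} [NormedAddCommGroup E] [NormedSpace ℝ E] {s : Set E}
    {α : E → V [⋀^Fin k]→L[ℝ] ℂ} (h : ContDiffOn ℝ n α s) (v : Fin k → V) :
    ContDiffOn ℝ n (fun z => α z v) s :=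
  (evalFormCLM v).contDiff.comp_contDiffOn h

theorem fderiv_form_apply {k : ℕ} {α : V → V [⋀^Fin k]→L[ℝ] ℂ} {z : V}
    (h : DifferentiableAt ℝ α z) (v : Fin k → V) (a : V) :
    fderiv ℝ α z a v = fderiv ℝ (fun y => α y v) z a := by
  have := ((evalFormCLM v).hasFDerivAt.comp z h.hasFDerivAt).fderiv
  exact (congrArg (fun f => f a) this).symm

/-- The directional derivative. -/
def dir (f : V → ℂ) (a : V) (z : V) : ℂ := fderiv ℝ f z a

theorem contDiffOn_dir {U : Set V} (hU : IsOpen U) {f : V → ℂ} (hf : ContDiffOn ℝ ∞ f U) (a : V) :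
    ContDiffOn ℝ ∞ (dir f a) U :=
  (hf.fderiv_of_isOpen hU (m := ∞) (by simp)).clm_apply contDiffOn_const

theorem dir_comm {U : Set V} (hU : IsOpen U) {f : V → ℂ} (hf : ContDiffOn ℝ ∞ f U) {z : V}
    (hz : z ∈ U) (a b : V) : dir (dir f a) b z = dir (dir f b) a z := by
  have hf' : ContDiffAt ℝ ∞ f z := hf.contDiffAt (hU.mem_nhds hz)
  have hd : DifferentiableAt ℝ (fderiv ℝ f) z :=
    (hf'.fderiv_right (m := 1) (by norm_cast)).differentiableAt one_ne_zero
  have h := (hf'.of_le (m := 2) (by norm_cast)).isSymmSndFDerivAt (by simp)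
  have key : ∀ a b, dir (dir f a) b z = fderiv ℝ (fderiv ℝ f) z b a := fun a b => by
    unfold dir
    rw [fderiv_clm_apply hd (differentiableAt_const a)]
    simp
  rw [key, key, h.eq]

/-- The operator `v ↦ (Df(v) + ε Df(iv)) / 2`; it gives `∂f` for `ε = -i`, `∂̄f` for `ε = i`. -/
def dOp (ε : ℂ) (f : V → ℂ) (z a : V) : ℂ := (1 / 2) * (dir f a z + ε * dir f (Complex.I • a) z)

theorem contDiffOn_dOp {U : Set V} (hU : IsOpen U) (ε : ℂ) {f : V → ℂ} (hf : ContDiffOn ℝ ∞ f U)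
    (a : V) : ContDiffOn ℝ ∞ (fun z => dOp ε f z a) U :=
  contDiffOn_const.mul ((contDiffOn_dir hU hf a).add
    (contDiffOn_const.mul (contDiffOn_dir hU hf _)))

theorem dOp_congr {ε : ℂ} {f g : V → ℂ} {z : V} (h : f =ᶠ[𝓝 z] g) (a : V) :
    dOp ε f z a = dOp ε g z a := by
  simp only [dOp, dir, h.fderiv_eq]

theorem dOp_mul {ε : ℂ} {f g : V → ℂ} {z : V} (hf : DifferentiableAt ℝ f z)
    (hg : DifferentiableAt ℝ g z) (a : V) :
    dOp ε (fun y => f y * g y) z a = dOp ε f z a * g z + f z * dOp ε g z a := by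
  simp only [dOp, dir, fderiv_fun_mul hf hg]
  simp
  ring

theorem dOp_const (ε c : ℂ) (z a : V) : dOp ε (fun _ => c) z a = 0 := by
  simp [dOp, dir]

theorem dOp_const_mul {ε : ℂ} (c : ℂ) {f : V → ℂ} {z : V} (hf : DifferentiableAt ℝ f z) (a : V) :
    dOp ε (fun y => c * f y) z a = c * dOp ε f z a := by
  rw [dOp_mul (differentiableAt_const c) hf, dOp_const]; ring

theorem dOp_sum {ε : ℂ} {ι : Type*} (s : Finset ι) {f : ι → V → ℂ} {z : V}
    (hf : ∀ i ∈ s, DifferentiableAt ℝ (f i) z) (a : V) :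
    dOp ε (fun y => ∑ i ∈ s, f i y) z a = ∑ i ∈ s, dOp ε (f i) z a := by
  simp only [dOp, dir, fderiv_fun_sum hf]
  simp [Finset.mul_sum, Finset.sum_add_distrib, mul_add]

theorem dOp_prod {ε : ℂ} {ι : Type*} [DecidableEq ι] (s : Finset ι) {f : ι → V → ℂ} {z : V}
    (hf : ∀ i ∈ s, DifferentiableAt ℝ (f i) z) (a : V) :
    dOp ε (fun y => ∏ i ∈ s, f i y) z a =
      ∑ i ∈ s, (∏ j ∈ s.erase i, f j z) * dOp ε (f i) z a := by
  have h := (HasFDerivAt.finsetProd (u := s) (g := f)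
    fun i hi => (hf i hi).hasFDerivAt).fderiv
  simp only [dOp, dir, h]
  simp [Finset.mul_sum, ← Finset.sum_add_distrib, mul_add]
  exact Finset.sum_congr rfl fun i _ => by ring

theorem dOp_altSum {ε : ℂ} {ι : Type*} [Fintype ι] [DecidableEq ι] {T : V → (ι → V) → ℂ} {z : V}
    (hT : ∀ u, DifferentiableAt ℝ (fun y => T y u) z) (v : ι → V) (a : V) :
    dOp ε (fun y => altSum (T y) v) z a = altSum (fun u => dOp ε (fun y => T y u) z a) v := by
  simp only [altSum]
  rw [dOp_sum _ fun σ _ => (hT _).const_mul _]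
  exact Finset.sum_congr rfl fun σ _ => dOp_const_mul _ (hT _) a

/-! ### The operators `∂` and `∂̄` on an open set -/

/-- The common form of `localDel` (`ε = -i`) and `localDelbar` (`ε = i`). -/
def localD (ε : ℂ) {k : ℕ} (α : V → V [⋀^Fin k]→L[ℝ] ℂ) (z : V) : V [⋀^Fin (k + 1)]→L[ℝ] ℂ :=
  .alternatizeUncurryFin ((1 / 2 : ℂ) • (fderiv ℝ α z + ε • (fderiv ℝ α z).comp mulI))

theorem localDelbar_eq {k : ℕ} (α : V → V [⋀^Fin k]→L[ℝ] ℂ) :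
    localDelbar α = localD Complex.I α := rfl

theorem localDel_eq {k : ℕ} (α : V → V [⋀^Fin k]→L[ℝ] ℂ) :
    localDel α = localD (-Complex.I) α := by
  funext z
  simp only [localDel, localD]
  congr 1
  ext a v
  change (1 / 2 : ℂ) * (fderiv ℝ α z a v - Complex.I * fderiv ℝ α z (mulI a) v) =
    (1 / 2 : ℂ) * (fderiv ℝ α z a v + -Complex.I * fderiv ℝ α z (mulI a) v)
  ring

theorem localD_congr {ε : ℂ} {k : ℕ} {α β : V → V [⋀^Fin k]→L[ℝ] ℂ} {z : V} (h : α =ᶠ[𝓝 z] β) :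
    localD ε α z = localD ε β z := by
  simp only [localD, h.fderiv_eq]

theorem half_smul_fderiv_apply {ε : ℂ} {k : ℕ} {α : V → V [⋀^Fin k]→L[ℝ] ℂ} {z : V}
    (h : DifferentiableAt ℝ α z) (a : V) (v : Fin k → V) :
    ((1 / 2 : ℂ) • (fderiv ℝ α z + ε • (fderiv ℝ α z).comp mulI)) a v =
      dOp ε (fun y => α y v) z a := by
  rw [dOp, dir, dir, ← fderiv_form_apply h, ← fderiv_form_apply h]
  rfl

theorem localD_apply {ε : ℂ} {k : ℕ} {α : V → V [⋀^Fin k]→L[ℝ] ℂ} {z : V}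
    (h : DifferentiableAt ℝ α z) (v : Fin (k + 1) → V) :
    localD ε α z v = (1 / (k.factorial : ℂ)) *
      altSum (fun u => dOp ε (fun y => α y fun i => u i.succ) z (u 0)) v := by
  rw [localD, alternatizeUncurryFin_eq_altSum]
  simp only [half_smul_fderiv_apply h]

theorem localD_apply' {ε : ℂ} {k : ℕ} {α : V → V [⋀^Fin k]→L[ℝ] ℂ} {z : V}
    (h : DifferentiableAt ℝ α z) (v : Fin (k + 1) → V) :
    localD ε α z v =
      ∑ i : Fin (k + 1), (-1) ^ (i : ℕ) * dOp ε (fun y => α y (i.removeNth v)) z (v i) := by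
  rw [localD, ContinuousAlternatingMap.alternatizeUncurryFin_apply]
  simp only [half_smul_fderiv_apply h]
  exact Finset.sum_congr rfl fun i _ => by rw [zsmul_eq_mul]; push_cast; rfl

theorem contDiffOn_localD [FiniteDimensional ℂ V] {ε : ℂ} {k : ℕ} {α : V → V [⋀^Fin k]→L[ℝ] ℂ}
    {U : Set V} (hU : IsOpen U) (h : ContDiffOn ℝ ∞ α U) : ContDiffOn ℝ ∞ (localD ε α) U := by
  refine contDiffOn_form fun v => ?_
  have : ∀ z ∈ U, localD ε α z v = ∑ i : Fin (k + 1), (-1) ^ (i : ℕ) *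
      dOp ε (fun y => α y (i.removeNth v)) z (v i) := fun z hz =>
    localD_apply' ((h.contDiffAt (hU.mem_nhds hz)).differentiableAt (by simp)) v
  refine ContDiffOn.congr ?_ this
  exact ContDiffOn.sum fun i _ => contDiffOn_const.mul
    (contDiffOn_dOp hU ε (contDiffOn_form_apply h _) _)

/-- A function on `V` as a `0`-form. -/
def zeroForm (f : V → ℂ) (z : V) : V [⋀^Fin 0]→L[ℝ] ℂ :=
  ContinuousAlternatingMap.constOfIsEmpty ℝ V (Fin 0) (f z)

theorem contDiffOn_zeroForm [FiniteDimensional ℂ V] {f : V → ℂ} {U : Set V}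
    (hf : ContDiffOn ℝ ∞ f U) : ContDiffOn ℝ ∞ (zeroForm f) U :=
  contDiffOn_form fun _ => hf

/-- The local expression of `∂̄∂f`. -/
def ddbar (f : V → ℂ) (z : V) : V [⋀^Fin 2]→L[ℝ] ℂ :=
  localDelbar (localDel (zeroForm f)) z

variable [FiniteDimensional ℂ V]

theorem contDiffOn_ddbar {f : V → ℂ} {U : Set V} (hU : IsOpen U)
    (hf : ContDiffOn ℝ ∞ f U) : ContDiffOn ℝ ∞ (ddbar f) U := by
  unfold ddbar
  rw [localDel_eq, localDelbar_eq]
  exact contDiffOn_localD hU (contDiffOn_localD hU (contDiffOn_zeroForm hf))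

theorem localD_zeroForm_apply {ε : ℂ} {f : V → ℂ} {U : Set V} (hU : IsOpen U)
    (hf : ContDiffOn ℝ ∞ f U) {z : V} (hz : z ∈ U) (v : Fin 1 → V) :
    localD ε (zeroForm f) z v = dOp ε f z (v 0) := by
  rw [localD_apply' (((contDiffOn_zeroForm hf).contDiffAt (hU.mem_nhds hz)).differentiableAt
    (by simp))]
  simp [zeroForm]

theorem ddbar_eq_sub {f : V → ℂ} {U : Set V} (hU : IsOpen U)
    (hf : ContDiffOn ℝ ∞ f U) {z : V} (hz : z ∈ U) (v : Fin 2 → V) :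
    ddbar f z v = dOp Complex.I (fun y => dOp (-Complex.I) f y (v 1)) z (v 0) -
      dOp Complex.I (fun y => dOp (-Complex.I) f y (v 0)) z (v 1) := by
  rw [ddbar, localDel_eq, localDelbar_eq, localD_apply'
    (((contDiffOn_localD hU (contDiffOn_zeroForm hf)).contDiffAt
      (hU.mem_nhds hz)).differentiableAt (by simp)), Fin.sum_univ_two]
  have : ∀ w : Fin 1 → V, (fun y => localD (-Complex.I) (zeroForm f) y w) =ᶠ[𝓝 z]
      fun y => dOp (-Complex.I) f y (w 0) := fun w => by
    filter_upwards [hU.mem_nhds hz] with y hy using localD_zeroForm_apply hU hf hy w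
  rw [dOp_congr (this _), dOp_congr (this _)]
  simp [Fin.removeNth, Fin.succAbove, sub_eq_add_neg]

/-- In the expansion of `∂̄∂f` the terms `D_a D_b` and `D_{ia} D_{ib}` are symmetric in the two
vectors, so they cancel; the mixed terms double. -/
theorem ddbar_apply {f : V → ℂ} {U : Set V} (hU : IsOpen U)
    (hf : ContDiffOn ℝ ∞ f U) {z : V} (hz : z ∈ U) (v : Fin 2 → V) :
    ddbar f z v = (Complex.I / 2) * (dir (dir f (v 1)) (Complex.I • v 0) z -
      dir (dir f (Complex.I • v 1)) (v 0) z) := by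
  have hd : ∀ a, DifferentiableAt ℝ (dir f a) z := fun a =>
    ((contDiffOn_dir hU hf a).contDiffAt (hU.mem_nhds hz)).differentiableAt (by simp)
  have key : ∀ a b, dOp Complex.I (fun y => dOp (-Complex.I) f y b) z a =
      (1 / 2) * (dOp Complex.I (dir f b) z a
        - Complex.I * dOp Complex.I (dir f (Complex.I • b)) z a) := fun a b => by
    have e : (fun y => dOp (-Complex.I) f y b) = fun y => ∑ j : Fin 2,
        (![1 / 2, -Complex.I / 2] : Fin 2 → ℂ) j * dir f (![b, Complex.I • b] j) y := by
      funext y; simp [dOp, Fin.sum_univ_two]; ring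
    rw [e, dOp_sum _ fun i _ => (hd _).const_mul _, Fin.sum_univ_two, dOp_const_mul _ (hd _),
      dOp_const_mul _ (hd _)]
    simp
    ring
  rw [ddbar_eq_sub hU hf hz, key, key]
  simp only [dOp]
  rw [dir_comm hU hf hz (v 1) (v 0), dir_comm hU hf hz (Complex.I • v 1) (Complex.I • v 0),
    dir_comm hU hf hz (v 1) (Complex.I • v 0), dir_comm hU hf hz (Complex.I • v 1) (v 0)]
  linear_combination (-(1 / 4) * (dir (dir f (Complex.I • v 0)) (Complex.I • v 1) z)
     + (1 / 4) * dir (dir f (Complex.I • v 0)) (Complex.I • v 1) z) * Complex.I_sq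

/-- Everything reduces to third derivatives of `f`, which are symmetric. The case of general `ε`
covers closedness under `∂` and `∂̄` at once. -/
theorem localD_ddbar {ε : ℂ} {f : V → ℂ} {U : Set V} (hU : IsOpen U)
    (hf : ContDiffOn ℝ ∞ f U) {z : V} (hz : z ∈ U) :
    localD ε (ddbar f) z = 0 := by
  ext v
  rw [localD_apply' (((contDiffOn_ddbar hU hf).contDiffAt (hU.mem_nhds hz)).differentiableAt
    (by simp)), Fin.sum_univ_three]
  have hd : ∀ a b, DifferentiableAt ℝ (dir (dir f a) b) z := fun a b =>
    ((contDiffOn_dir hU (contDiffOn_dir hU hf a) b).contDiffAt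
      (hU.mem_nhds hz)).differentiableAt (by simp)
  have key : ∀ (a : V) (w : Fin 2 → V), dOp ε (fun y => ddbar f y w) z a = (Complex.I / 2) *
      (dOp ε (dir (dir f (w 1)) (Complex.I • w 0)) z a -
        dOp ε (dir (dir f (Complex.I • w 1)) (w 0)) z a) := fun a w => by
    have e : (fun y => ddbar f y w) =ᶠ[𝓝 z] fun y => ∑ j : Fin 2,
        (![Complex.I / 2, -Complex.I / 2] : Fin 2 → ℂ) j *
          dir (dir f (![w 1, Complex.I • w 1] j)) (![Complex.I • w 0, w 0] j) y := by
      filter_upwards [hU.mem_nhds hz] with y hy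
      rw [ddbar_apply hU hf hy]
      simp [Fin.sum_univ_two]; ring
    rw [dOp_congr e, dOp_sum _ fun i _ => (hd _ _).const_mul _, Fin.sum_univ_two,
      dOp_const_mul _ (hd _ _), dOp_const_mul _ (hd _ _)]
    simp
    ring
  simp only [key]
  simp only [dOp]
  -- `s1` exchanges the last two directions and `s2` the first two. The rewriting below brings
  -- matching third derivatives to a common order, after which they cancel.
  have s1 : ∀ a b c, dir (dir (dir f a) b) c z = dir (dir (dir f a) c) b z := fun a b c =>
    dir_comm hU (contDiffOn_dir hU hf a) hz b c
  have s2 : ∀ a b c, dir (dir (dir f a) b) c z = dir (dir (dir f b) a) c z := fun a b c => by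
    have : dir (dir f a) b =ᶠ[𝓝 z] dir (dir f b) a := by
      filter_upwards [hU.mem_nhds hz] with y hy using dir_comm hU hf hy a b
    unfold dir at this ⊢
    rw [this.fderiv_eq]
  simp only [Fin.removeNth, Fin.succAbove, Fin.isValue, Fin.val_zero, pow_zero,
    Fin.castSucc_zero, lt_self_iff_false, ↓reduceIte, Fin.succ_one_eq_two, Fin.succ_zero_eq_one,
    one_mul, Fin.val_one, pow_one, Fin.castSucc_one, zero_lt_one, Fin.val_two, even_two,
    Even.neg_pow, one_pow, Fin.reduceLT, neg_mul]
  rw [s2 (v 2) (Complex.I • v 1) (v 0), s1 _ (v 2) (v 0), s1 _ (v 1) (v 0),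
    s2 (v 2) (Complex.I • v 0) (v 1), s1 _ (v 2) (v 1), s2 _ (v 1) (v 2),
    s1 (v 2) (Complex.I • v 1) (Complex.I • v 0), s2 _ (v 1) (Complex.I • v 0),
    s1 _ (Complex.I • v 2) (Complex.I • v 0), s2 _ (v 0) (Complex.I • v 1),
    s1 _ (Complex.I • v 2) (Complex.I • v 1), s2 (v 0) (Complex.I • v 1)]
  change _ = (0 : ℂ)
  ring

end Smooth

end ChernForms

end

noncomputable section

namespace ChernForms

open Equiv Filter

theorem altSum_uncurry_two {V : Type*} {k : ℕ} (M : V → V → ℂ) (T : (Fin k → V) → ℂ)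
    (v : Fin (k + 1 + 1) → V) :
    altSum (fun u => M (u 0) (u 1) * altSum T (fun i => u i.succ.succ)) v =
      (k.factorial : ℂ) * altSum (fun u => M (u 0) (u 1) * T (fun i => u i.succ.succ)) v := by
  have key := altSum_altSum
    (fun τ : Perm (Fin k) => Perm.decomposeFin.symm (0, Perm.decomposeFin.symm (0, τ)))
    (fun τ => by simp [Perm.decomposeFin.symm_sign])
    (fun u : Fin (k + 1 + 1) → V => M (u 0) (u 1) * T (fun i => u i.succ.succ)) v
  rw [Fintype.card_fin] at key
  rw [← key]
  congr 1
  funext u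
  rw [altSum, Finset.mul_sum]
  refine Finset.sum_congr rfl fun τ _ => ?_
  have h1 : Perm.decomposeFin.symm (0, Perm.decomposeFin.symm (0, τ)) (1 : Fin (k + 1 + 1)) = 1 := by
    rw [← Fin.succ_zero_eq_one, Perm.decomposeFin_symm_apply_succ]; simp
  have h2 : ∀ i : Fin k, Perm.decomposeFin.symm (0, Perm.decomposeFin.symm (0, τ)) i.succ.succ =
      (τ i).succ.succ := fun i => by
    rw [Perm.decomposeFin_symm_apply_succ, Perm.decomposeFin_symm_apply_succ]; simp
  simp only [Function.comp_apply, Perm.decomposeFin_symm_apply_zero, h1, h2]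
  rw [mul_left_comm]
  rfl

/-! ### The Leibniz rule for products of closed `2`-forms -/

section Leibniz

variable {V : Type*} [NormedAddCommGroup V] [NormedSpace ℂ V]

theorem contDiffOn_wprod [FiniteDimensional ℂ V] {n : WithTop ℕ∞}
    {E : Type*} [NormedAddCommGroup E] [NormedSpace ℝ E] {s : Set E} {p : ℕ}
    {θ : Fin p → E → V [⋀^Fin 2]→L[ℝ] ℂ} (h : ∀ i, ContDiffOn ℝ n (θ i) s) :
    ContDiffOn ℝ n (fun z => wprod p fun i => θ i z) s := by
  refine contDiffOn_form fun v => ?_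
  simp only [wprod_apply, altSum]
  exact contDiffOn_const.mul (ContDiffOn.sum fun σ _ => contDiffOn_const.mul
    (contDiffOn_prod fun i _ => contDiffOn_form_apply (h i) _))

/-- Closedness is put in cyclic form because `altSum_eq_zero_of_rotate` consumes a vanishing sum
over rotations of three slots. -/
theorem dOp_cyclic_of_localD_eq_zero {ε : ℂ} {θ : V → V [⋀^Fin 2]→L[ℝ] ℂ} {z : V}
    (hθ : DifferentiableAt ℝ θ z) (h : localD ε θ z = 0) (a b c : V) :
    dOp ε (fun y => θ y ![b, c]) z a + dOp ε (fun y => θ y ![c, a]) z b +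
      dOp ε (fun y => θ y ![a, b]) z c = 0 := by
  have h1 : localD ε θ z ![a, b, c] = 0 := by rw [h]; rfl
  rw [localD_apply' hθ, Fin.sum_univ_three] at h1
  have h2 : dOp ε (fun y => θ y ![c, a]) z b = -dOp ε (fun y => θ y ![a, c]) z b := by
    have : (fun y => θ y ![c, a]) = fun y => (-1 : ℂ) * θ y ![a, c] := by
      funext y
      have := (θ y).toAlternatingMap.map_swap ![a, c] (i := 0) (j := 1) (by decide)
      have e : (![a, c] ∘ swap (0 : Fin 2) 1 : Fin 2 → V) = ![c, a] := by
        ext i; fin_cases i <;> rfl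
      rw [e] at this
      rw [neg_one_mul]
      exact this
    rw [this, dOp_const_mul]
    · ring
    · exact (evalFormCLM ![a, c]).differentiableAt.comp z hθ
  have e0 : Fin.removeNth 0 ![a, b, c] = ![b, c] := by ext i; fin_cases i <;> rfl
  have e1 : Fin.removeNth 1 ![a, b, c] = ![a, c] := by ext i; fin_cases i <;> rfl
  have e2 : Fin.removeNth 2 ![a, b, c] = ![a, b] := by ext i; fin_cases i <;> rfl
  rw [e0, e1, e2] at h1
  rw [h2, ← h1]
  simp

theorem localD_smul_of_closed {ε : ℂ} {U : Set V} (hU : IsOpen U) {k : ℕ}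
    {g : V → ℂ} (hg : ContDiffOn ℝ ∞ g U) {α : V → V [⋀^Fin k]→L[ℝ] ℂ}
    (hα : ContDiffOn ℝ ∞ α U) {z : V} (hz : z ∈ U) (hc : localD ε α z = 0)
    (v : Fin (k + 1) → V) :
    localD ε (fun y => g y • α y) z v = (1 / (k.factorial : ℂ)) *
      altSum (fun u => dOp ε g z (u 0) * α z (fun i => u i.succ)) v := by
  have hgd := (hg.contDiffAt (hU.mem_nhds hz)).differentiableAt (by simp)
  have hαd := (hα.contDiffAt (hU.mem_nhds hz)).differentiableAt (by simp)
  have h0 : localD ε α z v = 0 := by rw [hc]; rfl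
  rw [localD_apply hαd] at h0
  have hgα : DifferentiableAt ℝ (fun y => g y • α y) z := hgd.smul hαd
  rw [localD_apply hgα]
  have : ∀ u : Fin (k + 1) → V, dOp ε (fun y => (g y • α y) fun i => u i.succ) z (u 0) =
      dOp ε g z (u 0) * α z (fun i => u i.succ) +
        g z * dOp ε (fun y => α y fun i => u i.succ) z (u 0) := fun u => by
    have hu : DifferentiableAt ℝ (fun y => α y fun i => u i.succ) z :=
      (evalFormCLM fun i => u i.succ).differentiableAt.comp z hαd
    exact dOp_mul hgd hu (u 0)
  simp only [this]
  rw [altSum_add, mul_add, altSum_const_mul, mul_left_comm, h0, mul_zero, add_zero]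

variable [FiniteDimensional ℂ V]

/-- The derivative falls on one factor at a time. In each such term, rotating the derivative slot
with the two slots of that factor gives a cyclic sum that vanishes by closedness of the factor. -/
theorem localD_wprod {ε : ℂ} {U : Set V} (hU : IsOpen U) {p : ℕ}
    {θ : Fin p → V → V [⋀^Fin 2]→L[ℝ] ℂ} (hθ : ∀ i, ContDiffOn ℝ ∞ (θ i) U) {z : V} (hz : z ∈ U)
    (hc : ∀ i, localD ε (θ i) z = 0) :
    localD ε (fun y => wprod p fun i => θ i y) z = 0 := by
  have hd : ∀ i, DifferentiableAt ℝ (θ i) z := fun i =>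
    ((hθ i).contDiffAt (hU.mem_nhds hz)).differentiableAt (by simp)
  have hd' : ∀ i v, DifferentiableAt ℝ (fun y => θ i y v) z := fun i v =>
    (evalFormCLM v).differentiableAt.comp z (hd i)
  ext v
  rw [localD_apply (((contDiffOn_wprod hθ).contDiffAt (hU.mem_nhds hz)).differentiableAt
    (by simp))]
  let S : V → (Fin (2 * p) → V) → ℂ := fun a u => ∑ i,
    (∏ j ∈ Finset.univ.erase i, θ j z (fun l => u (pairIdx j l))) *
      dOp ε (fun y => θ i y (fun l => u (pairIdx i l))) z a
  have key : ∀ (a : V) (u : Fin (2 * p) → V),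
      dOp ε (fun y => wprod p (fun i => θ i y) u) z a = (1 / 2) ^ p * altSum (S a) u := by
    intro a u
    simp only [wprod_apply]
    have hp : ∀ u : Fin (2 * p) → V,
        DifferentiableAt ℝ (fun y => ∏ i, θ i y (fun l => u (pairIdx i l))) z := fun u =>
      (HasFDerivAt.finsetProd fun i _ => (hd' i _).hasFDerivAt).differentiableAt
    rw [dOp_const_mul, dOp_altSum hp]
    · congr 2
      funext u
      exact dOp_prod _ (fun i _ => hd' i _) a
    · exact DifferentiableAt.fun_sum fun σ _ => (hp _).const_mul _
  simp only [key]
  rw [altSum_const_mul, altSum_uncurry, altSum_sum, Finset.sum_eq_zero, mul_zero, mul_zero,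
    mul_zero]
  · rfl
  intro i _
  have n0b : (0 : Fin (2 * p + 1)) ≠ (pairIdx i 0).succ := (Fin.succ_ne_zero _).symm
  have nbc : (pairIdx i 0).succ ≠ (pairIdx i 1).succ := by
    simp [pairIdx, Fin.ext_iff]
  have n0c : (0 : Fin (2 * p + 1)) ≠ (pairIdx i 1).succ := (Fin.succ_ne_zero _).symm
  -- The 3-cycle through the derivative slot and the two slots of factor `i`; it is even and leaves
  -- the slots of the other factors alone.
  let ρ : Perm (Fin (2 * p + 1)) :=
    swap 0 (pairIdx i 0).succ * swap (pairIdx i 0).succ (pairIdx i 1).succ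
  have r0 : ρ 0 = (pairIdx i 0).succ := by
    simp [ρ, swap_apply_of_ne_of_ne n0b n0c]
  have rb : ρ (pairIdx i 0).succ = (pairIdx i 1).succ := by
    simp [ρ, swap_apply_of_ne_of_ne n0c.symm nbc.symm]
  have rc : ρ (pairIdx i 1).succ = 0 := by simp [ρ]
  have rj : ∀ j ≠ i, ∀ l, ρ (pairIdx j l).succ = (pairIdx j l).succ := fun j hj l => by
    have h1 : ∀ l', (pairIdx j l).succ ≠ (pairIdx i l').succ := fun l' h => by
      simp only [pairIdx, Fin.succ_mk, Fin.mk.injEq] at h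
      exact hj (Fin.ext (by omega))
    simp only [ρ, Perm.coe_mul, Function.comp_apply]
    rw [swap_apply_of_ne_of_ne (h1 0) (h1 1), swap_apply_of_ne_of_ne (Fin.succ_ne_zero _) (h1 0)]
  refine altSum_eq_zero_of_rotate ρ ?_ _ (fun u => ?_) v
  · rw [Perm.sign_mul, Perm.sign_swap n0b, Perm.sign_swap nbc]; simp
  have hpair : ∀ w : Fin (2 * p + 1) → V, (fun l => w (pairIdx i l).succ) =
      ![w (pairIdx i 0).succ, w (pairIdx i 1).succ] := fun w => by
    ext l; fin_cases l <;> rfl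
  have h1 : (∏ j ∈ Finset.univ.erase i, θ j z (fun l => (u ∘ ρ) (pairIdx j l).succ)) =
      ∏ j ∈ Finset.univ.erase i, θ j z (fun l => u (pairIdx j l).succ) :=
    Finset.prod_congr rfl fun j hj => by
      simp only [Function.comp_apply, rj j (Finset.ne_of_mem_erase hj)]
  have h2 : (∏ j ∈ Finset.univ.erase i, θ j z (fun l => (u ∘ ρ ∘ ρ) (pairIdx j l).succ)) =
      ∏ j ∈ Finset.univ.erase i, θ j z (fun l => u (pairIdx j l).succ) :=
    Finset.prod_congr rfl fun j hj => by
      simp only [Function.comp_apply, rj j (Finset.ne_of_mem_erase hj)]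
  rw [h1, h2, hpair, hpair, hpair]
  simp only [Function.comp_apply, r0, rb, rc]
  rw [← mul_add, ← mul_add, dOp_cyclic_of_localD_eq_zero (hd i) (hc i), mul_zero]

/-- `∂̄∂(g θ) = ∂̄∂g ∧ θ` for a closed form `θ`. -/
theorem localDelbar_localDel_smul_of_closed {U : Set V} (hU : IsOpen U) {k : ℕ}
    {g : V → ℂ} (hg : ContDiffOn ℝ ∞ g U) {α : V → V [⋀^Fin k]→L[ℝ] ℂ}
    (hα : ContDiffOn ℝ ∞ α U) (hc : ∀ ε, ∀ z ∈ U, localD ε α z = 0) {z : V} (hz : z ∈ U)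
    (v : Fin (k + 1 + 1) → V) :
    localDelbar (localDel fun y => g y • α y) z v = (1 / (k.factorial : ℂ)) *
      altSum (fun u => dOp Complex.I (fun y => dOp (-Complex.I) g y (u 1)) z (u 0) *
        α z (fun i => u i.succ.succ)) v := by
  have hk : (k.factorial : ℂ) ≠ 0 := by exact_mod_cast k.factorial_ne_zero
  have hk' : ((k + 1).factorial : ℂ) ≠ 0 := by exact_mod_cast (k + 1).factorial_ne_zero
  have hαd : ∀ w, DifferentiableAt ℝ (fun y => α y w) z := fun w =>
    (evalFormCLM w).differentiableAt.comp z
      ((hα.contDiffAt (hU.mem_nhds hz)).differentiableAt (by simp))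
  have hdg : ∀ a, DifferentiableAt ℝ (fun y => dOp (-Complex.I) g y a) z := fun a =>
    ((contDiffOn_dOp hU _ hg a).contDiffAt (hU.mem_nhds hz)).differentiableAt (by simp)
  have hgα : ContDiffOn ℝ ∞ (fun y => g y • α y) U := hg.smul hα
  rw [localDel_eq, localDelbar_eq, localD_apply
    (((contDiffOn_localD hU hgα).contDiffAt (hU.mem_nhds hz)).differentiableAt (by simp))]
  let S : V → (Fin (k + 1) → V) → ℂ := fun a u =>
    dOp Complex.I (fun y => dOp (-Complex.I) g y (u 0)) z a * α z (fun i => u i.succ) +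
      dOp (-Complex.I) g z (u 0) * dOp Complex.I (fun y => α y (fun i => u i.succ)) z a
  have key : ∀ (a : V) (u : Fin (k + 1) → V),
      dOp Complex.I (fun y => localD (-Complex.I) (fun y => g y • α y) y u) z a =
        (1 / (k.factorial : ℂ)) * altSum (S a) u := fun a u => by
    have e : (fun y => localD (-Complex.I) (fun y => g y • α y) y u) =ᶠ[𝓝 z] fun y =>
        (1 / (k.factorial : ℂ)) *
          altSum (fun u => dOp (-Complex.I) g y (u 0) * α y (fun i => u i.succ)) u := by
      filter_upwards [hU.mem_nhds hz] with y hy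
      exact localD_smul_of_closed hU hg hα hy (hc _ y hy) u
    have hm : ∀ u : Fin (k + 1) → V, DifferentiableAt ℝ
        (fun y => dOp (-Complex.I) g y (u 0) * α y (fun i => u i.succ)) z := fun u =>
      (hdg _).mul (hαd _)
    rw [dOp_congr e, dOp_const_mul, dOp_altSum hm]
    · congr 2
      funext u
      exact dOp_mul (hdg _) (hαd _) a
    · exact DifferentiableAt.fun_sum fun σ _ => (hm _).const_mul _
  simp only [key]
  rw [altSum_const_mul, altSum_uncurry]
  simp only [S]
  rw [altSum_add]
  -- The cross term is `∂g ∧ ∂̄α` up to sign: exchanging the first two slots puts the derivative of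
  -- `α` next to its own arguments, where antisymmetrization gives `∂̄α = 0`.
  have h2 : altSum (fun u : Fin (k + 1 + 1) → V => dOp (-Complex.I) g z (u (Fin.succ 0)) *
      dOp Complex.I (fun y => α y (fun i => u i.succ.succ)) z (u 0)) v = 0 := by
    have hs := altSum_comp_perm (fun u : Fin (k + 1 + 1) → V => dOp (-Complex.I) g z (u 0) *
      dOp Complex.I (fun y => α y (fun i => u i.succ.succ)) z (u (Fin.succ 0)))
      (swap 0 (Fin.succ 0)) v
    have e : (fun u : Fin (k + 1 + 1) → V =>
        dOp (-Complex.I) g z ((u ∘ swap 0 (Fin.succ 0)) 0) *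
        dOp Complex.I (fun y => α y (fun i => (u ∘ swap 0 (Fin.succ 0)) i.succ.succ)) z
          ((u ∘ swap 0 (Fin.succ 0)) (Fin.succ 0))) = fun u =>
        dOp (-Complex.I) g z (u (Fin.succ 0)) *
          dOp Complex.I (fun y => α y (fun i => u i.succ.succ)) z (u 0) := by
      funext u
      have : ∀ i : Fin k, swap (0 : Fin (k + 1 + 1)) (Fin.succ 0) i.succ.succ = i.succ.succ :=
        fun i => swap_apply_of_ne_of_ne (Fin.succ_ne_zero _)
          fun h => Fin.succ_ne_zero _ (Fin.succ_injective _ h)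
      simp only [Function.comp_apply, swap_apply_left, swap_apply_right, this]
    rw [e] at hs
    rw [hs]
    have h3 := altSum_uncurry (fun a (u : Fin (k + 1) → V) => dOp (-Complex.I) g z a *
      dOp Complex.I (fun y => α y (fun i => u i.succ)) z (u 0)) v
    have h4 : ∀ w : Fin (k + 1) → V,
        altSum (fun u => dOp Complex.I (fun y => α y (fun i => u i.succ)) z (u 0)) w = 0 :=
      fun w => by
        have h5 : localD Complex.I α z w = 0 := by rw [hc _ z hz]; rfl
        rw [localD_apply ((hα.contDiffAt (hU.mem_nhds hz)).differentiableAt (by simp))] at h5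
        exact (mul_eq_zero.1 h5).resolve_left (one_div_ne_zero hk)
    simp only [altSum_const_mul, h4, mul_zero] at h3
    have h6 : altSum (fun _ : Fin (k + 1 + 1) → V => (0 : ℂ)) v = 0 := by simp [altSum]
    rw [h6] at h3
    rw [(mul_eq_zero.1 h3.symm).resolve_left hk', mul_zero]
  rw [h2, add_zero]
  field_simp
  rfl

/-- This is where a coefficient function becomes one more factor of the form `∂̄∂g`, so that `∂̄∂`
of a combination of products is again a sum of products, now with constant coefficients. -/
theorem localDelbar_localDel_smul_wprod {U : Set V} (hU : IsOpen U) {p : ℕ}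
    {g : V → ℂ} (hg : ContDiffOn ℝ ∞ g U) {θ : Fin p → V → V [⋀^Fin 2]→L[ℝ] ℂ}
    (hθ : ∀ i, ContDiffOn ℝ ∞ (θ i) U) (hc : ∀ ε i, ∀ z ∈ U, localD ε (θ i) z = 0)
    {z : V} (hz : z ∈ U) :
    localDelbar (localDel fun y => g y • wprod p fun i => θ i y) z =
      (wprod (p + 1) (Fin.cons (ddbar g z) fun i => θ i z) : V [⋀^Fin (2 * (p + 1))]→L[ℝ] ℂ) := by
  ext v
  refine (localDelbar_localDel_smul_of_closed hU hg (contDiffOn_wprod hθ)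
    (fun ε z hz => localD_wprod hU hθ hz fun i => hc ε i z hz) hz v).trans ?_
  refine Eq.trans ?_ (wprod_apply (p + 1) _ v).symm
  have hk : ((2 * p).factorial : ℂ) ≠ 0 := by exact_mod_cast (2 * p).factorial_ne_zero
  let M : V → V → ℂ := fun a b => dOp Complex.I (fun y => dOp (-Complex.I) g y b) z a
  let T : (Fin (2 * p) → V) → ℂ := fun u => ∏ i, θ i z fun j => u (pairIdx i j)
  have h1 : (fun u : Fin (2 * p + 1 + 1) → V => M (u 0) (u 1) *
      wprod p (fun i => θ i z) (fun i => u i.succ.succ)) = fun u =>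
      (1 / 2) ^ p * (M (u 0) (u 1) * altSum T (fun i => u i.succ.succ)) := by
    funext u
    rw [wprod_apply]; ring
  -- `∂̄∂g` is the antisymmetrization of `M` in two slots, so after full antisymmetrization it
  -- counts `M` twice; this absorbs the extra `1 / 2` in `(1 / 2) ^ (p + 1)`.
  have h2 : altSum (fun u : Fin (2 * p + 1 + 1) → V => M (u 1) (u 0) *
      T (fun i => u i.succ.succ)) v =
      -altSum (fun u => M (u 0) (u 1) * T (fun i => u i.succ.succ)) v := by
    have hs := altSum_comp_perm (fun u : Fin (2 * p + 1 + 1) → V => M (u 0) (u 1) *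
      T (fun i => u i.succ.succ)) (swap 0 1) v
    have : ∀ i : Fin (2 * p), swap (0 : Fin (2 * p + 1 + 1)) 1 i.succ.succ = i.succ.succ :=
        fun i => swap_apply_of_ne_of_ne (Fin.succ_ne_zero _) (by
          rw [← Fin.succ_zero_eq_one]
          exact fun h => Fin.succ_ne_zero _ (Fin.succ_injective _ h))
    simp only [Function.comp_apply, swap_apply_left, swap_apply_right, this] at hs
    rw [hs, Perm.sign_swap (by simp)]
    simp
  have h3 : (fun u : Fin (2 * p + 1 + 1) → V =>
      ∏ i : Fin (p + 1), (Fin.cons (ddbar g z) (fun i => θ i z) :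
        Fin (p + 1) → V [⋀^Fin 2]→L[ℝ] ℂ) i fun j => u (pairIdx i j)) = fun u =>
      M (u 0) (u 1) * T (fun i => u i.succ.succ) +
        (-1) * (M (u 1) (u 0) * T (fun i => u i.succ.succ)) := by
    funext u
    rw [Fin.prod_univ_succ, Fin.cons_zero, ddbar_eq_sub hU hg hz]
    simp only [Fin.cons_succ]
    have e0 : (pairIdx (0 : Fin (p + 1)) 0 : Fin (2 * (p + 1))) = (0 : Fin (2 * p + 1 + 1)) := rfl
    have e1 : (pairIdx (0 : Fin (p + 1)) 1 : Fin (2 * (p + 1))) = (1 : Fin (2 * p + 1 + 1)) :=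
      Fin.ext (by simp [pairIdx])
    have e2 : ∀ (i : Fin p) j, (pairIdx i.succ j : Fin (2 * (p + 1))) =
        ((pairIdx i j).succ.succ : Fin (2 * p + 1 + 1)) := fun i j =>
      Fin.ext (by simp [pairIdx]; ring)
    simp only [e0, e1, e2]
    change (M (u 0) (u 1) - M (u 1) (u 0)) * T (fun i => u i.succ.succ) = _
    ring
  refine Eq.trans ?_ (congrArg (fun T => (1 / 2 : ℂ) ^ (p + 1) * altSum T v) h3.symm)
  refine (congrArg (fun T => (1 / ((2 * p).factorial : ℂ)) * altSum T v) h1).trans ?_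
  rw [altSum_const_mul, altSum_uncurry_two, altSum_add, altSum_const_mul, h2]
  field_simp
  ring

end Leibniz

end ChernForms

end

noncomputable section

namespace ChernForms

open Filter

/-! ### Holomorphic changes of coordinates -/

section Pullback

variable {V : Type*} [NormedAddCommGroup V] [NormedSpace ℂ V]

@[simp]
theorem mulI_apply (v : V) : mulI v = Complex.I • v := rfl

/-- With `J = mulI` and `J⁻¹ = -mulI`, the twisted derivative is the conjugate `J^* ∘ d ∘ (J⁻¹)^*`.
Thus `∂` and `∂̄` are expressed through `d`, and naturality of `d` can be used. -/
theorem alternatizeUncurryFin_comp_mulI {k : ℕ} {α : V → V [⋀^Fin k]→L[ℝ] ℂ} {z : V}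
    (h : DifferentiableAt ℝ α z) :
    ContinuousAlternatingMap.alternatizeUncurryFin ((fderiv ℝ α z).comp mulI) =
      (extDeriv (fun y => (α y).compContinuousLinearMap (-mulI)) z).compContinuousLinearMap
        mulI := by
  have h' : DifferentiableAt ℝ (fun y => (α y).compContinuousLinearMap (-mulI)) z :=
    h.continuousAlternatingMapCompContinuousLinearMap (differentiableAt_const _)
  ext v
  rw [ContinuousAlternatingMap.alternatizeUncurryFin_apply,
    ContinuousAlternatingMap.compContinuousLinearMap_apply, extDeriv_apply h']
  refine Finset.sum_congr rfl fun i _ => ?_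
  congr 1
  rw [ContinuousLinearMap.comp_apply, fderiv_form_apply h]
  congr 2
  funext y
  rw [ContinuousAlternatingMap.compContinuousLinearMap_apply]
  congr 1
  funext j
  simp [Fin.removeNth, smul_smul]

theorem localD_eq_extDeriv {ε : ℂ} {k : ℕ} {α : V → V [⋀^Fin k]→L[ℝ] ℂ} {z : V}
    (h : DifferentiableAt ℝ α z) : localD ε α z = (1 / 2 : ℂ) • (extDeriv α z +
      ε • (extDeriv (fun y => (α y).compContinuousLinearMap (-mulI)) z).compContinuousLinearMap
        mulI) := by
  rw [← alternatizeUncurryFin_comp_mulI h, localD,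
    ContinuousAlternatingMap.alternatizeUncurryFin_smul,
    ContinuousAlternatingMap.alternatizeUncurryFin_add,
    ContinuousAlternatingMap.alternatizeUncurryFin_smul]
  rfl

/-- The operators `∂` and `∂̄` commute with pull-back by holomorphic maps. -/
theorem localD_pullback {ε : ℂ} {k : ℕ} {β : V → V [⋀^Fin k]→L[ℝ] ℂ} {φ : V → V} {z : V}
    (hφ : ContDiffAt ℂ ω φ z) (hβ : DifferentiableAt ℝ β (φ z)) :
    localD ε (fun y => (β (φ y)).compContinuousLinearMap ((fderiv ℂ φ y).restrictScalars ℝ)) z =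
      (localD ε β (φ z)).compContinuousLinearMap ((fderiv ℂ φ z).restrictScalars ℝ) := by
  have hev : ∀ᶠ y in 𝓝 z, (fderiv ℂ φ y).restrictScalars ℝ = fderiv ℝ φ y := by
    filter_upwards [hφ.eventually (by simp)] with y hy
    exact ((hy.differentiableAt (by simp)).fderiv_restrictScalars ℝ).symm
  have hφ' : ContDiffAt ℝ 2 φ z := (hφ.restrict_scalars ℝ).of_le le_top
  have e1 : (fun y => (β (φ y)).compContinuousLinearMap ((fderiv ℂ φ y).restrictScalars ℝ))
      =ᶠ[𝓝 z] fun y => (β (φ y)).compContinuousLinearMap (fderiv ℝ φ y) := by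
    filter_upwards [hev] with y hy
    rw [hy]
  -- Holomorphy enters here: the derivative of `φ` commutes with multiplication by `i`, so
  -- conjugation by it commutes with the pull-back.
  have hJ : ∀ᶠ y in 𝓝 z, (fderiv ℝ φ y).comp mulI = mulI.comp (fderiv ℝ φ y) := by
    filter_upwards [hev] with y hy
    rw [← hy]
    ext v
    simp
  have e2 : (fun y => ((β (φ y)).compContinuousLinearMap
      (fderiv ℝ φ y)).compContinuousLinearMap (-mulI)) =ᶠ[𝓝 z]
      fun y => ((β (φ y)).compContinuousLinearMap (-mulI)).compContinuousLinearMap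
        (fderiv ℝ φ y) := by
    filter_upwards [hJ] with y hy
    ext v
    simp only [ContinuousAlternatingMap.compContinuousLinearMap_apply]
    congr 1
    funext j
    have := congrArg (fun T => T (v j)) hy
    simpa using this
  have hβ' : DifferentiableAt ℝ (fun y => (β y).compContinuousLinearMap (-mulI)) (φ z) :=
    hβ.continuousAlternatingMapCompContinuousLinearMap (differentiableAt_const _)
  have hd : DifferentiableAt ℝ
      (fun y => (β (φ y)).compContinuousLinearMap (fderiv ℝ φ y)) z := by
    have h1 : DifferentiableAt ℝ (fun y => β (φ y)) z :=
      hβ.comp z (hφ'.differentiableAt (by simp))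
    have h2 : DifferentiableAt ℝ (fderiv ℝ φ) z :=
      (hφ'.fderiv_right (m := 1) (by norm_num)).differentiableAt (by simp)
    exact h1.continuousAlternatingMapCompContinuousLinearMap h2
  rw [localD_congr e1, localD_eq_extDeriv hd, localD_eq_extDeriv hβ, e2.extDeriv_eq,
    extDeriv_pullback hβ hφ' (by simp), extDeriv_pullback hβ' hφ' (by simp), hev.self_of_nhds]
  have hJz := hJ.self_of_nhds
  have key : ∀ γ : V [⋀^Fin (k + 1)]→L[ℝ] ℂ,
      (γ.compContinuousLinearMap (fderiv ℝ φ z)).compContinuousLinearMap mulI =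
        (γ.compContinuousLinearMap mulI).compContinuousLinearMap (fderiv ℝ φ z) := fun γ => by
    ext v
    simp only [ContinuousAlternatingMap.compContinuousLinearMap_apply]
    congr 1
    funext j
    exact congrArg (fun T => T (v j)) hJz
  rw [key]
  rfl

end Pullback

/-! ### Independence of `∂` and `∂̄` of the chart -/

section Charts

variable {V : Type*} [NormedAddCommGroup V] [NormedSpace ℂ V]
  {X : Type*} [TopologicalSpace X] [ChartedSpace V X]

/-- The derivative of the inverse of a chart. -/
def chartDeriv (e : OpenPartialHomeomorph X V) (z : V) : V →L[ℂ] V :=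
  mfderiv 𝓘(ℂ, V) 𝓘(ℂ, V) e.symm z

theorem inChart_eq {k : ℕ} (α : Form V X k) (e : OpenPartialHomeomorph X V) (z : V) :
    inChart α e z =
      (α (e.symm z)).compContinuousLinearMap ((chartDeriv e z).restrictScalars ℝ) := rfl

/-- The common form of `del` (`ε = -i`) and `delbar` (`ε = i`). -/
def dForm (ε : ℂ) {k : ℕ} (α : Form V X k) : Form V X (k + 1) :=
  fun x => localD ε (inChart α (chartAt V x)) (chartAt V x x)

theorem del_eq {k : ℕ} (α : Form V X k) : del α = dForm (-Complex.I) α := by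
  funext x; rw [del, localDel_eq]; rfl

theorem delbar_eq {k : ℕ} (α : Form V X k) : delbar α = dForm Complex.I α := rfl

variable [IsManifold 𝓘(ℂ, V) ω X]

theorem mem_maximalAtlas {e : OpenPartialHomeomorph X V} (he : e ∈ atlas V X) :
    e ∈ IsManifold.maximalAtlas 𝓘(ℂ, V) ω X :=
  IsManifold.subset_maximalAtlas he

theorem mdifferentiableAt_chart_symm {e : OpenPartialHomeomorph X V} (he : e ∈ atlas V X) {z : V}
    (hz : z ∈ e.target) : MDifferentiableAt 𝓘(ℂ, V) 𝓘(ℂ, V) e.symm z :=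
  (contMDiffAt_symm_of_mem_maximalAtlas (mem_maximalAtlas he) hz).mdifferentiableAt (by simp)

theorem contDiffAt_transition {e c : OpenPartialHomeomorph X V} (he : e ∈ atlas V X)
    (hc : c ∈ atlas V X) {z : V} (hz : z ∈ e.target) (hzc : e.symm z ∈ c.source) :
    ContDiffAt ℂ ω (fun y => c (e.symm y)) z :=
  ((contMDiffAt_of_mem_maximalAtlas (mem_maximalAtlas hc) hzc).comp z
    (contMDiffAt_symm_of_mem_maximalAtlas (mem_maximalAtlas he) hz)).contDiffAt

theorem chartDeriv_eq_comp {e c : OpenPartialHomeomorph X V} (he : e ∈ atlas V X)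
    (hc : c ∈ atlas V X) {z : V} (hz : z ∈ e.target) (hzc : e.symm z ∈ c.source) :
    chartDeriv e z =
      (chartDeriv c (c (e.symm z))).comp (fderiv ℂ (fun y => c (e.symm y)) z) := by
  have h1 : e.symm =ᶠ[𝓝 z] fun y => c.symm (c (e.symm y)) := by
    filter_upwards [(e.continuousAt_symm hz).preimage_mem_nhds (c.open_source.mem_nhds hzc)] with
      y hy using (c.left_inv hy).symm
  have h2 := (mdifferentiableAt_chart_symm hc (c.map_source hzc)).hasMFDerivAt.comp z
    ((contDiffAt_transition he hc hz hzc).differentiableAt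
      (by simp)).hasFDerivAt.hasMFDerivAt
  exact (h2.congr_of_eventuallyEq h1).mfderiv

/-- The tangent space at `x` is identified with `V` through this very chart, so in these coordinates
the chart is the identity to first order. -/
theorem chartDeriv_chartAt (x : X) : chartDeriv (chartAt V x) (chartAt V x x) =
    ContinuousLinearMap.id ℂ V := by
  have h := (mdifferentiableAt_chart_symm (chart_mem_atlas V x) (mem_chart_target V x))
  have hx : (chartAt V x).symm (chartAt V x x) = x :=
    (chartAt V x).left_inv (mem_chart_source V x)
  refine h.mfderiv.trans ?_
  change fderivWithin ℂ (chartAt V ((chartAt V x).symm (chartAt V x x)) ∘ (chartAt V x).symm)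
    (Set.range id) (chartAt V x x) = _
  rw [Set.range_id, fderivWithin_univ, hx]
  have : (chartAt V x ∘ (chartAt V x).symm) =ᶠ[𝓝 (chartAt V x x)] id := by
    filter_upwards [(chartAt V x).open_target.mem_nhds (mem_chart_target V x)] with y hy
    exact (chartAt V x).right_inv hy
  exact this.fderiv_eq.trans fderiv_id

theorem inChart_chartAt {k : ℕ} (α : Form V X k) (x : X) :
    inChart α (chartAt V x) (chartAt V x x) = α x := by
  rw [inChart_eq, chartDeriv_chartAt, (chartAt V x).left_inv (mem_chart_source V x)]
  ext v
  rfl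

theorem inChart_eventuallyEq {k : ℕ} (α : Form V X k) {e c : OpenPartialHomeomorph X V}
    (he : e ∈ atlas V X) (hc : c ∈ atlas V X) {z : V} (hz : z ∈ e.target)
    (hzc : e.symm z ∈ c.source) :
    inChart α e =ᶠ[𝓝 z] fun y => (inChart α c (c (e.symm y))).compContinuousLinearMap
      ((fderiv ℂ (fun y => c (e.symm y)) y).restrictScalars ℝ) := by
  filter_upwards [(e.continuousAt_symm hz).preimage_mem_nhds (c.open_source.mem_nhds hzc),
    e.open_target.mem_nhds hz] with y hy hye
  rw [inChart_eq, inChart_eq, chartDeriv_eq_comp he hc hye hy, c.left_inv hy]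
  ext v
  rfl

/-- The operators `∂` and `∂̄` may be computed in any chart. -/
theorem inChart_dForm {ε : ℂ} {k : ℕ} {α : Form V X k} (hα : IsSmooth α)
    {e : OpenPartialHomeomorph X V} (he : e ∈ atlas V X) {z : V} (hz : z ∈ e.target) :
    inChart (dForm ε α) e z = localD ε (inChart α e) z := by
  have hc := chart_mem_atlas V (e.symm z)
  have hzc := mem_chart_source V (e.symm z)
  have hd : DifferentiableAt ℝ (inChart α (chartAt V (e.symm z)))
      (chartAt V (e.symm z) (e.symm z)) :=
    ((hα _ hc).contDiffAt ((chartAt V (e.symm z)).open_target.mem_nhds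
      (mem_chart_target V _))).differentiableAt (by simp)
  rw [localD_congr (inChart_eventuallyEq α he hc hz hzc),
    localD_pullback (contDiffAt_transition he hc hz hzc) hd, inChart_eq,
    chartDeriv_eq_comp he hc hz hzc, chartDeriv_chartAt]
  rfl

theorem isSmooth_dForm [FiniteDimensional ℂ V] {ε : ℂ} {k : ℕ} {α : Form V X k}
    (hα : IsSmooth α) : IsSmooth (dForm ε α) := fun e he =>
  (contDiffOn_localD e.open_target (hα e he)).congr fun _ hz => inChart_dForm hα he hz

/-- `∂̄∂α` at a point, computed in the preferred chart. -/
theorem delbar_del_apply {k : ℕ} {α : Form V X k} (hα : IsSmooth α) (x : X) :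
    delbar (del α) x =
      localDelbar (localDel (inChart α (chartAt V x))) (chartAt V x x) := by
  rw [del_eq, localDel_eq, localDelbar_eq]
  refine localD_congr ?_
  filter_upwards [(chartAt V x).open_target.mem_nhds (mem_chart_target V x)] with y hy
  exact inChart_dForm hα (chart_mem_atlas V x) hy

theorem inChart_delbar_del [FiniteDimensional ℂ V] {k : ℕ} {α : Form V X k} (hα : IsSmooth α)
    {e : OpenPartialHomeomorph X V} (he : e ∈ atlas V X) {z : V} (hz : z ∈ e.target) :
    inChart (delbar (del α)) e z = localDelbar (localDel (inChart α e)) z := by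
  rw [del_eq, delbar_eq, inChart_dForm (isSmooth_dForm hα) he hz, localDel_eq, localDelbar_eq]
  refine localD_congr ?_
  filter_upwards [e.open_target.mem_nhds hz] with y hy using inChart_dForm hα he hy

omit [IsManifold 𝓘(ℂ, V) ω X] in
theorem inChart_ofFunction (f : X → ℂ) (e : OpenPartialHomeomorph X V) :
    inChart (ofFunction V f) e = zeroForm (f ∘ e.symm) := by
  funext z; ext v; rfl

end Charts

end ChernForms

end

noncomputable section

namespace ChernForms

open Filter

/-! ### `∂̄∂` of functions on a manifold -/

section Linear

variable {V : Type*} [NormedAddCommGroup V] [NormedSpace ℂ V] [FiniteDimensional ℂ V]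

theorem ddbar_add {f g : V → ℂ} {U : Set V} (hU : IsOpen U) (hf : ContDiffOn ℝ ∞ f U)
    (hg : ContDiffOn ℝ ∞ g U) {z : V} (hz : z ∈ U) :
    ddbar (fun y => f y + g y) z = ddbar f z + ddbar g z := by
  ext v
  have h1 : ∀ a, dir (fun y => f y + g y) a =ᶠ[𝓝 z] fun y => dir f a y + dir g a y := fun a => by
    filter_upwards [hU.mem_nhds hz] with y hy
    simp only [dir]
    rw [fderiv_fun_add ((hf.contDiffAt (hU.mem_nhds hy)).differentiableAt (by simp))
      ((hg.contDiffAt (hU.mem_nhds hy)).differentiableAt (by simp))]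
    rfl
  have hd : ∀ {f : V → ℂ}, ContDiffOn ℝ ∞ f U → ∀ a, DifferentiableAt ℝ (dir f a) z :=
    fun hf a => ((contDiffOn_dir hU hf a).contDiffAt (hU.mem_nhds hz)).differentiableAt (by simp)
  have h2 : ∀ a b, dir (dir (fun y => f y + g y) a) b z =
      dir (dir f a) b z + dir (dir g a) b z := fun a b => by
    rw [dir, (h1 a).fderiv_eq, fderiv_fun_add (hd hf a) (hd hg a)]
    rfl
  rw [ContinuousAlternatingMap.add_apply, ddbar_apply hU (hf.add hg) hz, ddbar_apply hU hf hz,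
    ddbar_apply hU hg hz, h2, h2]
  ring

theorem ddbar_const_mul (c : ℂ) {f : V → ℂ} {U : Set V} (hU : IsOpen U)
    (hf : ContDiffOn ℝ ∞ f U) {z : V} (hz : z ∈ U) :
    ddbar (fun y => c * f y) z = c • ddbar f z := by
  ext v
  have h1 : ∀ a, dir (fun y => c * f y) a =ᶠ[𝓝 z] fun y => c * dir f a y := fun a => by
    filter_upwards [hU.mem_nhds hz] with y hy
    simp only [dir]
    rw [fderiv_const_mul ((hf.contDiffAt (hU.mem_nhds hy)).differentiableAt (by simp))]
    rfl
  have h2 : ∀ a b, dir (dir (fun y => c * f y) a) b z = c * dir (dir f a) b z := fun a b => by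
    rw [dir, (h1 a).fderiv_eq, fderiv_const_mul
      (((contDiffOn_dir hU hf a).contDiffAt (hU.mem_nhds hz)).differentiableAt (by simp))]
    rfl
  rw [ContinuousAlternatingMap.smul_apply, ddbar_apply hU (contDiffOn_const.mul hf) hz,
    ddbar_apply hU hf hz, h2, h2, smul_eq_mul]
  ring

end Linear

/-! ### The real manifold underlying `X`, and `∂̄∂` as a linear map on functions -/

section Manifold

variable (V : Type*) [NormedAddCommGroup V] [NormedSpace ℂ V]
  (X : Type*) [TopologicalSpace X] [ChartedSpace V X] [IsManifold 𝓘(ℂ, V) ω X]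

/-- The underlying real manifold of a complex manifold. -/
theorem isManifold_real : IsManifold 𝓘(ℝ, V) ∞ X := by
  refine isManifold_of_contDiffOn 𝓘(ℝ, V) ∞ X fun e e' he he' => ?_
  intro z hz
  simp only [mfld_simps] at hz
  exact (((contDiffAt_transition he he' hz.1 hz.2).restrict_scalars ℝ).of_le
    le_top).contDiffWithinAt

/-- Real smooth functions. -/
abbrev SmoothFn : Type _ := ContMDiffMap 𝓘(ℝ, V) 𝓘(ℝ, ℝ) X ℝ ∞

variable {V X}

theorem contDiffOn_chart {F : Type*} [NormedAddCommGroup F] [NormedSpace ℝ F] {f : X → F}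
    (hf : ContMDiff 𝓘(ℝ, V) 𝓘(ℝ, F) ∞ f) {e : OpenPartialHomeomorph X V} (he : e ∈ atlas V X) :
    ContDiffOn ℝ ∞ (f ∘ e.symm) e.target := by
  have := isManifold_real V X
  have h := hf.comp_contMDiffOn (contMDiffOn_symm_of_mem_maximalAtlas
    (IsManifold.subset_maximalAtlas (I := 𝓘(ℝ, V)) (n := ∞) he))
  exact h.contDiffOn

theorem isSmooth_ofFunction [FiniteDimensional ℂ V] {f : X → ℂ}
    (hf : ContMDiff 𝓘(ℝ, V) 𝓘(ℝ, ℂ) ∞ f) : IsSmooth (ofFunction V f) := fun e he => by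
  rw [inChart_ofFunction]
  exact contDiffOn_zeroForm (contDiffOn_chart hf he)

/-- The form `∂̄∂f`. -/
def ddbarForm (V : Type*) [NormedAddCommGroup V] [NormedSpace ℂ V]
    {X : Type*} [TopologicalSpace X] [ChartedSpace V X] (f : X → ℂ) : Form V X 2 :=
  delbar (del (ofFunction V f))

variable [FiniteDimensional ℂ V]

theorem inChart_ddbarForm {f : X → ℂ} (hf : ContMDiff 𝓘(ℝ, V) 𝓘(ℝ, ℂ) ∞ f)
    {e : OpenPartialHomeomorph X V} (he : e ∈ atlas V X) {z : V} (hz : z ∈ e.target) :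
    inChart (ddbarForm V f) e z = ddbar (f ∘ e.symm) z := by
  rw [ddbarForm, inChart_delbar_del (isSmooth_ofFunction hf) he hz, inChart_ofFunction]
  rfl

theorem ddbarForm_apply {f : X → ℂ} (hf : ContMDiff 𝓘(ℝ, V) 𝓘(ℝ, ℂ) ∞ f) (x : X) :
    ddbarForm V f x = ddbar (f ∘ (chartAt V x).symm) (chartAt V x x) := by
  rw [← inChart_ddbarForm hf (chart_mem_atlas V x) (mem_chart_target V x), inChart_chartAt]

theorem ddbarForm_add {f g : X → ℂ} (hf : ContMDiff 𝓘(ℝ, V) 𝓘(ℝ, ℂ) ∞ f)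
    (hg : ContMDiff 𝓘(ℝ, V) 𝓘(ℝ, ℂ) ∞ g) :
    ddbarForm V (fun x => f x + g x) = ddbarForm V f + ddbarForm V g := by
  funext x
  have hfg : ContMDiff 𝓘(ℝ, V) 𝓘(ℝ, ℂ) ∞ fun x => f x + g x := hf.add hg
  rw [Pi.add_apply, ddbarForm_apply hfg, ddbarForm_apply hf, ddbarForm_apply hg]
  exact ddbar_add (chartAt V x).open_target (contDiffOn_chart hf (chart_mem_atlas V x))
    (contDiffOn_chart hg (chart_mem_atlas V x)) (mem_chart_target V x)

theorem ddbarForm_const_mul (c : ℂ) {f : X → ℂ} (hf : ContMDiff 𝓘(ℝ, V) 𝓘(ℝ, ℂ) ∞ f) :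
    ddbarForm V (fun x => c * f x) = c • ddbarForm V f := by
  funext x
  have hcf : ContMDiff 𝓘(ℝ, V) 𝓘(ℝ, ℂ) ∞ fun x => c * f x :=
    (contDiff_const.mul contDiff_id).contMDiff.comp hf
  rw [Pi.smul_apply, ddbarForm_apply hcf, ddbarForm_apply hf]
  exact ddbar_const_mul c (chartAt V x).open_target (contDiffOn_chart hf (chart_mem_atlas V x))
    (mem_chart_target V x)

omit [IsManifold 𝓘(ℂ, V) ω X] [FiniteDimensional ℂ V] in
theorem contMDiff_ofReal {u : X → ℝ} (hu : ContMDiff 𝓘(ℝ, V) 𝓘(ℝ, ℝ) ∞ u) :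
    ContMDiff 𝓘(ℝ, V) 𝓘(ℝ, ℂ) ∞ fun x => (u x : ℂ) :=
  Complex.ofRealCLM.contDiff.contMDiff.comp hu

/-- The form `∂̄∂u` of a real smooth function, as a linear map. -/
def ddbarLM (V X : Type*) [NormedAddCommGroup V] [NormedSpace ℂ V] [FiniteDimensional ℂ V]
    [TopologicalSpace X] [ChartedSpace V X] [IsManifold 𝓘(ℂ, V) ω X] :
    SmoothFn V X →ₗ[ℝ] Form V X 2 where
  toFun u := ddbarForm V fun x => (u x : ℂ)
  map_add' u v := by
    rw [← ddbarForm_add (contMDiff_ofReal u.contMDiff) (contMDiff_ofReal v.contMDiff)]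
    congr 1
    funext x
    simp
  map_smul' r u := by
    rw [show (fun x => ((r • u) x : ℂ)) = fun x => (r : ℂ) * (u x : ℂ) by funext x; simp,
      ddbarForm_const_mul _ (contMDiff_ofReal u.contMDiff)]
    funext x
    ext v
    simp

end Manifold

/-! ### Diagonal metrics -/

section Diagonal

variable {V : Type*} [NormedAddCommGroup V] [NormedSpace ℂ V]

theorem wedge_zero_left {p q : ℕ} (β : V [⋀^Fin q]→L[ℝ] ℂ) :
    wedge (0 : V [⋀^Fin p]→L[ℝ] ℂ) β = 0 := by
  ext v
  rw [wedge_apply]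
  simp

theorem wedge_zero_right {p q : ℕ} (α : V [⋀^Fin p]→L[ℝ] ℂ) :
    wedge α (0 : V [⋀^Fin q]→L[ℝ] ℂ) = 0 := by
  ext v
  rw [wedge_apply]
  simp

variable {X : Type*} [TopologicalSpace X] [ChartedSpace V X]

theorem dForm_zero {ε : ℂ} {k : ℕ} : dForm ε (0 : Form V X k) = 0 := by
  funext x
  have : inChart (0 : Form V X k) (chartAt V x) = fun _ => 0 := by
    funext z; ext v; rfl
  rw [dForm, this, localD]
  ext v
  simp [ContinuousAlternatingMap.alternatizeUncurryFin_apply]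

/-- The metric `diag(e^{u_0}, …, e^{u_{r-1}})`. -/
def diagMetric {r : ℕ} (u : Fin r → SmoothFn V X) : HermitianMetric V X r where
  toFun x := Matrix.diagonal fun i => (Real.exp (u i x) : ℂ)
  smooth i j := by
    by_cases h : i = j
    · subst h
      simp only [Matrix.diagonal_apply_eq]
      exact contMDiff_ofReal (Real.contDiff_exp.contMDiff.comp (u i).contMDiff)
    · simp only [Matrix.diagonal_apply_ne _ h]
      exact contMDiff_const
  posDef x := Matrix.posDef_diagonal_iff.2 fun i => by
    exact_mod_cast Real.exp_pos (u i x)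

variable [IsManifold 𝓘(ℂ, V) ω X] [FiniteDimensional ℂ V]

theorem del_exp {u : X → ℂ} (hu : ContMDiff 𝓘(ℝ, V) 𝓘(ℝ, ℂ) ∞ u) (x : X) :
    del (ofFunction V fun y => Complex.exp (u y)) x =
      Complex.exp (u x) • del (ofFunction V u) x := by
  have hU := (chartAt V x).open_target
  have hz := mem_chart_target V x
  have h1 := contDiffOn_chart hu (chart_mem_atlas V x)
  ext v
  rw [ContinuousAlternatingMap.smul_apply, del_eq, del_eq, dForm, dForm, inChart_ofFunction,
    inChart_ofFunction, localD_zeroForm_apply hU h1 hz,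
    localD_zeroForm_apply hU (f := (fun y => Complex.exp (u y)) ∘ (chartAt V x).symm) h1.cexp hz]
  have hd := (h1.contDiffAt (hU.mem_nhds hz)).differentiableAt (by simp)
  have h2 : fderiv ℝ ((fun y => Complex.exp (u y)) ∘ (chartAt V x).symm) (chartAt V x x) =
      Complex.exp (u x) • fderiv ℝ (u ∘ (chartAt V x).symm) (chartAt V x x) := by
    have := hd.hasFDerivAt.cexp.fderiv
    rw [Function.comp_apply, (chartAt V x).left_inv (mem_chart_source V x)] at this
    exact this
  simp only [dOp, dir, h2]
  simp
  ring

/-- Diagonal entries are `e^{-u} ∂(e^u) = ∂u`: the exponential makes the curvature linear in `u`,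
which is what polarization needs. -/
theorem connection_diagMetric {r : ℕ} (u : Fin r → SmoothFn V X) (i j : Fin r) :
    (diagMetric u).connection i j =
      if i = j then del (ofFunction V fun x => (u i x : ℂ)) else 0 := by
  funext x
  have hinv : ((diagMetric u).toFun x)⁻¹ =
      Matrix.diagonal fun i => ((Real.exp (u i x) : ℂ))⁻¹ := by
    refine Matrix.inv_eq_right_inv ?_
    rw [diagMetric, Matrix.diagonal_mul_diagonal]
    have : (fun i => (Real.exp (u i x) : ℂ) * ((Real.exp (u i x) : ℂ))⁻¹) = fun _ => 1 := by
      funext i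
      exact mul_inv_cancel₀ (by exact_mod_cast (Real.exp_pos _).ne')
    rw [this, Matrix.diagonal_one]
  simp only [HermitianMetric.connection, hinv]
  rw [Finset.sum_eq_single i (fun l _ hl => by
    rw [Matrix.diagonal_apply_ne _ hl.symm]; ext v; exact zero_mul _)
    (fun h => absurd (Finset.mem_univ i) h), Matrix.diagonal_apply_eq]
  by_cases h : i = j
  · subst h
    rw [if_pos rfl]
    have : (fun y => (diagMetric u).toFun y i i) = fun y => Complex.exp (u i y : ℂ) := by
      funext y
      simp [diagMetric]
    rw [this, del_exp (contMDiff_ofReal (u i).contMDiff), smul_smul, Complex.ofReal_exp,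
      inv_mul_cancel₀ (Complex.exp_ne_zero _), one_smul]
  · rw [if_neg h]
    have : (fun y => (diagMetric u).toFun y i j) = fun _ => 0 := by
      funext y
      simp [diagMetric, h]
    have h0 : ofFunction V (fun _ : X => (0 : ℂ)) = 0 := by
      funext y; ext v; rfl
    rw [this, h0, del_eq, dForm_zero, Pi.zero_apply]
    ext v
    exact mul_zero _

theorem curvature_diagMetric {r : ℕ} (u : Fin r → SmoothFn V X) (i j : Fin r) :
    (diagMetric u).curvature i j = if i = j then ddbarLM V X (u i) else 0 := by
  rw [HermitianMetric.curvature, connection_diagMetric]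
  split_ifs
  · rfl
  · rw [delbar_eq, dForm_zero]

theorem curvaturePow_diagMetric {r : ℕ} (u : Fin r → SmoothFn V X) (p : ℕ) (i j : Fin r) (x : X) :
    (diagMetric u).curvaturePow p i j x =
      if i = j then wprod p (fun _ => ddbarLM V X (u i) x) else 0 := by
  induction p generalizing j with
  | zero =>
    by_cases h : i = j
    · subst h
      rw [if_pos rfl, HermitianMetric.curvaturePow]
      simp only [Matrix.one_apply_eq]
      rfl
    · rw [if_neg h, HermitianMetric.curvaturePow]
      simp only [Matrix.one_apply_ne h]
      rfl
  | succ p ih =>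
    change ∑ l, wedge ((diagMetric u).curvaturePow p i l x) ((diagMetric u).curvature l j x) = _
    rw [Finset.sum_eq_single i (fun l _ hl => by rw [ih, if_neg hl.symm, wedge_zero_left])
      (fun h => absurd (Finset.mem_univ i) h), ih, if_pos rfl, curvature_diagMetric]
    by_cases h : i = j
    · subst h
      rw [if_pos rfl, if_pos rfl]
      rfl
    · rw [if_neg h, if_neg h, Pi.zero_apply, wedge_zero_right]

/-- The form `(i / 2π)^m ∂̄∂u_1 ∧ ⋯ ∧ ∂̄∂u_m` as a multilinear function of `u_1, …, u_m`. -/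
def ddbarProd (V X : Type*) [NormedAddCommGroup V] [NormedSpace ℂ V] [FiniteDimensional ℂ V]
    [TopologicalSpace X] [ChartedSpace V X] [IsManifold 𝓘(ℂ, V) ω X] (m : ℕ) :
    MultilinearMap ℝ (fun _ : Fin m => SmoothFn V X) (Form V X (2 * m)) :=
  MultilinearMap.pi fun x =>
    (((Complex.I / (2 * (Real.pi : ℂ))) ^ m • wprodMultilinear m).restrictScalars ℝ).compLinearMap
      fun _ => (LinearMap.proj x).comp (ddbarLM V X)

theorem ddbarProd_apply {m : ℕ} (u : Fin m → SmoothFn V X) (x : X) :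
    ddbarProd V X m u x = (Complex.I / (2 * (Real.pi : ℂ))) ^ m •
      wprod m fun i => ddbarLM V X (u i) x := rfl

theorem ddbarProd_comp_perm {m : ℕ} (u : Fin m → SmoothFn V X) (π : Equiv.Perm (Fin m)) :
    ddbarProd V X m (u ∘ π) = ddbarProd V X m u := by
  funext x
  rw [ddbarProd_apply, ddbarProd_apply]
  congr 1
  exact wprod_comp_perm (fun i => ddbarLM V X (u i) x) π

theorem ddbarProd_eq_zero {m : ℕ} (hm : Module.finrank ℝ V < m) (u : Fin m → SmoothFn V X) :
    ddbarProd V X m u = 0 := by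
  have : FiniteDimensional ℝ V := FiniteDimensional.complexToReal V
  funext x
  exact eq_zero_of_finrank_lt (by omega) _

/-- The Chern character forms of the trivial line bundle with the metric `e^u`. -/
def lineChern (u : SmoothFn V X) (p : ℕ) : Form V X (2 * p) :=
  (1 / (p.factorial : ℝ)) • ddbarProd V X p fun _ => u

theorem chernCharacter_diagMetric {r : ℕ} (u : Fin r → SmoothFn V X) (p : ℕ) :
    (diagMetric u).chernCharacter p = ∑ i, lineChern (u i) p := by
  funext x
  rw [HermitianMetric.chernCharacter, Pi.smul_apply, Matrix.trace, Finset.sum_apply,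
    Finset.sum_apply, Finset.smul_sum]
  refine Finset.sum_congr rfl fun i _ => ?_
  rw [Matrix.diag_apply, curvaturePow_diagMetric, if_pos rfl, lineChern, Pi.smul_apply,
    ddbarProd_apply, mul_smul]
  ext v
  simp

end Diagonal

end ChernForms

end

noncomputable section

namespace ChernForms

open Filter

/-! ### Polarization -/

section Polarization

/-- If `f` misses `j`, adding or removing `j` is a sign-reversing involution on the sets containing
the image of `f`. If `f` is surjective, only the full set contains its image, with sign `(-1) ^ (2k)
= 1`. -/
theorem sum_neg_one_pow_supersets {k m : ℕ} (f : Fin m → Fin k) :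
    (∑ S : Finset (Fin k), if ∀ i, f i ∈ S then (-1 : ℤ) ^ (k + S.card) else 0) =
      if Function.Surjective f then 1 else 0 := by
  split_ifs with hf
  · rw [Finset.sum_eq_single Finset.univ]
    · simp [← two_mul]
    · intro S _ hS
      rw [if_neg]
      intro h
      refine hS (Finset.eq_univ_of_forall fun j => ?_)
      obtain ⟨i, rfl⟩ := hf j
      exact h i
    · simp
  · obtain ⟨j, hj⟩ : ∃ j, ∀ i, f i ≠ j := by simpa [Function.Surjective] using hf
    have hmem : ∀ (S : Finset (Fin k)), (∀ i, f i ∈ symmDiff S {j}) ↔ ∀ i, f i ∈ S := fun S => by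
      simp [Finset.mem_symmDiff, hj]
    have hcard : ∀ S : Finset (Fin k),
        (-1 : ℤ) ^ (k + (symmDiff S {j}).card) = -(-1) ^ (k + S.card) := fun S => by
      by_cases h : j ∈ S
      · have : symmDiff S {j} = S.erase j := by
          ext a; simp only [Finset.mem_symmDiff, Finset.mem_singleton, Finset.mem_erase]
          constructor
          · rintro (⟨h1, h2⟩ | ⟨h1, h2⟩)
            · exact ⟨h2, h1⟩
            · exact absurd (h1 ▸ h) h2
          · exact fun h => Or.inl ⟨h.2, h.1⟩
        rw [this, ← Finset.card_erase_add_one h, ← add_assoc, pow_succ]; ring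
      · have : symmDiff S {j} = insert j S := by
          ext a; simp only [Finset.mem_symmDiff, Finset.mem_singleton, Finset.mem_insert]
          constructor
          · rintro (⟨h1, h2⟩ | ⟨h1, h2⟩)
            · exact Or.inr h1
            · exact Or.inl h1
          · rintro (h1 | h1)
            · exact Or.inr ⟨h1, h1 ▸ h⟩
            · exact Or.inl ⟨h1, fun h2 => h (h2 ▸ h1)⟩
        rw [this, Finset.card_insert_of_notMem h, ← add_assoc, pow_succ]; ring
    refine Finset.sum_involution (fun S _ => symmDiff S {j}) (fun S _ => ?_) (fun S _ _ => ?_)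
      (fun S _ => Finset.mem_univ _) (fun S _ => ?_)
    · simp only [hmem, hcard]
      split_ifs <;> simp
    · intro h
      have h1 := congrArg (fun T => symmDiff S T) h
      simp only [symmDiff_symmDiff_cancel_left, symmDiff_self] at h1
      simp at h1
    · simp

variable {M N : Type*} [AddCommGroup M] [Module ℝ M] [AddCommGroup N] [Module ℝ N]

/-- Inclusion-exclusion for the diagonal values of a multilinear map. -/
theorem sum_neg_one_pow_map_sum {k m : ℕ} (P : MultilinearMap ℝ (fun _ : Fin m => M) N)
    (u : Fin k → M) :
    ∑ S : Finset (Fin k), (-1 : ℤ) ^ (k + S.card) • P (fun _ => ∑ j ∈ S, u j) =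
      ∑ f : Fin m → Fin k with Function.Surjective f, P (u ∘ f) := by
  have h1 : ∀ S : Finset (Fin k), P (fun _ => ∑ j ∈ S, u j) =
      ∑ f : Fin m → Fin k, if ∀ i, f i ∈ S then P (u ∘ f) else 0 := fun S => by
    rw [P.map_sum_finset (fun _ j => u j) fun _ => S, ← Finset.sum_filter]
    refine Finset.sum_congr ?_ fun f _ => rfl
    ext f
    simp [Fintype.mem_piFinset]
  simp only [h1, Finset.smul_sum]
  rw [Finset.sum_comm, Finset.sum_filter]
  refine Finset.sum_congr rfl fun f _ => ?_
  have h2 := congrArg (fun n : ℤ => n • P (u ∘ f)) (sum_neg_one_pow_supersets f)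
  simp only [Finset.sum_smul] at h2
  refine Eq.trans (Finset.sum_congr rfl fun S _ => ?_) (h2.trans ?_)
  · split_ifs <;> simp
  · split_ifs <;> simp

/-- Polarization of a symmetric multilinear map. -/
theorem sum_surjective_symmetric {k : ℕ} (P : MultilinearMap ℝ (fun _ : Fin k => M) N)
    (hP : ∀ u (π : Equiv.Perm (Fin k)), P (u ∘ π) = P u) (u : Fin k → M) :
    ∑ f : Fin k → Fin k with Function.Surjective f, P (u ∘ f) = (k.factorial : ℝ) • P u := by
  have : ∀ f ∈ Finset.univ.filter fun f : Fin k → Fin k => Function.Surjective f,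
      P (u ∘ f) = P u := fun f hf => by
    have hf' : Function.Bijective f :=
      Finite.surjective_iff_bijective.1 (Finset.mem_filter.1 hf).2
    exact hP u (Equiv.ofBijective f hf')
  rw [Finset.sum_congr rfl this, Finset.sum_const]
  have hc : (Finset.univ.filter fun f : Fin k → Fin k => Function.Surjective f).card =
      k.factorial := by
    have h1 : Fintype.card (Equiv.Perm (Fin k)) = k.factorial := by simp [Fintype.card_perm]
    rw [← h1, ← Finset.card_univ]
    refine (Finset.card_bij (fun (π : Equiv.Perm (Fin k)) _ => (π : Fin k → Fin k))
      (fun π _ => by simp [π.surjective]) (fun π _ ρ _ h => DFunLike.coe_injective h)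
      fun f hf => ?_).symm
    exact ⟨Equiv.ofBijective f (Finite.surjective_iff_bijective.1 (Finset.mem_filter.1 hf).2),
      Finset.mem_univ _, rfl⟩
  rw [hc, Nat.cast_smul_eq_nsmul]

end Polarization

/-! ### Differences of Chern character forms -/

section Differences

variable (V : Type*) [NormedAddCommGroup V] [NormedSpace ℂ V] [FiniteDimensional ℂ V]
  (X : Type*) [TopologicalSpace X] [ChartedSpace V X] [IsManifold 𝓘(ℂ, V) ω X]

/-- The group of differences of Chern character forms of diagonal metrics. -/
def chernDiff : AddSubgroup ((p : ℕ) → Form V X (2 * p)) where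
  carrier := {w | ∃ (r : ℕ) (u v : Fin r → SmoothFn V X),
    ∀ p, ∑ i, lineChern (u i) p - ∑ i, lineChern (v i) p = w p}
  zero_mem' := ⟨0, fun i => i.elim0, fun i => i.elim0, fun p => by simp⟩
  add_mem' := by
    rintro w w' ⟨r, u, v, h⟩ ⟨r', u', v', h'⟩
    -- Direct sum of bundles. Both metrics of each pair have the same rank, so the sums do too.
    refine ⟨r + r', Fin.append u u', Fin.append v v', fun p => ?_⟩
    simp only [Fin.sum_univ_add, Fin.append_left, Fin.append_right]
    rw [Pi.add_apply, ← h, ← h']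
    abel
  neg_mem' := by
    rintro w ⟨r, u, v, h⟩
    refine ⟨r, v, u, fun p => ?_⟩
    rw [Pi.neg_apply, ← h, neg_sub]

variable {V X}

theorem exists_metrics_of_mem_chernDiff {w : (p : ℕ) → Form V X (2 * p)}
    (hw : w ∈ chernDiff V X) : ∃ (r : ℕ) (h₁ h₂ : HermitianMetric V X r),
      ∀ p, h₁.chernCharacter p - h₂.chernCharacter p = w p := by
  obtain ⟨r, u, v, h⟩ := hw
  exact ⟨r, diagMetric u, diagMetric v, fun p => by
    rw [chernCharacter_diagMetric, chernCharacter_diagMetric, h]⟩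

theorem lineChern_sub_mem (u v : SmoothFn V X) : lineChern u - lineChern v ∈ chernDiff V X :=
  ⟨1, fun _ => u, fun _ => v, fun p => by simp⟩

/-- The family of forms whose only nonzero component is `α`, in degree `2 m`. -/
def single {m : ℕ} (α : Form V X (2 * m)) : (p : ℕ) → Form V X (2 * p) := Pi.single m α

omit [TopologicalSpace X] [ChartedSpace V X] [FiniteDimensional ℂ V] [IsManifold 𝓘(ℂ, V) ω X] in
theorem single_zero {m : ℕ} : single (0 : Form V X (2 * m)) = 0 := by
  rw [single, Pi.single_zero]

/-- `(i / 2π)^k ∂̄∂u_1 ∧ ⋯ ∧ ∂̄∂u_k` is a difference of Chern character forms. -/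
theorem single_ddbarProd_mem {k : ℕ} (hk : 1 ≤ k) (u : Fin k → SmoothFn V X) :
    single (ddbarProd V X k u) ∈ chernDiff V X := by
  -- The induction is descending in the number `k` of factors; `d` bounds how far `k` is from the
  -- range where the product vanishes for reasons of dimension.
  obtain ⟨d, hd⟩ : ∃ d, Module.finrank ℝ V < k + d := ⟨Module.finrank ℝ V + 1, by omega⟩
  induction d using Nat.strong_induction_on generalizing k with
  | _ d ih =>
  by_cases hkn : Module.finrank ℝ V < k
  · rw [ddbarProd_eq_zero hkn, single_zero]
    exact zero_mem _
  have hhigh : ∀ m ∈ Finset.Ioc k (Module.finrank ℝ V), single ((1 / (m.factorial : ℝ)) •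
      ∑ f : Fin m → Fin k with Function.Surjective f, ddbarProd V X m (u ∘ f)) ∈
        chernDiff V X := fun m hm => by
    rw [Finset.mem_Ioc] at hm
    rw [Finset.smul_sum]
    have : single (∑ f : Fin m → Fin k with Function.Surjective f,
        (1 / (m.factorial : ℝ)) • ddbarProd V X m (u ∘ f)) =
        ∑ f : Fin m → Fin k with Function.Surjective f,
          single ((1 / (m.factorial : ℝ)) • ddbarProd V X m (u ∘ f)) :=
      map_sum (AddMonoidHom.single (fun p : ℕ => Form V X (2 * p)) m) _ _
    rw [this]
    refine sum_mem fun f _ => ?_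
    -- `chernDiff` is only an additive group, so the scalar `1 / m!` has to be moved into one of the
    -- functions; the induction hypothesis holds for all functions.
    let i : Fin m := ⟨0, by omega⟩
    rw [← Function.update_eq_self i (u ∘ f), ← MultilinearMap.map_update_smul]
    exact ih (d - (m - k)) (by omega) (by omega) _ (by omega)
  have hsum : (∑ S : Finset (Fin k), (-1 : ℤ) ^ (k + S.card) •
      (lineChern (∑ j ∈ S, u j) - lineChern 0)) ∈ chernDiff V X :=
    sum_mem fun S _ => zsmul_mem (lineChern_sub_mem _ _) _
  -- Subtracting the flat metric, needed to stay among differences, costs nothing: the signs add up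
  -- to `0`. This is the inclusion-exclusion formula for the empty map, which is not surjective as
  -- `k ≥ 1`.
  have hsign : (∑ S : Finset (Fin k), (-1 : ℤ) ^ (k + S.card)) = 0 := by
    have h := sum_neg_one_pow_supersets (fun i : Fin 0 => (i.elim0 : Fin k))
    rw [if_neg (fun h => (h ⟨0, by omega⟩).elim fun i _ => i.elim0)] at h
    simpa using h
  have hval : ∀ p, (∑ S : Finset (Fin k), (-1 : ℤ) ^ (k + S.card) •
      (lineChern (∑ j ∈ S, u j) - lineChern (0 : SmoothFn V X))) p = (1 / (p.factorial : ℝ)) •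
      ∑ f : Fin p → Fin k with Function.Surjective f, ddbarProd V X p (u ∘ f) := fun p => by
    rw [← sum_neg_one_pow_map_sum, Finset.sum_apply]
    simp only [smul_sub, Finset.sum_sub_distrib, Pi.smul_apply, Pi.sub_apply]
    rw [← Finset.sum_smul, hsign, zero_smul, sub_zero, Finset.smul_sum]
    refine Finset.sum_congr rfl fun S _ => ?_
    rw [lineChern, smul_comm]
  have key : single (ddbarProd V X k u) = (∑ S : Finset (Fin k), (-1 : ℤ) ^ (k + S.card) •
      (lineChern (∑ j ∈ S, u j) - lineChern 0)) -
      ∑ m ∈ Finset.Ioc k (Module.finrank ℝ V), single ((1 / (m.factorial : ℝ)) •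
      ∑ f : Fin m → Fin k with Function.Surjective f, ddbarProd V X m (u ∘ f)) := by
    funext p
    rw [Pi.sub_apply, hval, Finset.sum_apply]
    have hs : ∀ m ∈ Finset.Ioc k (Module.finrank ℝ V), m ≠ p →
        single ((1 / (m.factorial : ℝ)) • ∑ f : Fin m → Fin k with Function.Surjective f,
          ddbarProd V X m (u ∘ f)) p = 0 := fun m _ hmp => Pi.single_eq_of_ne hmp.symm _
    by_cases hp : p ∈ Finset.Ioc k (Module.finrank ℝ V)
    · rw [Finset.sum_eq_single p hs (fun h => absurd hp h)]
      rw [Finset.mem_Ioc] at hp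
      unfold single
      rw [Pi.single_eq_same, sub_self, Pi.single_eq_of_ne (by omega)]
    · rw [Finset.sum_eq_zero fun m hm => hs m hm fun h => hp (h ▸ hm), sub_zero]
      rw [Finset.mem_Ioc] at hp
      rcases lt_trichotomy p k with h | h | h
      · rw [single, Pi.single_eq_of_ne (by omega), Finset.filter_eq_empty_iff.2,
          Finset.sum_empty, smul_zero]
        intro f _ hf
        have := Fintype.card_le_of_surjective f hf
        simp at this
        omega
      · subst h
        rw [sum_surjective_symmetric _ fun u π => ddbarProd_comp_perm u π, smul_smul,
          one_div_mul_cancel (by exact_mod_cast p.factorial_ne_zero), one_smul, single,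
          Pi.single_eq_same]
      · rw [single, Pi.single_eq_of_ne (by omega), Finset.sum_eq_zero, smul_zero]
        exact fun f _ => ddbarProd_eq_zero (by omega) _
  rw [key]
  exact sub_mem hsum (sum_mem hhigh)

end Differences

end ChernForms

end

noncomputable section

namespace ChernForms

open Filter

/-! ### Immersions of noncompact manifolds into Euclidean spaces -/

section GenericPosition

variable {E W : Type*} [NormedAddCommGroup E] [NormedSpace ℝ E] [FiniteDimensional ℝ E]
  [NormedAddCommGroup W] [NormedSpace ℝ W] [FiniteDimensional ℝ W] {κ : Type*} [DecidableEq κ]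

/-- The vectors `w` such that the derivative of `∑ k ∈ T, g k • w k` does not vanish on `K × L`. -/
def goodVectors (T : Finset κ) (g : κ → E → ℝ) (K L : Set E) : Set (κ → W) :=
  {w | ∀ q ∈ K ×ˢ L, ∑ k ∈ T, fderiv ℝ (g k) q.1 q.2 • w k ≠ 0}

variable {T : Finset κ} {g : κ → E → ℝ} {B K L : Set E}

omit [FiniteDimensional ℝ E] in
theorem contDiffOn_fderiv_prod {f : E → ℝ} (hB : IsOpen B) (hf : ContDiffOn ℝ ∞ f B) :
    ContDiffOn ℝ ∞ (fun q : E × E => fderiv ℝ f q.1 q.2) (B ×ˢ Set.univ) :=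
  ((hf.fderiv_of_isOpen hB (m := ∞) (by simp)).comp contDiff_fst.contDiffOn
    fun q hq => hq.1).clm_apply contDiff_snd.contDiffOn

-- Nonvanishing is an open condition in all the variables together, and compactness of `K × L` makes
-- it uniform.
omit [FiniteDimensional ℝ E] [FiniteDimensional ℝ W] [DecidableEq κ] in
theorem isOpen_goodVectors (hB : IsOpen B) (hg : ∀ k ∈ T, ContDiffOn ℝ ∞ (g k) B)
    (hK : IsCompact K) (hL : IsCompact L) (hKB : K ⊆ B) :
    IsOpen (goodVectors T g K L : Set (κ → W)) := by
  rw [isOpen_iff_mem_nhds]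
  intro w hw
  refine (hK.prod hL).eventually_forall_of_forall_eventually
    (P := fun (w : κ → W) (q : E × E) => ∑ k ∈ T, fderiv ℝ (g k) q.1 q.2 • w k ≠ 0) fun q hq => ?_
  have hc : ContinuousAt (fun y : (κ → W) × E × E =>
      ∑ k ∈ T, fderiv ℝ (g k) y.2.1 y.2.2 • y.1 k) (w, q) := by
    refine tendsto_finsetSum _ fun k hk => ?_
    have h1 : ContinuousAt (fun q : E × E => fderiv ℝ (g k) q.1 q.2) q :=
      (contDiffOn_fderiv_prod hB (hg k hk)).continuousOn.continuousAt
        ((hB.prod isOpen_univ).mem_nhds ⟨hKB hq.1, Set.mem_univ _⟩)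
    have h2 : ContinuousAt (fun y : (κ → W) × E × E => fderiv ℝ (g k) y.2.1 y.2.2) (w, q) :=
      h1.tendsto.comp (f := fun y : (κ → W) × E × E => y.2) continuousAt_snd
    exact h2.smul ((continuous_apply k).continuousAt.comp continuousAt_fst)
  exact hc.eventually_ne (hw q hq)

/-- Only the coordinate `w k₀` is moved. Since `g k₀` has derivative `1` along vectors of `L`,
vanishing at `(z, v)` can be solved for `w k₀`, and the bad values lie in a smooth image of a set of
dimension `2 dim E < dim W`. -/
theorem dense_goodVectors (hB : IsOpen B) (hBc : Convex ℝ B)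
    (hg : ∀ k ∈ T, ContDiffOn ℝ ∞ (g k) B) (hKB : K ⊆ B)
    (hW : 2 * Module.finrank ℝ E < Module.finrank ℝ W) {k₀ : κ} (hk₀ : k₀ ∈ T) {l : E →L[ℝ] ℝ}
    (hl : Set.EqOn (g k₀) l B) (hL : ∀ v ∈ L, l v = 1) :
    Dense (goodVectors T g K L : Set (κ → W)) := by
  intro w
  -- At the points considered the `k₀` term of the sum is `w k₀`, so `Ψ` is minus the sum over the
  -- other indices: exactly the bad value of the coordinate `k₀`.
  let Ψ : E × E → W := fun q => w k₀ - ∑ k ∈ T, fderiv ℝ (g k) q.1 q.2 • w k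
  have hΨ : ContDiffOn ℝ 1 Ψ (B ×ˢ Set.univ) := by
    refine contDiffOn_const.sub (ContDiffOn.sum fun k hk => ?_)
    exact ((contDiffOn_fderiv_prod hB (hg k hk)).of_le (by norm_cast)).smul contDiffOn_const
  have hdim : dimH (B ×ˢ (Set.univ : Set E)) < Module.finrank ℝ W := by
    refine (dimH_mono (Set.subset_univ _)).trans_lt ?_
    rw [Real.dimH_univ_eq_finrank, Module.finrank_prod]
    exact_mod_cast (by omega)
  have hdense := hΨ.dense_compl_image_of_dimH_lt_finrank (hBc.prod convex_univ) subset_rfl hdim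
  have hmaps : Set.MapsTo (Function.update w k₀) (Ψ '' (B ×ˢ Set.univ))ᶜ
      (goodVectors T g K L : Set (κ → W)) := by
    rintro y hy ⟨z, v⟩ ⟨hz, hv⟩ h0
    refine hy ⟨(z, v), ⟨hKB hz, Set.mem_univ _⟩, ?_⟩
    have hder : fderiv ℝ (g k₀) z v = 1 := by
      rw [(hl.eventuallyEq_of_mem (hB.mem_nhds (hKB hz))).fderiv_eq, l.fderiv, hL v hv]
    rw [← Finset.add_sum_erase T _ hk₀] at h0
    simp only [Ψ]
    rw [← Finset.add_sum_erase T _ hk₀]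
    rw [Finset.sum_congr rfl fun k hk => by
      rw [Function.update_of_ne (Finset.ne_of_mem_erase hk)]] at h0
    rw [Function.update_self] at h0
    simp only [hder, one_smul] at h0 ⊢
    rw [sub_add_cancel_left, ← eq_neg_of_add_eq_zero_left h0]
  have hw := map_mem_closure (f := Function.update w k₀) (by fun_prop) (hdense (w k₀)) hmaps
  rwa [Function.update_eq_self] at hw

end GenericPosition

/-! ### Construction of the immersion by Baire category -/

section Immersion

/-- A Hausdorff second countable manifold admits finitely many smooth functions whose differentials
span the cotangent space at every point. -/
theorem exists_immersion (E X : Type*) [NormedAddCommGroup E] [NormedSpace ℝ E]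
    [FiniteDimensional ℝ E] [TopologicalSpace X] [T2Space X] [SecondCountableTopology X]
    [ChartedSpace E X] [IsManifold 𝓘(ℝ, E) ∞ X] :
    ∃ (N : ℕ) (f : Fin N → X → ℝ), (∀ a, ContMDiff 𝓘(ℝ, E) 𝓘(ℝ, ℝ) ∞ (f a)) ∧
      ∀ x, ∃ e ∈ atlas E X, x ∈ e.source ∧
        ∀ v ≠ 0, ∃ a, fderiv ℝ (f a ∘ e.symm) (e x) v ≠ 0 := by
  classical
  have : LocallyCompactSpace X := ChartedSpace.locallyCompactSpace E X
  obtain ⟨ι, fs, -⟩ := SmoothBumpCovering.exists_isSubordinate 𝓘(ℝ, E) (M := X)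
    (s := Set.univ) isClosed_univ (U := fun _ => Set.univ) fun _ _ => univ_mem
  -- Countability makes `κ → W` a countable product of complete metric spaces, to which the Baire
  -- theorem applies.
  have hι : Countable ι := Set.countable_univ_iff.1
    (fs.locallyFinite.countable_univ fun i => (fs i).nonempty_support)
  let b := Module.finBasis ℝ E
  let l : Fin (Module.finrank ℝ E) → E →L[ℝ] ℝ := fun a =>
    LinearMap.toContinuousLinearMap (b.coord a)
  -- One dimension more than the space of pairs (point, tangent vector), as the dimension count in
  -- `dense_goodVectors` requires.
  let W := Fin (2 * Module.finrank ℝ E + 1) → ℝ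
  let κ := ι × Fin (Module.finrank ℝ E)
  let u : κ → X → ℝ := fun k x => fs k.1 x • l k.2 (chartAt E (fs.c k.1) x)
  have hu : ∀ k, ContMDiff 𝓘(ℝ, E) 𝓘(ℝ, ℝ) ∞ (u k) := fun k =>
    (fs k.1).contMDiff_smul ((l k.2).contMDiff.comp_contMDiffOn contMDiffOn_chart)
  have husupp : ∀ k x, u k x ≠ 0 → fs k.1 x ≠ 0 := fun k x h h0 => h (by simp [u, h0])
  -- The candidate immersions: cut-off coordinate functions with vector coefficients `w`, to be
  -- chosen generically.
  let F : (κ → W) → X → W := fun w x => ∑ᶠ k, u k x • w k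
  have hFsupp : ∀ w : κ → W, LocallyFinite fun k => Function.support fun x => u k x • w k :=
    fun w x => by
      obtain ⟨t, ht, hfin⟩ := fs.locallyFinite x
      refine ⟨t, ht, (hfin.prod Set.finite_univ).subset ?_⟩
      rintro k ⟨y, hy, hyt⟩
      exact ⟨⟨y, husupp k y fun h => hy (by simp [h]), hyt⟩, Set.mem_univ _⟩
  have hF : ∀ w, ContMDiff 𝓘(ℝ, E) 𝓘(ℝ, W) ∞ (F w) := fun w =>
    contMDiff_finsum (fun k => (hu k).smul contMDiff_const) (hFsupp w)
  -- local data around a point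
  have hloc : ∀ x : X, ∃ (i : ι) (r : ℝ) (T : Finset κ), 0 < r ∧
      x ∈ (chartAt E (fs.c i)).source ∧
      Metric.ball (chartAt E (fs.c i) x) (2 * r) ⊆ (chartAt E (fs.c i)).target ∧
      (∀ a, (i, a) ∈ T) ∧
      (∀ a, Set.EqOn (u (i, a) ∘ (chartAt E (fs.c i)).symm) (l a)
        (Metric.ball (chartAt E (fs.c i) x) (2 * r))) ∧
      ∀ w : κ → W, Set.EqOn (F w ∘ (chartAt E (fs.c i)).symm)
        (fun z => ∑ k ∈ T, u k ((chartAt E (fs.c i)).symm z) • w k)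
        (Metric.ball (chartAt E (fs.c i) x) (2 * r)) := fun x => by
    obtain ⟨i, hi⟩ := fs.eventuallyEq_one' x (Set.mem_univ x)
    change fs i =ᶠ[𝓝 x] 1 at hi
    have hx : x ∈ (chartAt E (fs.c i)).source :=
      (fs i).support_subset_source (by simp [hi.eq_of_nhds])
    obtain ⟨t, ht, hfin⟩ := fs.locallyFinite x
    let T : Finset κ := hfin.toFinset ×ˢ Finset.univ
    have hev : ∀ᶠ z in 𝓝 (chartAt E (fs.c i) x), z ∈ (chartAt E (fs.c i)).target ∧
        (chartAt E (fs.c i)).symm z ∈ t ∧ fs i ((chartAt E (fs.c i)).symm z) = 1 := by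
      have hc := (chartAt E (fs.c i)).continuousAt_symm ((chartAt E (fs.c i)).map_source hx)
      rw [ContinuousAt, (chartAt E (fs.c i)).left_inv hx] at hc
      filter_upwards [(chartAt E (fs.c i)).open_target.mem_nhds
        ((chartAt E (fs.c i)).map_source hx), hc ht, hc hi] with z h1 h2 h3
      exact ⟨h1, h2, h3⟩
    obtain ⟨ρ, hρ, hball⟩ := Metric.eventually_nhds_iff_ball.1 hev
    refine ⟨i, ρ / 2, T, by positivity, hx, ?_, fun a => ?_, fun a z hz => ?_, fun w z hz => ?_⟩
    · rw [mul_div_cancel₀ _ two_ne_zero]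
      exact fun z hz => (hball z hz).1
    · have : i ∈ hfin.toFinset := by
        rw [Set.Finite.mem_toFinset]
        exact ⟨x, by simp [hi.eq_of_nhds], mem_of_mem_nhds ht⟩
      exact Finset.mem_product.2 ⟨this, Finset.mem_univ _⟩
    · rw [mul_div_cancel₀ _ two_ne_zero] at hz
      obtain ⟨h1, -, h3⟩ := hball z hz
      simp only [u, Function.comp_apply, h3, (chartAt E (fs.c i)).right_inv h1, one_smul]
    · rw [mul_div_cancel₀ _ two_ne_zero] at hz
      obtain ⟨h1, h2, -⟩ := hball z hz
      refine finsum_eq_sum_of_support_subset _ fun k hk => ?_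
      have hk' : fs k.1 ((chartAt E (fs.c i)).symm z) ≠ 0 :=
        husupp k _ fun h => hk (by simp [h])
      have : k.1 ∈ hfin.toFinset := by
        rw [Set.Finite.mem_toFinset]
        exact ⟨_, hk', h2⟩
      exact Finset.mem_coe.2 (Finset.mem_product.2 ⟨this, Finset.mem_univ _⟩)
  choose i r T hr hxs hbt hiT hul hFT using hloc
  let e : X → OpenPartialHomeomorph X E := fun x => chartAt E (fs.c (i x))
  let B : X → Set E := fun x => Metric.ball (e x x) (2 * r x)
  let K : X → Set E := fun x => Metric.closedBall (e x x) (r x)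
  -- Every nonzero tangent vector has a multiple on which some coordinate equals `1`. Cutting by
  -- balls makes these slices compact, and countably many of them suffice.
  let L : Fin (Module.finrank ℝ E) → ℕ → Set E := fun a n => Metric.closedBall 0 n ∩ l a ⁻¹' {1}
  let g : X → κ → E → ℝ := fun x k => u k ∘ (e x).symm
  have hg : ∀ x k, ContDiffOn ℝ ∞ (g x k) (B x) := fun x k =>
    (((hu k).comp_contMDiffOn contMDiffOn_chart_symm).contDiffOn).mono (hbt x)
  have hKB : ∀ x, K x ⊆ B x := fun x =>
    Metric.closedBall_subset_ball (by linarith [hr x])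
  have hL : ∀ a n, IsCompact (L a n) := fun a n =>
    (isCompact_closedBall (0 : E) (n : ℝ)).inter_right (isClosed_singleton.preimage (l a).continuous)
  have hnhds : ∀ x, (e x).source ∩ (e x) ⁻¹' K x ∈ 𝓝 x := fun x =>
    inter_mem ((e x).open_source.mem_nhds (hxs x))
      (((e x).continuousAt (hxs x)).preimage_mem_nhds (Metric.closedBall_mem_nhds _ (hr x)))
  obtain ⟨s, hsc, hs⟩ := TopologicalSpace.countable_cover_nhds hnhds
  have : Countable s := hsc.to_subtype
  have hdense : Dense (⋂ q : s × Fin (Module.finrank ℝ E) × ℕ,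
      (goodVectors (T q.1) (g q.1) (K q.1) (L q.2.1 q.2.2) : Set (κ → W))) := by
    refine dense_iInter_of_isOpen (fun q => ?_) fun q => ?_
    · exact isOpen_goodVectors Metric.isOpen_ball (fun k _ => hg q.1 k)
        (isCompact_closedBall _ _) (hL _ _) (hKB q.1)
    · exact dense_goodVectors Metric.isOpen_ball (convex_ball _ _) (fun k _ => hg q.1 k) (hKB q.1)
        (by simp [W]) (hiT q.1 q.2.1) (hul q.1 q.2.1) fun v hv => hv.2
  obtain ⟨w, hw⟩ := hdense.nonempty
  rw [Set.mem_iInter] at hw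
  refine ⟨_, fun a x => F w x a, fun a => ?_, fun x => ?_⟩
  · exact (ContinuousLinearMap.proj (R := ℝ) (φ := fun _ => ℝ) a).contMDiff.comp (hF w)
  · have hxs : x ∈ ⋃ y ∈ s, (e y).source ∩ (e y) ⁻¹' K y := hs ▸ Set.mem_univ x
    obtain ⟨x₀, hx₀, hx⟩ := Set.mem_iUnion₂.1 hxs
    refine ⟨e x₀, chart_mem_atlas E _, hx.1, fun v hv => ?_⟩
    obtain ⟨a, ha⟩ : ∃ a, l a v ≠ 0 := by
      by_contra! h
      exact hv (b.ext_elem fun a => by simpa [l] using h a)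
    let v' : E := (l a v)⁻¹ • v
    obtain ⟨n, hn⟩ := exists_nat_ge ‖v'‖
    have hv' : v' ∈ L a n := ⟨by simpa using hn, by simp [v', ha]⟩
    have hne := hw (⟨x₀, hx₀⟩, a, n) (e x₀ x, v') ⟨hx.2, hv'⟩
    have hB := Metric.isOpen_ball.mem_nhds (hKB x₀ hx.2)
    have hgd : ∀ k, DifferentiableAt ℝ (g x₀ k) (e x₀ x) := fun k =>
      ((hg x₀ k).contDiffAt hB).differentiableAt (by simp)
    have hder : HasFDerivAt (F w ∘ (e x₀).symm)
        (∑ k ∈ T x₀, (fderiv ℝ (g x₀ k) (e x₀ x)).smulRight (w k)) (e x₀ x) := by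
      refine HasFDerivAt.congr_of_eventuallyEq ?_ ((hFT x₀ w).eventuallyEq_of_mem hB)
      exact HasFDerivAt.fun_sum fun k _ => (hgd k).hasFDerivAt.smul_const (w k)
    by_contra! h
    refine hne (funext fun j => ?_)
    have hj := (hasFDerivAt_pi'.1 hder j).fderiv
    have hj' := h j
    rw [show ((fun x => F w x j) ∘ (e x₀).symm) = fun z => (F w ∘ (e x₀).symm) z j from rfl,
      hj] at hj'
    simp only [v', map_smul, smul_eq_mul, ← smul_smul, ← Finset.smul_sum]
    simp only [ContinuousLinearMap.comp_apply, sum_apply,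
      ContinuousLinearMap.smulRight_apply, ContinuousLinearMap.proj_apply] at hj'
    rw [Pi.smul_apply, hj', smul_zero, Pi.zero_apply]

end Immersion

end ChernForms

end

noncomputable section

namespace ChernForms

open Filter

/-! ### Forms of type `(p, p)` on a vector space -/

section PointwiseType

variable {V : Type*} [NormedAddCommGroup V] [NormedSpace ℂ V]

theorem prod_pairIdx {p : ℕ} (h : Fin (2 * p) → ℂ) :
    ∏ j, h j = ∏ i : Fin p, h (pairIdx i 0) * h (pairIdx i 1) := by
  let e : Fin p × Fin 2 ≃ Fin (2 * p) := finProdFinEquiv.trans (finCongr (mul_comm p 2))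
  have he : ∀ i j, e (i, j) = pairIdx i j := fun i j => by
    ext; simp [e, pairIdx, finProdFinEquiv]; omega
  rw [← e.prod_comp, Fintype.prod_prod_type]
  refine Finset.prod_congr rfl fun i _ => ?_
  rw [Fin.prod_univ_two, he, he]

/-- Writing each factor as a two-term antisymmetrization of `a i` doubles the contribution of each
pair, so the powers of `1 / 2` in `wprod_apply` disappear. -/
theorem wprod_apply_of_alternating : ∀ {p : ℕ} (θ : Fin p → V [⋀^Fin 2]→L[ℝ] ℂ)
    (a : Fin p → V → V → ℂ) (_ : ∀ i v, θ i v = a i (v 0) (v 1) - a i (v 1) (v 0))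
    (v : Fin (2 * p) → V),
    wprod p θ v = altSum (fun u => ∏ i, a i (u (pairIdx i 0)) (u (pairIdx i 1))) v
  | 0, θ, a, _, v => by
    change (1 : ℂ) = ∑ σ : Equiv.Perm (Fin 0), ((Equiv.Perm.sign σ : ℤ) : ℂ) * 1
    simp
  | p + 1, θ, a, ha, v => by
    let T : (Fin (2 * p) → V) → ℂ := fun u =>
      ∏ i : Fin p, a i.castSucc (u (pairIdx i 0)) (u (pairIdx i 1))
    have h := wedge_altSum (wprod p fun i => θ i.castSucc) (θ (Fin.last p)) 1 T
      (fun u => by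
        rw [one_mul]
        exact wprod_apply_of_alternating _ _ (fun i v => ha i.castSucc v) u) v
    refine h.trans ?_
    let S : (Fin (2 * p + 2) → V) → ℂ := fun u => T (fun i => u (Fin.castAdd 2 i)) *
      a (Fin.last p) (u (Fin.natAdd (2 * p) 0)) (u (Fin.natAdd (2 * p) 1))
    let τ : Equiv.Perm (Fin (2 * p + 2)) :=
      Equiv.swap (Fin.natAdd (2 * p) 0) (Fin.natAdd (2 * p) 1)
    have e1 : (fun u : Fin (2 * p + 2) → V => T (fun i => u (Fin.castAdd 2 i)) *
        θ (Fin.last p) (fun j => u (Fin.natAdd (2 * p) j))) = fun u =>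
        S u + (-1) * S (u ∘ τ) := by
      funext u
      have h1 : ∀ i : Fin (2 * p), τ (Fin.castAdd 2 i) = Fin.castAdd 2 i := fun i =>
        Equiv.swap_apply_of_ne_of_ne (by simp [Fin.ext_iff]; omega) (by simp [Fin.ext_iff]; omega)
      rw [ha]
      simp only [S, Function.comp_apply, h1, τ, Equiv.swap_apply_left, Equiv.swap_apply_right]
      ring
    have e2 : altSum (fun u => S (u ∘ τ)) v = -altSum S v := by
      rw [altSum_comp_perm, Equiv.Perm.sign_swap (by simp [Fin.ext_iff])]
      simp
    have e3 : S = fun u : Fin (2 * p + 2) → V => ∏ i : Fin (p + 1),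
        a i ((u : Fin (2 * (p + 1)) → V) (pairIdx i 0)) ((u : Fin (2 * (p + 1)) → V) (pairIdx i 1)) :=
      by
      funext u
      rw [Fin.prod_univ_castSucc]
      rfl
    rw [e1, altSum_add, altSum_const_mul, e2, Nat.factorial_two]
    refine Eq.trans ?_ (congrArg (fun T => altSum T v) e3)
    push_cast
    ring

/-- The complex-linear functional with real part `ξ`. -/
def cPart (ξ : V →L[ℝ] ℝ) (v : V) : ℂ := ξ v - Complex.I * ξ (Complex.I • v)

theorem cPart_smul (ξ : V →L[ℝ] ℝ) (c : ℂ) (v : V) : cPart ξ (c • v) = c * cPart ξ v := by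
  have h1 : ξ (c • v) = c.re * ξ v + c.im * ξ (Complex.I • v) := by
    have : c • v = c.re • v + c.im • (Complex.I • v) := by
      conv_lhs => rw [← Complex.re_add_im c]
      rw [add_smul, mul_smul, Complex.coe_smul, Complex.coe_smul]
    rw [this]
    simp
  have h2 : ξ (Complex.I • (c • v)) = -c.im * ξ v + c.re * ξ (Complex.I • v) := by
    have : Complex.I • (c • v) = (-c.im) • v + c.re • (Complex.I • v) := by
      rw [smul_smul]
      conv_lhs => rw [← Complex.re_add_im c]
      rw [← Complex.coe_smul, ← Complex.coe_smul, smul_smul, ← add_smul]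
      congr 1
      push_cast
      linear_combination (c.im : ℂ) * Complex.I_sq
    rw [this]
    simp
  rw [cPart, cPart, h1, h2]
  push_cast
  conv_rhs => rw [← Complex.re_add_im c]
  linear_combination ((c.im : ℂ) * ξ (Complex.I • v)) * Complex.I_sq

theorem ofReal_eq_cPart (ξ : V →L[ℝ] ℝ) (v : V) :
    (ξ v : ℂ) = (1 / 2) * (cPart ξ v + conj (cPart ξ v)) := by
  simp [cPart]
  ring

/-- Multiplication by a complex number, as a real-linear endomorphism. -/
def rot (c : ℂ) : V →L[ℝ] V := (c • ContinuousLinearMap.id ℂ V).restrictScalars ℝ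

@[simp]
theorem rot_apply (c : ℂ) (v : V) : rot c v = c • v := rfl

/-- The powers of a primitive root of unity of order `2p + 1`. -/
def rootPow (p k : ℕ) : ℂ := Complex.exp (2 * Real.pi * Complex.I / (2 * p + 1 : ℕ)) ^ k

theorem norm_rootPow (p k : ℕ) : ‖rootPow p k‖ = 1 := by
  rw [rootPow, norm_pow,
    (Complex.isPrimitiveRoot_exp (2 * p + 1) (by omega)).norm'_eq_one (by omega), one_pow]

/-- The average of a form over the multiplications by roots of unity of order `2p + 1`. In degree
`2p` this is the projection onto the forms of type `(p, p)`. -/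
def rootAvg {p : ℕ} (α : V [⋀^Fin (2 * p)]→L[ℝ] ℂ) : V [⋀^Fin (2 * p)]→L[ℝ] ℂ :=
  (((2 * p + 1 : ℕ) : ℂ)⁻¹) • ∑ k ∈ Finset.range (2 * p + 1),
    α.compContinuousLinearMap (rot (rootPow p k))

theorem rootAvg_apply {p : ℕ} (α : V [⋀^Fin (2 * p)]→L[ℝ] ℂ) (v : Fin (2 * p) → V) :
    rootAvg α v = (((2 * p + 1 : ℕ) : ℂ)⁻¹) * ∑ k ∈ Finset.range (2 * p + 1),
      α fun i => rootPow p k • v i := by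
  rw [rootAvg, ContinuousAlternatingMap.smul_apply, smul_eq_mul]
  exact congrArg _ (map_sum (evalForm v) _ _)

/-- The conjugate is the inverse, so the sum is geometric with ratio `ζ ^ (a - b)`. The order `2p +
1` exceeds `|a - b|`, hence the ratio is `1` only for `a = b`. -/
theorem sum_pow_root_of_unity {p a b : ℕ} (ha : a ≤ 2 * p) (hb : b ≤ 2 * p) :
    ∑ k ∈ Finset.range (2 * p + 1),
      (Complex.exp (2 * Real.pi * Complex.I / (2 * p + 1 : ℕ)) ^ k) ^ a *
        conj (Complex.exp (2 * Real.pi * Complex.I / (2 * p + 1 : ℕ)) ^ k) ^ b =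
      if a = b then ((2 * p + 1 : ℕ) : ℂ) else 0 := by
  have hprim := Complex.isPrimitiveRoot_exp (2 * p + 1) (by omega)
  set ζ := Complex.exp (2 * Real.pi * Complex.I / (2 * p + 1 : ℕ)) with hζ
  have hnorm : ‖ζ‖ = 1 := hprim.norm'_eq_one (by omega)
  have hconj : conj ζ * ζ = 1 := by
    rw [mul_comm, Complex.mul_conj, Complex.normSq_eq_norm_sq, hnorm]; simp
  have hterm : ∀ k, (ζ ^ k) ^ a * conj (ζ ^ k) ^ b = (ζ ^ a * conj ζ ^ b) ^ k := fun k => by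
    rw [map_pow]; ring
  simp only [hterm]
  split_ifs with h
  · subst h
    rw [← mul_pow, mul_comm ζ, hconj]
    simp
  · have h1 : (ζ ^ a * conj ζ ^ b) ^ (2 * p + 1) = 1 := by
      rw [mul_pow, ← pow_mul, ← pow_mul, mul_comm a, mul_comm b, pow_mul, pow_mul, hprim.pow_eq_one,
        ← map_pow, hprim.pow_eq_one]
      simp
    have h2 : ζ ^ a * conj ζ ^ b ≠ 1 := fun h2 => by
      have h3 : ζ ^ a = ζ ^ b := by
        have := congrArg (fun t => t * ζ ^ b) h2
        simp only [one_mul] at this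
        rwa [mul_assoc, ← mul_pow, hconj, one_pow, mul_one] at this
      exact h (hprim.pow_inj (by omega) (by omega) h3)
    have h3 := mul_geom_sum (ζ ^ a * conj ζ ^ b) (2 * p + 1)
    rw [h1, sub_self] at h3
    exact (mul_eq_zero.1 h3).resolve_left (sub_ne_zero.2 h2)

theorem exists_perm_pairIdx {p : ℕ} (S : Finset (Fin (2 * p))) (hS : S.card = p) :
    ∃ σ : Equiv.Perm (Fin (2 * p)), ∀ i, σ (pairIdx i 0) ∈ S ∧ σ (pairIdx i 1) ∉ S := by
  have hcard : Fintype.card {x : Fin (2 * p) // (x : ℕ) % 2 = 0} = p := by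
    have e : Fin p ≃ {x : Fin (2 * p) // (x : ℕ) % 2 = 0} :=
      { toFun := fun i => ⟨pairIdx i 0, by simp [pairIdx]⟩
        invFun := fun x => ⟨(x : ℕ) / 2, by have := x.1.2; omega⟩
        left_inv := fun i => by ext; simp [pairIdx]
        right_inv := fun x => by
          ext
          have := x.2
          simp only [pairIdx, Fin.val_zero]
          omega }
    rw [← Fintype.card_congr e, Fintype.card_fin]
  let e : {x : Fin (2 * p) // (x : ℕ) % 2 = 0} ≃ {x : Fin (2 * p) // x ∈ S} :=
    Fintype.equivOfCardEq (by rw [hcard, Fintype.card_coe, hS])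
  refine ⟨e.extendSubtype, fun i => ⟨e.extendSubtype_mem _ ?_, e.extendSubtype_not_mem _ ?_⟩⟩
  · simp [pairIdx]
  · simp only [pairIdx, Fin.val_one]; omega

theorem dir_ofReal (ξ : V →L[ℝ] ℝ) (a : V) : dir (fun z => (ξ z : ℂ)) a = fun _ => (ξ a : ℂ) := by
  funext z
  have := (Complex.ofRealCLM.comp ξ).hasFDerivAt (x := z)
  exact congrArg (fun T => T a) this.fderiv

theorem dir_mul {f g : V → ℂ} {z : V} (hf : DifferentiableAt ℝ f z) (hg : DifferentiableAt ℝ g z)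
    (a : V) : dir (fun y => f y * g y) a z = dir f a z * g z + f z * dir g a z := by
  simp only [dir, fderiv_fun_mul hf hg]
  simp
  ring

variable [FiniteDimensional ℂ V]

/-- The form `∂̄∂(ξ η)` for real covectors `ξ` and `η`, which has constant coefficients. -/
def sForm (ξ η : V →L[ℝ] ℝ) : V [⋀^Fin 2]→L[ℝ] ℂ := ddbar (fun z => (ξ z : ℂ) * (η z : ℂ)) 0

omit [FiniteDimensional ℂ V] in
theorem dir_dir_mul {f g : V → ℂ} {U : Set V} (hU : IsOpen U) (hf : ContDiffOn ℝ ∞ f U)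
    (hg : ContDiffOn ℝ ∞ g U) {z : V} (hz : z ∈ U) (a b : V) :
    dir (dir (fun y => f y * g y) a) b z = dir (dir f a) b z * g z + dir f a z * dir g b z +
      (dir f b z * dir g a z + f z * dir (dir g a) b z) := by
  have hd : ∀ {f : V → ℂ}, ContDiffOn ℝ ∞ f U → ∀ y ∈ U, DifferentiableAt ℝ f y :=
    fun hf y hy => (hf.contDiffAt (hU.mem_nhds hy)).differentiableAt (by simp)
  have h1 : dir (fun y => f y * g y) a =ᶠ[𝓝 z] fun y => dir f a y * g y + f y * dir g a y := by
    filter_upwards [hU.mem_nhds hz] with y hy using dir_mul (hd hf y hy) (hd hg y hy) a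
  have h2 : ∀ {F G : V → ℂ}, DifferentiableAt ℝ F z → DifferentiableAt ℝ G z →
      dir (fun y => F y + G y) b z = dir F b z + dir G b z := fun hF hG => by
    simp only [dir, fderiv_fun_add hF hG]
    rfl
  have hfa := hd (contDiffOn_dir hU hf a) z hz
  have hga := hd (contDiffOn_dir hU hg a) z hz
  have hf' := hd hf z hz
  have hg' := hd hg z hz
  have h3 : dir (dir (fun y => f y * g y) a) b z =
      dir (fun y => dir f a y * g y + f y * dir g a y) b z := by
    rw [dir, h1.fderiv_eq]; rfl
  have h4 := h2 (F := fun y => dir f a y * g y) (G := fun y => f y * dir g a y)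
    (hfa.mul hg') (hf'.mul hga)
  rw [h3, h4, dir_mul hfa hg', dir_mul hf' hga]

theorem sForm_apply (ξ η : V →L[ℝ] ℝ) (v : Fin 2 → V) :
    sForm ξ η v = (Complex.I / 2) *
      (ξ (Complex.I • v 0) * η (v 1) + η (Complex.I • v 0) * ξ (v 1) -
        ξ (v 0) * η (Complex.I • v 1) - η (v 0) * ξ (Complex.I • v 1)) := by
  have hsm : ∀ ξ : V →L[ℝ] ℝ, ContDiffOn ℝ ∞ (fun z => (ξ z : ℂ)) Set.univ := fun ξ =>
    (Complex.ofRealCLM.comp ξ).contDiff.contDiffOn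
  have hU : IsOpen (Set.univ : Set V) := isOpen_univ
  have h0 : (0 : V) ∈ (Set.univ : Set V) := Set.mem_univ _
  have hc : ∀ (c : ℂ) (a : V), dir (fun _ => c) a 0 = 0 := fun c a => by simp [dir]
  rw [sForm, ddbar_apply hU ((hsm ξ).mul (hsm η)) h0, dir_dir_mul hU (hsm ξ) (hsm η) h0,
    dir_dir_mul hU (hsm ξ) (hsm η) h0]
  simp only [dir_ofReal, hc]
  ring

/-- Leibniz rule for `∂̄∂` of a product of real functions. -/
theorem ddbar_mul {f g : V → ℝ} {U : Set V} (hU : IsOpen U) (hf : ContDiffOn ℝ ∞ f U)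
    (hg : ContDiffOn ℝ ∞ g U) {z : V} (hz : z ∈ U) :
    ddbar (fun y => (f y : ℂ) * (g y : ℂ)) z = (f z : ℂ) • ddbar (fun y => (g y : ℂ)) z +
      (g z : ℂ) • ddbar (fun y => (f y : ℂ)) z + sForm (fderiv ℝ f z) (fderiv ℝ g z) := by
  have hc : ∀ {f : V → ℝ}, ContDiffOn ℝ ∞ f U → ContDiffOn ℝ ∞ (fun y => (f y : ℂ)) U :=
    fun hf => Complex.ofRealCLM.contDiff.comp_contDiffOn hf
  have hdir : ∀ {f : V → ℝ}, ContDiffOn ℝ ∞ f U → ∀ a, dir (fun y => (f y : ℂ)) a z =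
      (fderiv ℝ f z a : ℂ) := fun {f} hf a => by
    have := (Complex.ofRealCLM.hasFDerivAt).comp z
      ((hf.contDiffAt (hU.mem_nhds hz)).differentiableAt (by simp)).hasFDerivAt
    exact congrArg (fun T => T a) this.fderiv
  ext v
  simp only [ContinuousAlternatingMap.add_apply, ContinuousAlternatingMap.smul_apply, smul_eq_mul]
  rw [ddbar_apply hU ((hc hf).mul (hc hg)) hz, ddbar_apply hU (hc hf) hz,
    ddbar_apply hU (hc hg) hz, dir_dir_mul hU (hc hf) (hc hg) hz,
    dir_dir_mul hU (hc hf) (hc hg) hz, sForm_apply, hdir hf, hdir hf, hdir hf, hdir hf, hdir hg,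
    hdir hg, hdir hg, hdir hg]
  ring

/-- The form `e ∧ ē'` for the complex-linear functionals `e`, `e'` with real parts `ξ`, `η`. -/
def hForm (ξ η : V →L[ℝ] ℝ) : V [⋀^Fin 2]→L[ℝ] ℂ :=
  (-2 : ℂ) • sForm ξ η + (-2 * Complex.I) • sForm ξ (η.comp mulI)

/-- If `e`, `e'` have real parts `ξ`, `η`, then `∂̄∂(ξη) = -(e ∧ ē' + e' ∧ ē) / 4`. Replacing `η` by
`η ∘ mulI` replaces `e'` by `i e'`, and the coefficients `-2` and `-2i` isolate the first term. -/
theorem hForm_apply (ξ η : V →L[ℝ] ℝ) (v : Fin 2 → V) :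
    hForm ξ η v = cPart ξ (v 0) * conj (cPart η (v 1)) -
      cPart ξ (v 1) * conj (cPart η (v 0)) := by
  rw [hForm, ContinuousAlternatingMap.add_apply, ContinuousAlternatingMap.smul_apply,
    ContinuousAlternatingMap.smul_apply, sForm_apply, sForm_apply]
  have hI : ∀ w : V, Complex.I • Complex.I • w = -w := fun w => by
    rw [smul_smul, Complex.I_mul_I, neg_one_smul]
  simp [cPart, hI]
  ring_nf
  simp only [Complex.I_sq]
  ring

/-- A monomial of type `(|S|, k - |S|)`. -/
def typeMonomial {k d : ℕ} (ξ : Fin d → V →L[ℝ] ℝ) (m : Fin k → Fin d) (S : Finset (Fin k))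
    (u : Fin k → V) : ℂ :=
  (∏ i ∈ S, cPart (ξ (m i)) (u i)) * ∏ i ∈ Sᶜ, conj (cPart (ξ (m i)) (u i))

omit [FiniteDimensional ℂ V] in
theorem typeMonomial_eq_prod {k d : ℕ} (ξ : Fin d → V →L[ℝ] ℝ) (m : Fin k → Fin d)
    (S : Finset (Fin k)) (u : Fin k → V) : typeMonomial ξ m S u =
      ∏ i, if i ∈ S then cPart (ξ (m i)) (u i) else conj (cPart (ξ (m i)) (u i)) := by
  rw [typeMonomial, Finset.prod_ite]
  congr 1
  · exact Finset.prod_congr (by ext; simp) fun _ _ => rfl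
  · exact Finset.prod_congr (by ext; simp) fun _ _ => rfl

/-- Reordering the slots so that each pair consists of one slot of `S` and one outside turns the
monomial into a product of terms `e ⊗ ē'`; the reordering costs only a sign. -/
theorem altSum_typeMonomial {p d : ℕ} (ξ : Fin d → V →L[ℝ] ℝ) (m : Fin (2 * p) → Fin d)
    (S : Finset (Fin (2 * p))) (hS : S.card = p) : ∃ β : V [⋀^Fin (2 * p)]→L[ℝ] ℂ,
      β ∈ Submodule.span ℂ (Set.range fun J : Fin p → Fin d × Fin d =>
        wprod p fun i => hForm (ξ (J i).1) (ξ (J i).2)) ∧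
      ∀ v, altSum (typeMonomial ξ m S) v = β v := by
  obtain ⟨σ, hσ⟩ := exists_perm_pairIdx S hS
  refine ⟨((Equiv.Perm.sign σ⁻¹ : ℤ) : ℂ) • wprod p fun i =>
    hForm (ξ (m (σ (pairIdx i 0)))) (ξ (m (σ (pairIdx i 1)))),
    Submodule.smul_mem _ _ (Submodule.subset_span
      ⟨fun i => (m (σ (pairIdx i 0)), m (σ (pairIdx i 1))), rfl⟩), fun v => ?_⟩
  have h1 := altSum_comp_perm (typeMonomial ξ m S) σ⁻¹ v
  have h2 : (fun u : Fin (2 * p) → V => typeMonomial ξ m S (u ∘ ⇑σ⁻¹)) = fun u =>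
      ∏ i : Fin p, cPart (ξ (m (σ (pairIdx i 0)))) (u (pairIdx i 0)) *
        conj (cPart (ξ (m (σ (pairIdx i 1)))) (u (pairIdx i 1))) := by
    funext u
    rw [typeMonomial_eq_prod, ← Equiv.prod_comp σ, prod_pairIdx]
    refine Finset.prod_congr rfl fun i _ => ?_
    rw [if_pos (hσ i).1, if_neg (hσ i).2]
    simp
  rw [h2] at h1
  rw [ContinuousAlternatingMap.smul_apply,
    wprod_apply_of_alternating _ (fun i x y => cPart (ξ (m (σ (pairIdx i 0)))) x *
    conj (cPart (ξ (m (σ (pairIdx i 1)))) y)) (fun i v => hForm_apply _ _ v), h1, smul_eq_mul,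
    ← mul_assoc, sign_mul_self_cast, one_mul]

-- Each real covector is half the sum of a complex-linear functional and its conjugate. Expanding
-- the product separates the types, which the scaling factors in `c` record.
omit [FiniteDimensional ℂ V] in
theorem prod_ofReal_smul {k d : ℕ} (ξ : Fin d → V →L[ℝ] ℝ) (m : Fin k → Fin d) (u : Fin k → V)
    (c : ℂ) : ∏ i, (ξ (m i) (c • u i) : ℂ) = (1 / 2) ^ k *
      ∑ S : Finset (Fin k), c ^ S.card * conj c ^ (k - S.card) * typeMonomial ξ m S u := by
  simp only [ofReal_eq_cPart, cPart_smul, Finset.prod_mul_distrib, Finset.prod_const,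
    Finset.card_univ, Fintype.card_fin, map_mul]
  rw [Finset.prod_add]
  congr 1
  rw [Finset.powerset_univ]
  refine Finset.sum_congr rfl fun S _ => ?_
  rw [typeMonomial, Finset.prod_mul_distrib, Finset.prod_mul_distrib, Finset.prod_const,
    Finset.prod_const, ← Finset.compl_eq_univ_sdiff, Finset.card_compl, Fintype.card_fin]
  ring

omit [FiniteDimensional ℂ V] in
theorem apply_eq_sum_basis {k d : ℕ} (α : V [⋀^Fin k]→L[ℝ] ℂ) (b : Module.Basis (Fin d) ℝ V)
    (ξ : Fin d → V →L[ℝ] ℝ) (hξ : ∀ a v, ξ a v = b.repr v a) (v : Fin k → V) :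
    α v = ∑ m : Fin k → Fin d, (∏ i, (ξ (m i) (v i) : ℂ)) * α fun i => b (m i) := by
  have h1 : v = fun i => ∑ a, ξ a (v i) • b a := by
    funext i
    simp only [hξ]
    exact (b.sum_repr (v i)).symm
  conv_lhs => rw [h1]
  refine (α.toMultilinearMap.map_sum fun i a => ξ a (v i) • b a).trans ?_
  refine Finset.sum_congr rfl fun m _ => ?_
  refine (α.toMultilinearMap.map_smul_univ (fun i => ξ (m i) (v i)) fun i => b (m i)).trans ?_
  rw [Complex.real_smul, Complex.ofReal_prod]
  rfl

/-- Forms of type `(p, p)` are linear combinations of products of the forms `e ∧ ē'`. -/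
theorem rootAvg_mem_span {p : ℕ} (α : V [⋀^Fin (2 * p)]→L[ℝ] ℂ) {d : ℕ} (b : Module.Basis (Fin d) ℝ V) (ξ : Fin d → V →L[ℝ] ℝ)
    (hξ : ∀ a v, ξ a v = b.repr v a) :
    rootAvg α ∈ Submodule.span ℂ (Set.range fun J : Fin p → Fin d × Fin d =>
      wprod p fun i => hForm (ξ (J i).1) (ξ (J i).2)) := by
  choose! β hβ hβ' using fun (m : Fin (2 * p) → Fin d) (S : Finset (Fin (2 * p))) =>
    altSum_typeMonomial (p := p) ξ m S
  let ζ : ℕ → ℂ := rootPow p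
  have hfac : ((2 * p).factorial : ℂ) ≠ 0 := by exact_mod_cast (2 * p).factorial_ne_zero
  have hp : ((2 * p + 1 : ℕ) : ℂ) ≠ 0 := by exact_mod_cast (2 * p).succ_ne_zero
  have hexp : ∀ v, α v = (1 / ((2 * p).factorial : ℂ)) * ∑ m : Fin (2 * p) → Fin d,
      α (fun i => b (m i)) * altSum (fun u => ∏ i, (ξ (m i) (u i) : ℂ)) v := fun v => by
    have h := altSum_alternating α v
    have e : (fun u => α u) = fun u => ∑ m : Fin (2 * p) → Fin d,
        α (fun i => b (m i)) * ∏ i, (ξ (m i) (u i) : ℂ) := by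
      funext u
      rw [apply_eq_sum_basis α b ξ hξ]
      exact Finset.sum_congr rfl fun m _ => mul_comm _ _
    rw [e, altSum_sum, Fintype.card_fin] at h
    simp only [altSum_const_mul] at h
    rw [h]
    field_simp
  have hscale : ∀ (z : ℂ) (m : Fin (2 * p) → Fin d) (v : Fin (2 * p) → V),
      altSum (fun u => ∏ i, (ξ (m i) (u i) : ℂ)) (fun i => z • v i) = (1 / 2) ^ (2 * p) *
        ∑ S : Finset (Fin (2 * p)), z ^ S.card * conj z ^ (2 * p - S.card) *
          altSum (typeMonomial ξ m S) v := fun z m v => by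
    have : altSum (fun u => ∏ i, (ξ (m i) (u i) : ℂ)) (fun i => z • v i) =
      altSum (fun u => ∏ i, (ξ (m i) (z • u i) : ℂ)) v := rfl
    rw [this]
    simp only [prod_ofReal_smul]
    rw [altSum_const_mul, altSum_sum]
    simp only [altSum_const_mul]
  -- Averaging kills every monomial except those with `|S| = 2p - |S|`, that is `|S| = p`.
  have hmain : rootAvg α = ∑ m : Fin (2 * p) → Fin d, ∑ S : Finset (Fin (2 * p)) with S.card = p,
      ((1 / ((2 * p).factorial : ℂ)) * α (fun i => b (m i)) * (1 / 2) ^ (2 * p)) •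
        β m S := by
    ext v
    have h1 : ((2 * p + 1 : ℕ) : ℂ) * rootAvg α v =
        ∑ k ∈ Finset.range (2 * p + 1), α fun i => ζ k • v i := by
      rw [rootAvg_apply, mul_inv_cancel_left₀ hp]
    have h2 : ∑ k ∈ Finset.range (2 * p + 1), α (fun i => ζ k • v i) =
        (1 / ((2 * p).factorial : ℂ)) * ∑ m : Fin (2 * p) → Fin d, α (fun i => b (m i)) *
          ((1 / 2) ^ (2 * p) * ∑ S : Finset (Fin (2 * p)),
            (if S.card = p then ((2 * p + 1 : ℕ) : ℂ) else 0) *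
              altSum (typeMonomial ξ m S) v) := by
      have h3 : ∀ S : Finset (Fin (2 * p)), (if S.card = p then ((2 * p + 1 : ℕ) : ℂ) else 0) =
          ∑ k ∈ Finset.range (2 * p + 1), ζ k ^ S.card * conj (ζ k) ^ (2 * p - S.card) :=
        fun S => by
          have hS : S.card ≤ 2 * p := by simpa using Finset.card_le_univ S
          have e0 := sum_pow_root_of_unity (p := p) hS (Nat.sub_le (2 * p) S.card)
          refine Eq.trans ?_ e0.symm
          have : S.card = 2 * p - S.card ↔ S.card = p := by omega
          simp only [this]
      rw [Finset.sum_congr rfl fun k _ => hexp _, ← Finset.mul_sum, Finset.sum_comm]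
      congr 1
      refine Finset.sum_congr rfl fun m _ => ?_
      rw [← Finset.mul_sum]
      congr 1
      rw [Finset.sum_congr rfl fun k _ => hscale (ζ k) m v, ← Finset.mul_sum, Finset.sum_comm]
      congr 1
      refine Finset.sum_congr rfl fun S _ => ?_
      rw [h3, Finset.sum_mul]
    rw [h2] at h1
    refine mul_left_cancel₀ hp (h1.trans ?_)
    have h4 : ∀ s : Finset (Fin (2 * p) → Fin d),
        ∀ f : (Fin (2 * p) → Fin d) → V [⋀^Fin (2 * p)]→L[ℝ] ℂ,
        (∑ m ∈ s, f m) v = ∑ m ∈ s, f m v := fun s f => map_sum (evalForm v) f s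
    have h5 : ∀ s : Finset (Finset (Fin (2 * p))),
        ∀ f : Finset (Fin (2 * p)) → V [⋀^Fin (2 * p)]→L[ℝ] ℂ,
        (∑ m ∈ s, f m) v = ∑ m ∈ s, f m v := fun s f => map_sum (evalForm v) f s
    rw [h4, Finset.mul_sum, Finset.mul_sum]
    refine Finset.sum_congr rfl fun m _ => ?_
    rw [h5, Finset.sum_filter, Finset.mul_sum, Finset.mul_sum, Finset.mul_sum, Finset.mul_sum]
    refine Finset.sum_congr rfl fun S _ => ?_
    split_ifs with hS
    · rw [ContinuousAlternatingMap.smul_apply, hβ' m S hS, smul_eq_mul]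
      ring
    · simp
  rw [hmain]
  exact Submodule.sum_mem _ fun m _ => Submodule.sum_mem _ fun S hS =>
    Submodule.smul_mem _ _ (hβ m S (Finset.mem_filter.1 hS).2)

end PointwiseType

end ChernForms

end

noncomputable section

namespace ChernForms

open Filter

/-! ### Smooth coefficients -/

/-- If a projection `P` fixes the vectors `Ψ j z` and the `Ψ j z₀` span its range, then `P (η z)` is
near `z₀` a combination of the `Ψ j z` with smooth coefficients. -/
theorem exists_contDiffOn_coeff {E F ι : Type*} [NormedAddCommGroup E] [NormedSpace ℝ E]
    [NormedAddCommGroup F] [NormedSpace ℝ F] [NormedSpace ℂ F] [IsScalarTower ℝ ℂ F]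
    [FiniteDimensional ℝ F] [Fintype ι] {U : Set E} (hU : IsOpen U) {Ψ : ι → E → F}
    (hΨ : ∀ j, ContDiffOn ℝ ∞ (Ψ j) U) (P : F →L[ℝ] F) (hP : ∀ j, ∀ z ∈ U, ∀ c : ℂ,
      P (c • Ψ j z) = c • Ψ j z) {z₀ : E} (hz₀ : z₀ ∈ U)
    (hspan : ∀ τ, P τ ∈ Submodule.span ℂ (Set.range fun j => Ψ j z₀)) {η : E → F}
    (hη : ContDiffOn ℝ ∞ η U) : ∃ U' ⊆ U, IsOpen U' ∧ z₀ ∈ U' ∧ ∃ c : ι → E → ℂ,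
      (∀ j, ContDiffOn ℝ ∞ (c j) U') ∧ ∀ z ∈ U', P (η z) = ∑ j, c j z • Ψ j z := by
  have : CompleteSpace F := FiniteDimensional.complete ℝ F
  let A : E → (ι → ℂ) →ₗ[ℝ] F := fun z =>
    { toFun := fun c => ∑ j, c j • Ψ j z
      map_add' := fun c d => by simp [add_smul, Finset.sum_add_distrib]
      map_smul' := fun r c => by
        simp only [Pi.smul_apply, smul_assoc, Finset.smul_sum, RingHom.id_apply] }
  have hPA : ∀ z ∈ U, ∀ c, P (A z c) = A z c := fun z hz c => by
    change P (∑ j, c j • Ψ j z) = ∑ j, c j • Ψ j z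
    rw [map_sum]
    exact Finset.sum_congr rfl fun j _ => hP j z hz _
  have hrange : ∀ τ, P τ ∈ LinearMap.range (A z₀) := fun τ => by
    obtain ⟨c, hc⟩ := (Submodule.mem_span_range_iff_exists_fun ℂ).1 (hspan τ)
    exact ⟨c, hc⟩
  -- A linear choice of coefficients at the single point `z₀`: `A z₀ ∘ R = P`.
  obtain ⟨R', hR'⟩ := Module.projective_lifting_property (A z₀).rangeRestrict
    ((P : F →ₗ[ℝ] F).codRestrict _ hrange) (A z₀).surjective_rangeRestrict
  let R : F →L[ℝ] (ι → ℂ) := LinearMap.toContinuousLinearMap R'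
  have hR : ∀ τ, A z₀ (R τ) = P τ := fun τ => congrArg Subtype.val (LinearMap.congr_fun hR' τ)
  have hPP : ∀ τ, P (P τ) = P τ := fun τ => by rw [← hR τ, hPA z₀ hz₀]
  -- `B z` corrects the frozen choice `R` at nearby points. It is the identity at `z₀`, hence
  -- invertible nearby, and `R P (B z)⁻¹ P (η z)` is a smooth choice of coefficients.
  let B : E → F →L[ℝ] F := fun z =>
    ∑ j, ((ContinuousLinearMap.lsmul ℝ ℂ).flip (Ψ j z)).comp
      (((ContinuousLinearMap.proj (R := ℝ) j).comp R).comp P) + (ContinuousLinearMap.id ℝ F - P)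
  have hB : ∀ z τ, B z τ = A z (R (P τ)) + (τ - P τ) := fun z τ => by
    simp [B, A]
  have hBs : ContDiffOn ℝ ∞ B U := by
    refine ContDiffOn.add (ContDiffOn.sum fun j _ => ?_) contDiffOn_const
    have h1 : ContDiffOn ℝ ∞ (fun z => (ContinuousLinearMap.lsmul ℝ ℂ).flip (Ψ j z)) U :=
      (ContinuousLinearMap.lsmul ℝ ℂ : ℂ →L[ℝ] F →L[ℝ] F).flip.contDiff.comp_contDiffOn (hΨ j)
    exact h1.clm_comp contDiffOn_const
  have hB0 : B z₀ = 1 := by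
    ext τ
    rw [hB, hR, hPP]
    simp
  have hinv : ∀ z, IsUnit (B z) → ∀ τ, B z (Ring.inverse (B z) τ) = τ := fun z hz τ =>
    congrArg (fun T : F →L[ℝ] F => T τ) (Ring.mul_inverse_cancel (B z) hz)
  refine ⟨U ∩ B ⁻¹' {T | IsUnit T}, Set.inter_subset_left,
    hBs.continuousOn.isOpen_inter_preimage hU Units.isOpen, ⟨hz₀, ?_⟩,
    fun j z => R (P (Ring.inverse (B z) (P (η z)))) j, fun j => ?_, fun z hz => ?_⟩
  · change IsUnit (B z₀)
    rw [hB0]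
    exact isUnit_one
  · intro z hz
    obtain ⟨u, hu⟩ := hz.2
    have h1 : ContDiffAt ℝ ∞ (fun z => Ring.inverse (B z)) z := by
      refine ContDiffAt.comp (g := Ring.inverse) z ?_ (hBs.contDiffAt (hU.mem_nhds hz.1))
      rw [← hu]
      exact contDiffAt_ringInverse ℝ u
    have h2 : ContDiffAt ℝ ∞ (fun z => P (η z)) z :=
      P.contDiff.contDiffAt.comp z (hη.contDiffAt (hU.mem_nhds hz.1))
    exact ((((ContinuousLinearMap.proj (R := ℝ) j).comp R).comp P).contDiff.contDiffAt.comp z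
      (h1.clm_apply h2)).contDiffWithinAt
  -- Applying `P` removes the summand `τ - P τ` and fixes the range of `A z`, leaving the desired
  -- expression of `P (η z)`.
  · have h := congrArg P (hB z (Ring.inverse (B z) (P (η z))))
    rw [hinv z hz.2, map_add, map_sub, hPP, hPP, hPA z hz.1, sub_self, add_zero] at h
    exact h

theorem finiteDimensional_form {V : Type*} [NormedAddCommGroup V] [NormedSpace ℂ V]
    [FiniteDimensional ℂ V] (k : ℕ) : FiniteDimensional ℝ (V [⋀^Fin k]→L[ℝ] ℂ) := by
  obtain ⟨ι, _, b, L, hL⟩ := exists_leftInverse_evalForm (V := V) k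
  exact Module.Finite.of_surjective (L : (ι → ℂ) →ₗ[ℝ] V [⋀^Fin k]→L[ℝ] ℂ)
    fun α => ⟨_, hL α⟩

/-! ### Generation of the forms of type `(p, p)` by forms `∂̄∂f` -/

section Generation

variable {V : Type*} [NormedAddCommGroup V] [NormedSpace ℂ V]

theorem wprod_mem_span {p : ℕ} {K : Type*} [Fintype K] {Θ : K → V [⋀^Fin 2]→L[ℝ] ℂ}
    {θ : Fin p → V [⋀^Fin 2]→L[ℝ] ℂ} (hθ : ∀ i, θ i ∈ Submodule.span ℂ (Set.range Θ)) :
    wprod p θ ∈ Submodule.span ℂ (Set.range fun J : Fin p → K => wprod p fun i => Θ (J i)) := by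
  classical
  choose c hc using fun i => (Submodule.mem_span_range_iff_exists_fun ℂ).1 (hθ i)
  have h : wprod p θ = ∑ J : Fin p → K, (∏ i, c i (J i)) • wprod p fun i => Θ (J i) := by
    have h1 := (wprodMultilinear (V := V) p).map_sum fun i k => c i k • Θ k
    simp only [hc] at h1
    refine h1.trans (Finset.sum_congr rfl fun J _ => ?_)
    exact (wprodMultilinear (V := V) p).map_smul_univ (fun i => c i (J i)) fun i => Θ (J i)
  rw [h]
  exact Submodule.sum_mem _ fun J _ => Submodule.smul_mem _ _ (Submodule.subset_span ⟨J, rfl⟩)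

variable [FiniteDimensional ℂ V]

/-- Infinitesimally this says that `∂̄∂f` is of type `(1, 1)`: rotating both arguments multiplies it
by `|ζ| ^ 2 = 1`. -/
theorem ddbar_rot {f : V → ℂ} {U : Set V} (hU : IsOpen U) (hf : ContDiffOn ℝ ∞ f U) {z : V}
    (hz : z ∈ U) {ζ : ℂ} (hζ : ‖ζ‖ = 1) :
    (ddbar f z).compContinuousLinearMap (rot ζ) = ddbar f z := by
  have hd : ∀ a, DifferentiableAt ℝ (dir f a) z := fun a =>
    ((contDiffOn_dir hU hf a).contDiffAt (hU.mem_nhds hz)).differentiableAt (by simp)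
  have hnorm : (ζ.re : ℂ) ^ 2 + (ζ.im : ℂ) ^ 2 = 1 := by
    have := Complex.sq_norm ζ
    rw [hζ, Complex.normSq_apply] at this
    norm_cast
    nlinarith
  let D : V → V → ℂ := fun a b => dir (dir f a) b z
  have hdec : ∀ v : V, ζ • v = ζ.re • v + ζ.im • (Complex.I • v) := fun v => by
    conv_lhs => rw [← Complex.re_add_im ζ]
    rw [add_smul, mul_smul, Complex.coe_smul, Complex.coe_smul]
  have hr : ∀ a b c : V, ∀ r s : ℝ, D a (r • b + s • c) = r * D a b + s * D a c :=
    fun a b c r s => by simp [D, dir]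
  have hsymm : ∀ a b, D a b = D b a := fun a b => dir_comm hU hf hz a b
  have hl : ∀ a b c : V, ∀ r s : ℝ, D (r • b + s • c) a = r * D b a + s * D c a :=
    fun a b c r s => by rw [hsymm, hr, hsymm a, hsymm a]
  have hI : ∀ v : V, Complex.I • ζ • v = ζ.re • (Complex.I • v) + (-ζ.im) • v := fun v => by
    rw [hdec, smul_add, smul_comm Complex.I ζ.re, smul_comm Complex.I ζ.im, smul_smul Complex.I,
      Complex.I_mul_I, neg_one_smul, smul_neg, neg_smul]
  ext v
  rw [ContinuousAlternatingMap.compContinuousLinearMap_apply, ddbar_apply hU hf hz,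
    ddbar_apply hU hf hz]
  change Complex.I / 2 * (D (ζ • v 1) (Complex.I • ζ • v 0) - D (Complex.I • ζ • v 1) (ζ • v 0)) =
    Complex.I / 2 * (D (v 1) (Complex.I • v 0) - D (Complex.I • v 1) (v 0))
  rw [hI, hI, hdec, hdec]
  simp only [hl, hr]
  push_cast
  linear_combination (Complex.I / 2 * (D (v 1) (Complex.I • v 0) - D (Complex.I • v 1) (v 0))) *
    hnorm

omit [FiniteDimensional ℂ V] in
theorem rootAvg_of_rot {p : ℕ} {α : V [⋀^Fin (2 * p)]→L[ℝ] ℂ}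
    (h : ∀ ζ : ℂ, ‖ζ‖ = 1 → α.compContinuousLinearMap (rot ζ) = α) : rootAvg α = α := by
  rw [rootAvg, Finset.sum_congr rfl fun k _ => h _ (norm_rootPow p k), Finset.sum_const,
    Finset.card_range, ← Nat.cast_smul_eq_nsmul ℂ, smul_smul, inv_mul_cancel₀, one_smul]
  exact_mod_cast (2 * p).succ_ne_zero

theorem rootAvg_wprod_ddbar {p : ℕ} {f : Fin p → V → ℂ} {U : Set V} (hU : IsOpen U)
    (hf : ∀ i, ContDiffOn ℝ ∞ (f i) U) {z : V} (hz : z ∈ U) :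
    rootAvg (wprod p fun i => ddbar (f i) z) = wprod p fun i => ddbar (f i) z := by
  refine rootAvg_of_rot fun ζ hζ => ?_
  rw [← wprod_compContinuousLinearMap]
  simp only [ddbar_rot hU (hf _) hz hζ]

theorem sForm_comm (ξ η : V →L[ℝ] ℝ) : sForm ξ η = sForm η ξ := by
  ext v
  rw [sForm_apply, sForm_apply]
  ring

theorem sForm_mem_span_left {ι : Type*} {ξ : ι → V →L[ℝ] ℝ} {η : V →L[ℝ] ℝ}
    {S : Submodule ℂ (V [⋀^Fin 2]→L[ℝ] ℂ)} (h : ∀ a, sForm (ξ a) η ∈ S) {ρ : V →L[ℝ] ℝ}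
    (hρ : ρ ∈ Submodule.span ℝ (Set.range ξ)) : sForm ρ η ∈ S := by
  induction hρ using Submodule.span_induction with
  | mem x hx => obtain ⟨a, rfl⟩ := hx; exact h a
  | zero =>
    have : sForm (0 : V →L[ℝ] ℝ) η = 0 := by ext v; rw [sForm_apply]; simp
    rw [this]; exact S.zero_mem
  | add x y _ _ hx hy =>
    have : sForm (x + y) η = sForm x η + sForm y η := by
      ext v
      rw [ContinuousAlternatingMap.add_apply, sForm_apply, sForm_apply, sForm_apply]
      simp only [_root_.add_apply]
      push_cast
      ring
    rw [this]; exact S.add_mem hx hy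
  | smul r x _ hx =>
    have : sForm (r • x) η = (r : ℂ) • sForm x η := by
      ext v
      rw [ContinuousAlternatingMap.smul_apply, sForm_apply, sForm_apply]
      simp only [_root_.smul_apply, smul_eq_mul]
      push_cast
      ring
    rw [this]; exact S.smul_mem _ hx

omit [FiniteDimensional ℂ V] in
theorem mem_span_of_separating {N : ℕ} {ξ : Fin N → V →L[ℝ] ℝ} (h : ∀ v ≠ 0, ∃ a, ξ a v ≠ 0)
    (ρ : V →L[ℝ] ℝ) : ρ ∈ Submodule.span ℝ (Set.range ξ) := by
  have h1 : ((ρ : V →ₗ[ℝ] ℝ)) ∈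
      Submodule.span ℝ (Set.range fun a => ((ξ a : V →L[ℝ] ℝ) : V →ₗ[ℝ] ℝ)) := by
    refine mem_span_of_iInf_ker_le_ker fun v hv => ?_
    by_cases hv0 : v = 0
    · simp [hv0]
    · obtain ⟨a, ha⟩ := h v hv0
      exact absurd (by simpa using (Submodule.mem_iInf _).1 hv a) ha
  obtain ⟨c, hc⟩ := (Submodule.mem_span_range_iff_exists_fun ℝ).1 h1
  refine (Submodule.mem_span_range_iff_exists_fun ℝ).2 ⟨c, ?_⟩
  ext v
  simpa using LinearMap.congr_fun hc v

/-- The functions `f_a` and `f_a f_b`. -/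
def quadratic {X : Type*} {N : ℕ} (f : Fin N → X → ℝ) : Fin N ⊕ Fin N × Fin N → X → ℝ
  | .inl a => f a
  | .inr ab => fun x => f ab.1 x * f ab.2 x

omit [FiniteDimensional ℂ V] in
theorem contDiffOn_quadratic {N : ℕ} {f : Fin N → V → ℝ} {U : Set V}
    (hf : ∀ a, ContDiffOn ℝ ∞ (f a) U) : ∀ k, ContDiffOn ℝ ∞ (fun y => (quadratic f k y : ℂ)) U
  | .inl a => Complex.ofRealCLM.contDiff.comp_contDiffOn (hf a)
  | .inr ab => Complex.ofRealCLM.contDiff.comp_contDiffOn ((hf ab.1).mul (hf ab.2))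

/-- The Leibniz rule gives the mixed term of `df_a` and `df_b` as `∂̄∂(f_a f_b) - f_a ∂̄∂f_b - f_b
∂̄∂f_a`. This is why the products `f_a f_b` are among the generators; bilinearity then reaches all
covectors. -/
theorem sForm_mem_span_ddbar {N : ℕ} {f : Fin N → V → ℝ} {U : Set V} (hU : IsOpen U)
    (hf : ∀ a, ContDiffOn ℝ ∞ (f a) U) {z : V} (hz : z ∈ U)
    (h : ∀ v ≠ 0, ∃ a, fderiv ℝ (f a) z v ≠ 0) (ξ η : V →L[ℝ] ℝ) :
    sForm ξ η ∈ Submodule.span ℂ (Set.range fun k =>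
      ddbar (fun y => (quadratic f k y : ℂ)) z) := by
  have h1 : ∀ a b, sForm (fderiv ℝ (f a) z) (fderiv ℝ (f b) z) ∈ Submodule.span ℂ
      (Set.range fun k => ddbar (fun y => (quadratic f k y : ℂ)) z) := fun a b => by
    have h2 : sForm (fderiv ℝ (f a) z) (fderiv ℝ (f b) z) =
        ddbar (fun y => (quadratic f (.inr (a, b)) y : ℂ)) z -
          ((f a z : ℂ) • ddbar (fun y => (quadratic f (.inl b) y : ℂ)) z +
          (f b z : ℂ) • ddbar (fun y => (quadratic f (.inl a) y : ℂ)) z) := by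
      have := ddbar_mul hU (hf a) (hf b) hz
      simp only [quadratic, Complex.ofReal_mul]
      rw [this]
      abel
    rw [h2]
    exact Submodule.sub_mem _ (Submodule.subset_span ⟨_, rfl⟩) (Submodule.add_mem _
      (Submodule.smul_mem _ _ (Submodule.subset_span ⟨_, rfl⟩))
      (Submodule.smul_mem _ _ (Submodule.subset_span ⟨_, rfl⟩)))
  refine sForm_mem_span_left (fun a => ?_) (mem_span_of_separating h ξ)
  rw [sForm_comm]
  exact sForm_mem_span_left (fun b => h1 b a) (mem_span_of_separating h η)

theorem rootAvg_mem_span_ddbar {N : ℕ} {f : Fin N → V → ℝ} {U : Set V} (hU : IsOpen U)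
    (hf : ∀ a, ContDiffOn ℝ ∞ (f a) U) {z : V} (hz : z ∈ U)
    (h : ∀ v ≠ 0, ∃ a, fderiv ℝ (f a) z v ≠ 0) {p : ℕ} (α : V [⋀^Fin (2 * p)]→L[ℝ] ℂ) :
    rootAvg α ∈ Submodule.span ℂ (Set.range fun J : Fin p → Fin N ⊕ Fin N × Fin N =>
      wprod p fun i => ddbar (fun y => (quadratic f (J i) y : ℂ)) z) := by
  have : FiniteDimensional ℝ V := FiniteDimensional.complexToReal V
  let b := Module.finBasis ℝ V
  have h1 := rootAvg_mem_span α b (fun a => LinearMap.toContinuousLinearMap (b.coord a))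
    fun a v => rfl
  have h2 : ∀ ξ η : V →L[ℝ] ℝ, hForm ξ η ∈ Submodule.span ℂ (Set.range fun k =>
      ddbar (fun y => (quadratic f k y : ℂ)) z) := fun ξ η => by
    rw [hForm]
    exact Submodule.add_mem _ (Submodule.smul_mem _ _ (sForm_mem_span_ddbar hU hf hz h _ _))
      (Submodule.smul_mem _ _ (sForm_mem_span_ddbar hU hf hz h _ _))
  refine Submodule.span_le.2 ?_ h1
  rintro _ ⟨J, rfl⟩
  exact wprod_mem_span (Θ := fun k => ddbar (fun y => (quadratic f k y : ℂ)) z) fun i => h2 _ _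

/-- The average `rootAvg` as a continuous linear map. -/
def rootAvgCLM (V : Type*) [NormedAddCommGroup V] [NormedSpace ℂ V] [FiniteDimensional ℂ V] (p : ℕ) :
    (V [⋀^Fin (2 * p)]→L[ℝ] ℂ) →L[ℝ] V [⋀^Fin (2 * p)]→L[ℝ] ℂ :=
  have := finiteDimensional_form (V := V) (2 * p)
  LinearMap.toContinuousLinearMap
    { toFun := rootAvg
      map_add' := fun α β => by
        ext v
        simp only [rootAvg_apply, ContinuousAlternatingMap.add_apply, Finset.sum_add_distrib,
          mul_add]
      map_smul' := fun c α => by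
        ext v
        simp only [rootAvg_apply, ContinuousAlternatingMap.smul_apply, ← Finset.smul_sum,
          mul_smul_comm, RingHom.id_apply] }

@[simp]
theorem rootAvgCLM_apply {p : ℕ} (α : V [⋀^Fin (2 * p)]→L[ℝ] ℂ) :
    rootAvgCLM V p α = rootAvg α := rfl

/-- The averages of smooth forms are locally combinations of products of forms `∂̄∂f_a` and
`∂̄∂(f_a f_b)` with smooth coefficients, if the `f_a` define an immersion. -/
theorem exists_rootAvg_eq_sum {N : ℕ} {f : Fin N → V → ℝ} {U : Set V} (hU : IsOpen U)
    (hf : ∀ a, ContDiffOn ℝ ∞ (f a) U) {z₀ : V} (hz₀ : z₀ ∈ U)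
    (h : ∀ v ≠ 0, ∃ a, fderiv ℝ (f a) z₀ v ≠ 0) {p : ℕ} {η : V → V [⋀^Fin (2 * p)]→L[ℝ] ℂ}
    (hη : ContDiffOn ℝ ∞ η U) : ∃ U' ⊆ U, IsOpen U' ∧ z₀ ∈ U' ∧
      ∃ c : (Fin p → Fin N ⊕ Fin N × Fin N) → V → ℂ, (∀ J, ContDiffOn ℝ ∞ (c J) U') ∧
        ∀ z ∈ U', rootAvg (η z) = ∑ J, c J z •
          wprod p fun i => ddbar (fun y => (quadratic f (J i) y : ℂ)) z := by
  have := finiteDimensional_form (V := V) (2 * p)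
  have hsm : ∀ c : ℂ, ∀ α : V [⋀^Fin (2 * p)]→L[ℝ] ℂ, rootAvg (c • α) = c • rootAvg α :=
    fun c α => by
      ext v
      simp only [rootAvg_apply, ContinuousAlternatingMap.smul_apply, ← Finset.smul_sum,
        mul_smul_comm]
  let Ψ : (Fin p → Fin N ⊕ Fin N × Fin N) → V → V [⋀^Fin (2 * p)]→L[ℝ] ℂ := fun J z =>
    wprod p fun i => ddbar (fun y => (quadratic f (J i) y : ℂ)) z
  have h1 : ∀ J, ContDiffOn ℝ ∞ (Ψ J) U := fun J =>
    contDiffOn_wprod fun i => contDiffOn_ddbar hU (contDiffOn_quadratic hf _)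
  have h2 : ∀ J, ∀ z ∈ U, ∀ c : ℂ, rootAvgCLM V p (c • Ψ J z) = c • Ψ J z := fun J z hz c => by
    rw [rootAvgCLM_apply, hsm,
      rootAvg_wprod_ddbar hU (fun i => contDiffOn_quadratic hf _) hz]
  exact exists_contDiffOn_coeff hU h1 (rootAvgCLM V p) h2 hz₀
    (fun τ => rootAvg_mem_span_ddbar hU hf hz₀ h τ) hη

end Generation

end ChernForms

end

noncomputable section

namespace ChernForms

open Filter

/-! ### Averaging of forms -/

section LocalAverage

variable {V : Type*} [NormedAddCommGroup V] [NormedSpace ℂ V]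

theorem form_sum_apply {k : ℕ} {ι : Type*} (s : Finset ι) (α : ι → V [⋀^Fin k]→L[ℝ] ℂ)
    (v : Fin k → V) : (∑ i ∈ s, α i) v = ∑ i ∈ s, α i v :=
  map_sum (evalForm v) α s

theorem differentiableAt_form_apply {k : ℕ} {α : V → V [⋀^Fin k]→L[ℝ] ℂ} {z : V}
    (h : DifferentiableAt ℝ α z) (v : Fin k → V) : DifferentiableAt ℝ (fun y => α y v) z :=
  (evalFormCLM v).differentiableAt.comp z h

theorem localD_sum {ε : ℂ} {k : ℕ} {ι : Type*} (s : Finset ι)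
    {α : ι → V → V [⋀^Fin k]→L[ℝ] ℂ} {z : V} (h : ∀ i ∈ s, DifferentiableAt ℝ (α i) z) :
    localD ε (fun y => ∑ i ∈ s, α i y) z = ∑ i ∈ s, localD ε (α i) z := by
  ext v
  rw [localD_apply' (DifferentiableAt.fun_sum h), form_sum_apply,
    Finset.sum_congr rfl fun i hi => localD_apply' (h i hi) v, Finset.sum_comm]
  refine Finset.sum_congr rfl fun j _ => ?_
  simp only [form_sum_apply]
  rw [dOp_sum s fun i hi => differentiableAt_form_apply (h i hi) _, Finset.mul_sum]

theorem localD_const_smul {ε : ℂ} {k : ℕ} (c : ℂ) {α : V → V [⋀^Fin k]→L[ℝ] ℂ} {z : V}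
    (h : DifferentiableAt ℝ α z) : localD ε (fun y => c • α y) z = c • localD ε α z := by
  ext v
  rw [localD_apply' (h.fun_const_smul c), ContinuousAlternatingMap.smul_apply, localD_apply' h,
    Finset.smul_sum]
  refine Finset.sum_congr rfl fun j _ => ?_
  simp only [ContinuousAlternatingMap.smul_apply, smul_eq_mul]
  rw [dOp_const_mul c (differentiableAt_form_apply h _)]
  ring

theorem differentiableAt_compRot {k : ℕ} {α : V → V [⋀^Fin k]→L[ℝ] ℂ} {z : V}
    (h : DifferentiableAt ℝ α z) (ζ : ℂ) :
    DifferentiableAt ℝ (fun y => (α y).compContinuousLinearMap (rot ζ)) z :=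
  h.continuousAlternatingMapCompContinuousLinearMap (differentiableAt_const _)

/-- The operators `∂` and `∂̄` and the multiplication of the arguments by a complex number. -/
theorem localD_compRot {ε ζ χ : ℂ} (hε : ε ^ 2 = -1) (hχ : χ = ζ.re - ε * ζ.im) {k : ℕ}
    {α : V → V [⋀^Fin k]→L[ℝ] ℂ} {z : V} (h : DifferentiableAt ℝ α z) :
    (localD ε α z).compContinuousLinearMap (rot ζ) =
      χ • localD ε (fun y => (α y).compContinuousLinearMap (rot ζ)) z := by
  have hdec : ∀ v : V, ζ • v = ζ.re • v + ζ.im • (Complex.I • v) := fun v => by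
    conv_lhs => rw [← Complex.re_add_im ζ]
    rw [add_smul, mul_smul, Complex.coe_smul, Complex.coe_smul]
  have hI : ∀ v : V, Complex.I • ζ • v = ζ.re • (Complex.I • v) + (-ζ.im) • v := fun v => by
    rw [hdec, smul_add, smul_comm Complex.I ζ.re, smul_comm Complex.I ζ.im, smul_smul Complex.I,
      Complex.I_mul_I, neg_one_smul, smul_neg, neg_smul]
  have hlin : ∀ (f : V → ℂ) (a : V), dOp ε f z (ζ • a) = χ * dOp ε f z a := fun f a => by
    rw [dOp, dOp, hI, hdec, hχ]
    simp only [dir, map_add, map_smul, Complex.real_smul]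
    push_cast
    linear_combination (1 / 2 * ζ.im * fderiv ℝ f z (Complex.I • a)) * hε
  ext v
  rw [ContinuousAlternatingMap.compContinuousLinearMap_apply, ContinuousAlternatingMap.smul_apply,
    localD_apply' h, localD_apply' (differentiableAt_compRot h ζ), smul_eq_mul, Finset.mul_sum]
  refine Finset.sum_congr rfl fun j _ => ?_
  rw [Function.comp_apply, rot_apply, hlin, mul_left_comm]
  rfl

variable [FiniteDimensional ℂ V]

theorem localDelbar_localDel_sum {U : Set V} (hU : IsOpen U) {k : ℕ} {ι : Type*} (s : Finset ι)
    {α : ι → V → V [⋀^Fin k]→L[ℝ] ℂ} (h : ∀ i, ContDiffOn ℝ ∞ (α i) U) {z : V} (hz : z ∈ U) :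
    localDelbar (localDel fun y => ∑ i ∈ s, α i y) z =
      ∑ i ∈ s, localDelbar (localDel (α i)) z := by
  have hd : ∀ {k : ℕ} {α : V → V [⋀^Fin k]→L[ℝ] ℂ}, ContDiffOn ℝ ∞ α U → ∀ y ∈ U,
      DifferentiableAt ℝ α y :=
    fun h y hy => (h.contDiffAt (hU.mem_nhds hy)).differentiableAt (by simp)
  simp only [localDel_eq, localDelbar_eq]
  rw [← localD_sum s fun i _ => hd (contDiffOn_localD hU (h i)) z hz]
  refine localD_congr ?_
  filter_upwards [hU.mem_nhds hz] with y hy using localD_sum s fun i _ => hd (h i) y hy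

theorem localDelbar_localDel_const_smul {U : Set V} (hU : IsOpen U) {k : ℕ} (c : ℂ)
    {α : V → V [⋀^Fin k]→L[ℝ] ℂ} (h : ContDiffOn ℝ ∞ α U) {z : V} (hz : z ∈ U) :
    localDelbar (localDel fun y => c • α y) z = c • localDelbar (localDel α) z := by
  have hd : ∀ {k : ℕ} {α : V → V [⋀^Fin k]→L[ℝ] ℂ}, ContDiffOn ℝ ∞ α U → ∀ y ∈ U,
      DifferentiableAt ℝ α y :=
    fun h y hy => (h.contDiffAt (hU.mem_nhds hy)).differentiableAt (by simp)
  simp only [localDel_eq, localDelbar_eq]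
  rw [← localD_const_smul c (hd (contDiffOn_localD hU h) z hz)]
  refine localD_congr ?_
  filter_upwards [hU.mem_nhds hz] with y hy using localD_const_smul c (hd h y hy)

theorem contDiffOn_compRot {U : Set V} {k : ℕ} {α : V → V [⋀^Fin k]→L[ℝ] ℂ}
    (h : ContDiffOn ℝ ∞ α U) (ζ : ℂ) :
    ContDiffOn ℝ ∞ (fun y => (α y).compContinuousLinearMap (rot ζ)) U :=
  contDiffOn_form fun _ => contDiffOn_form_apply h _

/-- Passing through `∂` yields the factor `ζ` and passing through `∂̄` its conjugate; their product
is `1` on the unit circle. -/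
theorem localDelbar_localDel_compRot {U : Set V} (hU : IsOpen U) {ζ : ℂ} (hζ : ‖ζ‖ = 1) {k : ℕ}
    {α : V → V [⋀^Fin k]→L[ℝ] ℂ} (h : ContDiffOn ℝ ∞ α U) {z : V} (hz : z ∈ U) :
    localDelbar (localDel fun y => (α y).compContinuousLinearMap (rot ζ)) z =
      (localDelbar (localDel α) z).compContinuousLinearMap (rot ζ) := by
  have hd : ∀ {k : ℕ} {α : V → V [⋀^Fin k]→L[ℝ] ℂ}, ContDiffOn ℝ ∞ α U → ∀ y ∈ U,
      DifferentiableAt ℝ α y :=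
    fun h y hy => (h.contDiffAt (hU.mem_nhds hy)).differentiableAt (by simp)
  simp only [localDel_eq, localDelbar_eq]
  have e1 : (fun y => (localD (-Complex.I) α y).compContinuousLinearMap (rot ζ)) =ᶠ[𝓝 z]
      fun y => ζ • localD (-Complex.I) (fun y => (α y).compContinuousLinearMap (rot ζ)) y := by
    filter_upwards [hU.mem_nhds hz] with y hy
    refine localD_compRot (by simp) ?_ (hd h y hy)
    linear_combination -(Complex.re_add_im ζ)
  have hnorm : conj ζ * ζ = 1 := by
    rw [mul_comm, Complex.mul_conj, Complex.normSq_eq_norm_sq, hζ]; simp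
  rw [localD_compRot (χ := conj ζ) (by simp) (by
      apply Complex.ext <;> simp) (hd (contDiffOn_localD hU h) z hz),
    localD_congr e1,
    localD_const_smul ζ (hd (contDiffOn_localD hU (contDiffOn_compRot h ζ)) z hz), smul_smul,
    hnorm, one_smul]

/-- Allows `η` to be replaced by its `(p, p)` part: averaging commutes with `∂̄∂`, and `∂̄∂η` is
already invariant. -/
theorem localDelbar_localDel_rootAvg {U : Set V} (hU : IsOpen U) {p : ℕ}
    {α : V → V [⋀^Fin (2 * p)]→L[ℝ] ℂ} (h : ContDiffOn ℝ ∞ α U) {z : V} (hz : z ∈ U)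
    (hinv : ∀ ζ : ℂ, ‖ζ‖ = 1 → (localDelbar (localDel α) z).compContinuousLinearMap (rot ζ) =
      localDelbar (localDel α) z) :
    localDelbar (localDel fun y => rootAvg (α y)) z = localDelbar (localDel α) z := by
  unfold rootAvg
  have h1 : ∀ k, ContDiffOn ℝ ∞ (fun y => (α y).compContinuousLinearMap (rot (rootPow p k))) U :=
    fun k => contDiffOn_compRot h _
  rw [localDelbar_localDel_const_smul hU _ (ContDiffOn.sum fun k _ => h1 k) hz,
    localDelbar_localDel_sum hU _ h1 hz, Finset.sum_congr rfl fun k _ =>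
      (localDelbar_localDel_compRot hU (norm_rootPow p k) h hz).trans (hinv _ (norm_rootPow p k)),
    Finset.sum_const, Finset.card_range, ← Nat.cast_smul_eq_nsmul ℂ, smul_smul, inv_mul_cancel₀,
    one_smul]
  exact_mod_cast (2 * p).succ_ne_zero

end LocalAverage

/-! ### Generation of the forms of type `(p, p)` on a manifold -/

section Global

variable {V : Type*} [NormedAddCommGroup V] [NormedSpace ℂ V] [FiniteDimensional ℂ V]
  {X : Type*} [TopologicalSpace X] [ChartedSpace V X]

omit [FiniteDimensional ℂ V] in
theorem inChart_rootAvg {p : ℕ} (α : Form V X (2 * p)) (e : OpenPartialHomeomorph X V) (z : V) :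
    inChart (fun x => rootAvg (α x)) e z = rootAvg (inChart α e z) := by
  ext v
  rw [inChart_eq, inChart_eq, ContinuousAlternatingMap.compContinuousLinearMap_apply,
    rootAvg_apply, rootAvg_apply]
  simp only [ContinuousAlternatingMap.compContinuousLinearMap_apply]
  congr 1
  refine Finset.sum_congr rfl fun k _ => congrArg _ ?_
  funext i
  exact ((chartDeriv e z).map_smul _ _).symm

variable [IsManifold 𝓘(ℂ, V) ω X]

omit [FiniteDimensional ℂ V] in
theorem eq_of_inChart_eq {k : ℕ} {α β : Form V X k} {e : OpenPartialHomeomorph X V}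
    (he : e ∈ atlas V X) {x : X} (hx : x ∈ e.source)
    (h : inChart α e (e x) = inChart β e (e x)) : α x = β x := by
  have hc := chart_mem_atlas V x
  have hcx := (chartAt V x).left_inv (mem_chart_source V x)
  have key : ∀ α : Form V X k, α x = (inChart α e (e x)).compContinuousLinearMap
      ((fderiv ℂ (fun y => e ((chartAt V x).symm y)) (chartAt V x x)).restrictScalars ℝ) :=
    fun α => by
      have h1 := (inChart_eventuallyEq α hc he (mem_chart_target V x)
        (by rwa [hcx])).self_of_nhds
      change _ = (inChart α e (e ((chartAt V x).symm (chartAt V x x)))).compContinuousLinearMap _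
        at h1
      rwa [inChart_chartAt, hcx] at h1
  rw [key α, key β, h]

theorem inChart_sum_smul_wprod {ι : Type*} [Fintype ι] {p : ℕ} (g : ι → X → ℂ)
    (F : ι → Fin p → SmoothFn V X) {e : OpenPartialHomeomorph X V} (he : e ∈ atlas V X) {z : V}
    (hz : z ∈ e.target) :
    inChart (fun x => ∑ J, g J x • wprod p fun i => ddbarLM V X (F J i) x) e z =
      ∑ J, g J (e.symm z) • wprod p fun i => ddbar ((fun x => (F J i x : ℂ)) ∘ e.symm) z := by
  have h : ∀ u : SmoothFn V X, ddbar ((fun x => (u x : ℂ)) ∘ e.symm) z =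
      (ddbarLM V X u (e.symm z)).compContinuousLinearMap ((chartDeriv e z).restrictScalars ℝ) :=
    fun u => (inChart_ddbarForm (contMDiff_ofReal u.contMDiff) he hz).symm
  simp only [h, wprod_compContinuousLinearMap]
  ext v
  rw [inChart_eq, ContinuousAlternatingMap.compContinuousLinearMap_apply, form_sum_apply,
    form_sum_apply]
  rfl

/-- `∂̄∂` of a combination of products of forms `∂̄∂u`. -/
theorem delbar_del_of_rootAvg_eq {ι : Type*} [Fintype ι] {p : ℕ} {η : Form V X (2 * p)}
    (hη : IsSmooth η) (htype : IsOfType (p + 1) (p + 1) (k := 2 * (p + 1)) (delbar (del η)))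
    {g : ι → X → ℂ} (hg : ∀ J, ContMDiff 𝓘(ℝ, V) 𝓘(ℝ, ℂ) ∞ (g J)) (F : ι → Fin p → SmoothFn V X)
    (h : ∀ x, rootAvg (η x) = ∑ J, g J x • wprod p fun i => ddbarLM V X (F J i) x) (x : X) :
    delbar (del η) x = ∑ J, (wprod (p + 1) (Fin.cons (ddbarForm V (g J) x)
      fun i => ddbarLM V X (F J i) x) : V [⋀^Fin (2 * (p + 1))]→L[ℝ] ℂ) := by
  have hc := chart_mem_atlas V x
  have hx := mem_chart_target V x
  have hU := (chartAt V x).open_target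
  have hF : ∀ J i, ContDiffOn ℝ ∞ ((fun x => (F J i x : ℂ)) ∘ (chartAt V x).symm)
      (chartAt V x).target := fun J i => contDiffOn_chart (contMDiff_ofReal (F J i).contMDiff) hc
  have h1 := delbar_del_apply hη x
  have h2 := localDelbar_localDel_rootAvg hU (hη _ hc) hx fun ζ hζ => by
    rw [← h1]
    ext v
    refine (htype x ζ v).trans ?_
    rw [← mul_pow, Complex.mul_conj, Complex.normSq_eq_norm_sq, hζ]
    simp
  have h3 : (fun z => rootAvg (inChart η (chartAt V x) z)) =ᶠ[𝓝 (chartAt V x x)] fun z =>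
      ∑ J, (g J ∘ (chartAt V x).symm) z • wprod p fun i =>
        ddbar ((fun x => (F J i x : ℂ)) ∘ (chartAt V x).symm) z := by
    filter_upwards [hU.mem_nhds hx] with z hz
    rw [← inChart_rootAvg, funext h, inChart_sum_smul_wprod g F hc hz]
    rfl
  have h4 : localDelbar (localDel fun z => rootAvg (inChart η (chartAt V x) z)) (chartAt V x x) =
      localDelbar (localDel fun z => ∑ J, (g J ∘ (chartAt V x).symm) z • wprod p fun i =>
        ddbar ((fun x => (F J i x : ℂ)) ∘ (chartAt V x).symm) z) (chartAt V x x) := by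
    simp only [localDel_eq, localDelbar_eq]
    refine localD_congr ?_
    filter_upwards [h3.eventuallyEq_nhds] with z hz using localD_congr hz
  rw [h1, ← h2, h4]
  refine (localDelbar_localDel_sum hU Finset.univ (α := fun J z =>
    (g J ∘ (chartAt V x).symm) z • wprod p fun i =>
      ddbar ((fun x => (F J i x : ℂ)) ∘ (chartAt V x).symm) z) (fun J =>
    (contDiffOn_chart (hg J) hc).smul
      (contDiffOn_wprod fun i => contDiffOn_ddbar hU (hF J i))) hx).trans ?_
  refine Finset.sum_congr rfl fun J _ => ?_
  have h5 := localDelbar_localDel_smul_wprod hU (contDiffOn_chart (hg J) hc)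
    (fun i => contDiffOn_ddbar hU (hF J i)) (fun ε i z hz => localD_ddbar hU (hF J i) hz) hx
  refine h5.trans ?_
  rw [ddbarForm_apply (hg J)]
  congr 2
  funext i
  exact (ddbarForm_apply (contMDiff_ofReal (F J i).contMDiff) x).symm

/-- The smooth functions `f_a` and `f_a f_b`. -/
def quadraticFn {N : ℕ} {f : Fin N → X → ℝ} (hf : ∀ a, ContMDiff 𝓘(ℝ, V) 𝓘(ℝ, ℝ) ∞ (f a))
    (k : Fin N ⊕ Fin N × Fin N) : SmoothFn V X :=
  ⟨quadratic f k, match k with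
    | .inl a => hf a
    | .inr ab => contDiff_mul.contMDiff.comp ((hf ab.1).prodMk_space (hf ab.2))⟩

theorem quadratic_comp {Y Z : Type*} {N : ℕ} (f : Fin N → Y → ℝ) (s : Z → Y) (z : Z) :
    ∀ k, quadratic (fun a => f a ∘ s) k z = quadratic f k (s z)
  | .inl _ => rfl
  | .inr _ => rfl

/-- The averages of smooth forms are combinations of products of forms `∂̄∂u`. -/
theorem exists_rootAvg_eq [T2Space X] [SecondCountableTopology X] {p : ℕ} {η : Form V X (2 * p)}
    (hη : IsSmooth η) : ∃ (ι : Type) (_ : Fintype ι) (g : ι → X → ℂ)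
      (F : ι → Fin p → SmoothFn V X), (∀ J, ContMDiff 𝓘(ℝ, V) 𝓘(ℝ, ℂ) ∞ (g J)) ∧
      ∀ x, rootAvg (η x) = ∑ J, g J x • wprod p fun i => ddbarLM V X (F J i) x := by
  have : FiniteDimensional ℝ V := FiniteDimensional.complexToReal V
  have := isManifold_real V X
  have : LocallyCompactSpace X := ChartedSpace.locallyCompactSpace V X
  obtain ⟨N, f, hf, himm⟩ := exists_immersion V X
  let F : (Fin p → Fin N ⊕ Fin N × Fin N) → Fin p → SmoothFn V X := fun J i => quadraticFn hf (J i)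
  -- The admissible coefficients at a point form an affine space, in particular a convex set, so
  -- local smooth solutions are glued by a partition of unity.
  obtain ⟨g, hg⟩ := exists_contMDiffMap_forall_mem_convex_of_local 𝓘(ℝ, V) (n := ⊤)
    (t := fun x => {c : (Fin p → Fin N ⊕ Fin N × Fin N) → ℂ |
      rootAvg (η x) = ∑ J, c J • wprod p fun i => ddbarLM V X (F J i) x})
    (fun x c hc d hd a b _ _ hab => by
      change rootAvg (η x) = _
      have e1 : ∀ J, (a • c + b • d) J • (wprod p fun i => ddbarLM V X (F J i) x) =
          a • (c J • wprod p fun i => ddbarLM V X (F J i) x) +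
            b • (d J • wprod p fun i => ddbarLM V X (F J i) x) := fun J => by
        ext v
        simp only [Pi.add_apply, Pi.smul_apply, ContinuousAlternatingMap.add_apply,
          ContinuousAlternatingMap.smul_apply, smul_eq_mul, Complex.real_smul]
        ring
      have e2 := (Finset.sum_congr (s₁ := Finset.univ) rfl fun J _ => e1 J).trans
        Finset.sum_add_distrib
      rw [← Finset.smul_sum, ← Finset.smul_sum, ← (show rootAvg (η x) = _ from hc),
        ← (show rootAvg (η x) = _ from hd), ← add_smul, hab, one_smul] at e2
      exact e2.symm)
    fun x => by
      obtain ⟨e, he, hx, hsep⟩ := himm x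
      obtain ⟨U', hU', hU'o, hxU', c, hc, hceq⟩ := exists_rootAvg_eq_sum e.open_target
        (fun a => contDiffOn_chart (hf a) he) (e.map_source hx) hsep (hη e he)
      refine ⟨e.source ∩ e ⁻¹' U', (e.isOpen_inter_preimage hU'o).mem_nhds ⟨hx, hxU'⟩,
        fun y J => c J (e y), ?_, fun y hy => ?_⟩
      · have h1 : ContMDiffOn 𝓘(ℝ, V) 𝓘(ℝ, (Fin p → Fin N ⊕ Fin N × Fin N) → ℂ) ∞
            (fun z J => c J z) U' := (contDiffOn_pi.2 hc).contMDiffOn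
        exact h1.comp ((contMDiffOn_of_mem_maximalAtlas (I := 𝓘(ℝ, V)) (n := ∞)
          (IsManifold.subset_maximalAtlas he)).mono Set.inter_subset_left) fun y hy => hy.2
      · refine eq_of_inChart_eq (α := fun x => rootAvg (η x)) (β := fun y =>
          ∑ J, c J (e y) • wprod p fun i => ddbarLM V X (F J i) y) he hy.1 ?_
        rw [inChart_rootAvg, inChart_sum_smul_wprod (fun J y => c J (e y)) F he
          (e.map_source hy.1), hceq _ hy.2, e.left_inv hy.1]
        simp only [quadratic_comp]
        rfl
  refine ⟨_, inferInstance, fun J x => g x J, F, fun J => ?_, hg⟩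
  exact (ContinuousLinearMap.proj (R := ℝ) (φ := fun _ : Fin p → Fin N ⊕ Fin N × Fin N => ℂ)
    J).contDiff.contMDiff.comp g.contMDiff

end Global

end ChernForms

end

noncomputable section

namespace ChernForms

/-! ### Reality, and conclusion -/

section Conclusion

variable {V : Type*} [NormedAddCommGroup V] [NormedSpace ℂ V] [FiniteDimensional ℂ V]
  {X : Type*} [TopologicalSpace X] [ChartedSpace V X] [IsManifold 𝓘(ℂ, V) ω X]

omit [FiniteDimensional ℂ V] in
theorem conj_wprod {p : ℕ} {θ : Fin p → V [⋀^Fin 2]→L[ℝ] ℂ} (h : ∀ i v, conj (θ i v) = -θ i v)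
    (v : Fin (2 * p) → V) : conj (wprod p θ v) = (-1) ^ p * wprod p θ v := by
  rw [wprod_apply, altSum]
  simp only [map_mul, map_sum, map_prod, map_pow, h, Finset.prod_neg, Finset.card_univ,
    Fintype.card_fin]
  rw [map_div₀, map_one, Complex.conj_ofNat, Finset.mul_sum, Finset.mul_sum, Finset.mul_sum]
  refine Finset.sum_congr rfl fun σ _ => ?_
  rw [map_intCast]
  ring

/-- By `ddbar_apply`, `∂̄∂` of a real function is `i / 2` times a real expression. The resulting
sign `(-1) ^ m` in an `m`-fold product is cancelled by conjugating `(i/2π) ^ m`. -/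
theorem conj_ddbar_ofReal {f : V → ℝ} {U : Set V} (hU : IsOpen U)
    (hf : ContDiffOn ℝ ∞ (fun y => (f y : ℂ)) U) {z : V} (hz : z ∈ U) (v : Fin 2 → V) :
    conj (ddbar (fun y => (f y : ℂ)) z v) = -ddbar (fun y => (f y : ℂ)) z v := by
  have hconj : ∀ {g : V → ℂ} {z : V}, DifferentiableAt ℝ g z →
      (∀ᶠ y in 𝓝 z, conj (g y) = g y) → ∀ a, conj (dir g a z) = dir g a z :=
    fun {g z} hg h a => by
      have h1 := (Complex.conjCLE.toContinuousLinearMap.hasFDerivAt.comp z hg.hasFDerivAt).fderiv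
      have h2 : Complex.conjCLE.toContinuousLinearMap ∘ g =ᶠ[𝓝 z] g := h
      rw [h2.fderiv_eq] at h1
      exact (congrArg (fun T => T a) h1).symm
  have hd : ∀ {g : V → ℂ}, ContDiffOn ℝ ∞ g U → ∀ y ∈ U, DifferentiableAt ℝ g y :=
    fun h y hy => (h.contDiffAt (hU.mem_nhds hy)).differentiableAt (by simp)
  have h2 : ∀ a b, conj (dir (dir (fun y => (f y : ℂ)) a) b z) =
      dir (dir (fun y => (f y : ℂ)) a) b z := fun a b => by
    refine hconj (hd (contDiffOn_dir hU hf a) z hz) ?_ b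
    filter_upwards [hU.mem_nhds hz] with y hy
    exact hconj (hd hf y hy) (Filter.Eventually.of_forall fun y => Complex.conj_ofReal _) a
  rw [ddbar_apply hU hf hz, map_mul, map_sub, h2, h2, map_div₀, Complex.conj_I, Complex.conj_ofNat]
  ring

theorem isReal_ddbarProd {m : ℕ} (u : Fin m → SmoothFn V X) : IsReal (ddbarProd V X m u) :=
  fun x v => by
    rw [ddbarProd_apply, ContinuousAlternatingMap.smul_apply, smul_eq_mul, map_mul,
      conj_wprod fun i v => ?_]
    · rw [map_pow, map_div₀, Complex.conj_I, map_mul, Complex.conj_ofReal, Complex.conj_ofNat,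
        neg_div, neg_pow, mul_mul_mul_comm, ← mul_pow]
      simp
    · have h := ddbarForm_apply (contMDiff_ofReal (u i).contMDiff) x
      change conj (ddbarForm V (fun x => (u i x : ℂ)) x v) = -ddbarForm V (fun x => (u i x : ℂ)) x v
      rw [h]
      exact conj_ddbar_ofReal (f := fun y => u i ((chartAt V x).symm y)) (chartAt V x).open_target
        (contDiffOn_chart (contMDiff_ofReal (u i).contMDiff) (chart_mem_atlas V x))
        (mem_chart_target V x) v

theorem ddbarForm_eq_re_im {g : X → ℂ} (a b : SmoothFn V X) (c : ℂ)
    (h : ∀ x, g x = c * (a x + Complex.I * b x)) (x : X) :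
    ddbarForm V g x = c • (ddbarLM V X a x + Complex.I • ddbarLM V X b x) := by
  have ha := contMDiff_ofReal (V := V) a.contMDiff
  have hb := contMDiff_ofReal (V := V) b.contMDiff
  have hIb : ContMDiff 𝓘(ℝ, V) 𝓘(ℝ, ℂ) ∞ fun x => Complex.I * (b x : ℂ) :=
    (contDiff_const.mul contDiff_id).contMDiff.comp hb
  have hsum : ContMDiff 𝓘(ℝ, V) 𝓘(ℝ, ℂ) ∞ fun x => (a x : ℂ) + Complex.I * (b x : ℂ) :=
    ha.add hIb
  rw [funext h, ddbarForm_const_mul c hsum, ddbarForm_add ha hIb, ddbarForm_const_mul _ hb]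
  rfl

theorem ddbarProd_cons {p : ℕ} (a : SmoothFn V X) (F : Fin p → SmoothFn V X) (x : X) :
    ddbarProd V X (p + 1) (Fin.cons a F) x = (Complex.I / (2 * (Real.pi : ℂ))) ^ (p + 1) •
      wprod (p + 1) (Fin.cons (ddbarLM V X a x) fun i => ddbarLM V X (F i) x) := by
  rw [ddbarProd_apply]
  congr 2
  funext i
  refine Fin.cases rfl (fun i => rfl) i

omit [FiniteDimensional ℂ V] in
theorem wprod_cons_add_smul {p : ℕ} (c : ℂ) (A B : V [⋀^Fin 2]→L[ℝ] ℂ)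
    (Φ : Fin p → V [⋀^Fin 2]→L[ℝ] ℂ) : wprod (p + 1) (Fin.cons (c • (A + Complex.I • B)) Φ) =
      c • wprod (p + 1) (Fin.cons A Φ) + Complex.I • c • wprod (p + 1) (Fin.cons B Φ) := by
  have h1 := (wprodMultilinear (V := V) (p + 1)).cons_smul Φ c (A + Complex.I • B)
  have h2 := (wprodMultilinear (V := V) (p + 1)).cons_add Φ A (Complex.I • B)
  have h3 := (wprodMultilinear (V := V) (p + 1)).cons_smul Φ Complex.I B
  refine h1.trans ?_
  rw [h2, h3, smul_add, smul_comm c]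
  rfl

/-- Writing `g_J = c (a_J + i b_J)` with `c = (i/2π) ^ (p + 1)` gives `∂̄∂η = A + iB`, where `A` and
`B` are sums of normalized products of real functions and hence real. Reality of `∂̄∂η` forces `B =
0`. -/
theorem exists_delbar_del_eq_sum_ddbarProd [T2Space X] [SecondCountableTopology X] {p : ℕ}
    {η : Form V X (2 * p)} (hη : IsSmooth η)
    (htype : IsOfType (p + 1) (p + 1) (k := 2 * (p + 1)) (delbar (del η)))
    (hreal : IsReal (delbar (del η))) : ∃ (ι : Type) (_ : Fintype ι)
      (u : ι → Fin (p + 1) → SmoothFn V X),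
      (delbar (del η) : Form V X (2 * (p + 1))) = ∑ J, ddbarProd V X (p + 1) (u J) := by
  obtain ⟨ι, _, g, F, hg, h⟩ := exists_rootAvg_eq hη
  have h1 := delbar_del_of_rootAvg_eq hη htype hg F h
  set c : ℂ := (Complex.I / (2 * (Real.pi : ℂ))) ^ (p + 1) with hc
  have hc0 : c ≠ 0 := pow_ne_zero _ (div_ne_zero Complex.I_ne_zero
    (mul_ne_zero two_ne_zero (Complex.ofReal_ne_zero.2 Real.pi_ne_zero)))
  have hg' : ∀ J, ContMDiff 𝓘(ℝ, V) 𝓘(ℝ, ℂ) ∞ fun x => c⁻¹ * g J x := fun J =>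
    (contDiff_const.mul contDiff_id).contMDiff.comp (hg J)
  let a : ι → SmoothFn V X := fun J =>
    ⟨fun x => (c⁻¹ * g J x).re, Complex.reCLM.contDiff.contMDiff.comp (hg' J)⟩
  let b : ι → SmoothFn V X := fun J =>
    ⟨fun x => (c⁻¹ * g J x).im, Complex.imCLM.contDiff.contMDiff.comp (hg' J)⟩
  have h2 : ∀ J x, ddbarForm V (g J) x =
      c • (ddbarLM V X (a J) x + Complex.I • ddbarLM V X (b J) x) := fun J x => by
    refine ddbarForm_eq_re_im (a J) (b J) c (fun x => ?_) x
    change g J x = c * (((c⁻¹ * g J x).re : ℂ) + Complex.I * ((c⁻¹ * g J x).im : ℂ))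
    rw [mul_comm Complex.I, Complex.re_add_im, mul_inv_cancel_left₀ hc0]
  have h3 : ∀ x, (delbar (del η) x : V [⋀^Fin (2 * (p + 1))]→L[ℝ] ℂ) =
      ∑ J, (ddbarProd V X (p + 1) (Fin.cons (a J) (F J)) x +
        Complex.I • ddbarProd V X (p + 1) (Fin.cons (b J) (F J)) x) := fun x => by
    refine (h1 x).trans (Finset.sum_congr rfl fun J _ => ?_)
    rw [h2, wprod_cons_add_smul, ddbarProd_cons, ddbarProd_cons]
  refine ⟨ι, inferInstance, fun J => Fin.cons (a J) (F J), ?_⟩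
  funext x
  rw [Finset.sum_apply]
  ext v
  have h4 := congrArg (fun α : V [⋀^Fin (2 * (p + 1))]→L[ℝ] ℂ => α v) (h3 x)
  simp only [form_sum_apply, ContinuousAlternatingMap.add_apply,
    ContinuousAlternatingMap.smul_apply, smul_eq_mul, Finset.sum_add_distrib,
    ← Finset.mul_sum] at h4
  have h5 : ∀ u : ι → Fin (p + 1) → SmoothFn V X, conj (∑ J, ddbarProd V X (p + 1) (u J) x v) =
      ∑ J, ddbarProd V X (p + 1) (u J) x v := fun u => by
    rw [map_sum]
    exact Finset.sum_congr rfl fun J _ => isReal_ddbarProd (u J) x v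
  have h6 := hreal x v
  rw [form_sum_apply]
  rw [h4, map_add, map_mul, h5, h5, Complex.conj_I] at h6
  refine h4.trans ?_
  linear_combination (-1 / 2) * h6

theorem mem_chernDiff [T2Space X] [SecondCountableTopology X] {w : (p : ℕ) → Form V X (2 * p)}
    (hw : IsRealDiagonal w) (hexact : IsDelbarDelExact w) : w ∈ chernDiff V X := by
  have : FiniteDimensional ℝ V := FiniteDimensional.complexToReal V
  obtain ⟨η, hη, rfl⟩ := hexact
  have hne : ∀ m p : ℕ, p ≠ m → single (delbarDel η m) p = 0 := fun m p h =>
    Pi.single_eq_of_ne (M := fun p => Form V X (2 * p)) h _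
  -- The family is a finite sum of its components since forms of degree above the real dimension
  -- vanish; the component of degree `0` is zero by definition, so only products with at least one
  -- factor occur.
  have hsum : delbarDel η = ∑ m ∈ Finset.range (Module.finrank ℝ V + 1),
      single (delbarDel η m) := by
    funext p
    rw [Finset.sum_apply]
    by_cases hp : p ∈ Finset.range (Module.finrank ℝ V + 1)
    · rw [Finset.sum_eq_single_of_mem p hp fun m _ hm => hne m p hm.symm]
      exact (Pi.single_eq_same (M := fun p => Form V X (2 * p)) p _).symm
    · rw [Finset.sum_eq_zero fun m hm => hne m p fun h => hp (h ▸ hm)]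
      funext x
      exact eq_zero_of_finrank_lt (by rw [Finset.mem_range] at hp; omega) _
  rw [hsum]
  refine AddSubgroup.sum_mem _ fun m _ => ?_
  cases m with
  | zero =>
    have : single (delbarDel η 0) = 0 := single_zero
    rw [this]
    exact zero_mem _
  | succ p =>
    obtain ⟨ι, _, u, hu⟩ := exists_delbar_del_eq_sum_ddbarProd (hη p) (hw.type (p + 1))
      (hw.real (p + 1))
    have : single (delbarDel η (p + 1)) = ∑ J, single (ddbarProd V X (p + 1) (u J)) := by
      have hu' : delbarDel η (p + 1) = ∑ J, ddbarProd V X (p + 1) (u J) := hu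
      rw [hu']
      exact map_sum (AddMonoidHom.single (fun p => Form V X (2 * p)) (p + 1)) _ _
    rw [this]
    exact AddSubgroup.sum_mem _ fun J _ => single_ddbarProd_mem (by omega) (u J)

end Conclusion

end ChernForms

end

theorem mainTheorem1
    {V : Type*} [NormedAddCommGroup V] [NormedSpace ℂ V] [FiniteDimensional ℂ V]
    {X : Type*} [TopologicalSpace X] [T2Space X] [SecondCountableTopology X]
    [ChartedSpace V X] [IsManifold 𝓘(ℂ, V) ω X]
    (w : (p : ℕ) → ChernForms.Form V X (2 * p))
    (hw : ChernForms.IsRealDiagonal w)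
    (hexact : ChernForms.IsDelbarDelExact w) :
    ∃ (r : ℕ) (h₁ h₂ : ChernForms.HermitianMetric V X r),
      ∀ p, h₁.chernCharacter p - h₂.chernCharacter p = w p :=
  ChernForms.exists_metrics_of_mem_chernDiff (ChernForms.mem_chernDiff hw hexact)
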